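/- Let $\mathbb{F}_q$ be a finite field with $q$ elements. For $n\ge 0$ let $\mathrm{GL}_n=\mathrm{GL}_n(\mathbb{F}_q)$ and let $\mathrm{UT}_n\le \mathrm{GL}_n$ be the subgroup of unipotent upper triangular matrices. An indifference graph on $[n]=\{1,\dots,n\}$ is a simple graph $\gamma$ such that $\{i,l\}\in E(\gamma)$, $i<l$, implies $\{j,k\}\in E(\gamma)$ whenever $i\le j<k\le l$. Put $\mathrm{UT}_\gamma=\{g\in \mathrm{UT}_n : g_{ij}=0 \text{ if } \{i,j\}\in E(\gamma)\}$, and let the superclass $\mathrm{UT}_\gamma^\circ$ be the set of elements of $\mathrm{UT}_\gamma$ that lie in no $\mathrm{UT}_\sigma$ with $\sigma\supsetneq\gamma$ an indifference graph on $[n]$; these sets partition $\mathrm{UT}_n$. Let $\mathsf{scf}(\mathrm{UT}_n)$ be the space of functions $\mathrm{UT}_n\to\mathbb{C}$ that are constant on each superclass, $\mathsf{cf}(\mathrm{GL}_n)$ the space of complex class functions of $\mathrm{GL}_n$, and $$\mathsf{scf}(\mathrm{UT}_\bullet)=\bigoplus_{n\ge0}\mathsf{scf}(\mathrm{UT}_n),\qquad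 \mathsf{cf}(\mathrm{GL}_\bullet)=\bigoplus_{n\ge0}\mathsf{cf}(\mathrm{GL}_n).$$ These are graded connected Hopf algebras over $\mathbb{C}$, as follows; in both, the unit is the constant function $1$ in degree $0$, the counit is the value of the degree $0$ component, and functions on $G\times H$ are identified with tensors by $f\otimes g\leftrightarrow f(x)g(y)$. * On $\mathsf{cf}(\mathrm{GL}_\bullet)$ (Zelevinsky), the product is parabolic induction: inflate $\varphi\otimes\psi$ from $\mathrm{GL}_k\times\mathrm{GL}_l$ to the group $P_{k,l}\le \mathrm{GL}_{k+l}$ of block upper triangular matrices, then induce to $\mathrm{GL}_{k+l}$. The component of the coproduct in degree $(k,l)$ is parabolic restriction: $(a,b)\mapsto q^{-kl}\sum_{u}\psi\begin{pmatrix}a&u\\0&b\end{pmatrix}$, the sum being over all $k\times l$ matrices $u$. * On $\mathsf{scf}(\mathrm{UT}_\bullet)$, the product of $\varphi\in\mathsf{scf}(\mathrm{UT}_k)$ and $\psi\in\mathsf{scf}(\mathrm{UT}_l)$ is the inflation of $\varphi\otimes\psi$ along the map $\mathrm{UT}_{k+l}\to\mathrm{UT}_k\times\mathrm{UT}_l$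 onto the diagonal blocks. The component of the coproduct of $\varphi\in\mathsf{scf}(\mathrm{UT}_n)$ in degree $(k,l)$, $k+l=n$, is the sum over all $A\sqcup B=[n]$ with $|A|=k$, $|B|=l$ of the functions whose value at $(a,b)\in\mathrm{UT}_k\times\mathrm{UT}_l$ is the average of $\varphi(u)$ over all $u\in\mathrm{UT}_n$ with $u_{ij}=0$ for $(i,j)\in B\times A$ and with diagonal blocks $a$ at $A\times A$ and $b$ at $B\times B$ (rows and columns numbered in increasing order). A linear character of a Hopf algebra $H$ is a unital algebra homomorphism $\zeta:H\to\mathbb{C}$; the pair $(H,\zeta)$ is then a combinatorial Hopf algebra (CHA). A CHA morphism $(H,\zeta)\to(H',\zeta')$ is a graded Hopf algebra homomorphism $\Psi:H\to H'$ with $\zeta=\zeta'\circ\Psi$. For a finite group $G$ let $\langle\psi,\chi\rangle=|G|^{-1}\sum_{g}\psi(g)\overline{\chi(g)}$, and let $|\chi\rangle$ denote the functional $\psi\mapsto\langle\psi,\chi\rangle$ and $|\chi^*\rangle=|\chi\rangle/\langle\chi,\chi\rangle$. Let $\delta_{([n],\emptyset)}$ be the indicator function on $\mathrm{UT}_n$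 of the superclass of the edgeless graph, and let $\delta_{(n)}$ be the indicator function on $\mathrm{GL}_n$ of the conjugacy class of the unipotent Jordan block of size $n$. Define linear functionals $$|(q-1)^\bullet\delta^*_{([\bullet],\emptyset)}\rangle=\big((q-1)^n|\delta^*_{([n],\emptyset)}\rangle\big)_{n\ge0}\ \text{on}\ \mathsf{scf}(\mathrm{UT}_\bullet),\qquad |\delta^*_{(\bullet)}\rangle=\big(|\delta^*_{(n)}\rangle\big)_{n\ge0}\ \text{on}\ \mathsf{cf}(\mathrm{GL}_\bullet),$$ and let $\operatorname{Ind}_{\mathrm{UT}}^{\mathrm{GL}}:\mathsf{scf}(\mathrm{UT}_\bullet)\to\mathsf{cf}(\mathrm{GL}_\bullet)$ be induction from $\mathrm{UT}_n$ to $\mathrm{GL}_n$ in each degree $n$. **Theorem.** The functional $|(q-1)^\bullet\delta^*_{([\bullet],\emptyset)}\rangle$ is a linear character of $\mathsf{scf}(\mathrm{UT}_\bullet)$. Moreover, $$|(q-1)^\bullet\delta^*_{([\bullet],\emptyset)}\rangle=|\delta^*_{(\bullet)}\rangle\circ\operatorname{Ind}_{\mathrm{UT}}^{\mathrm{GL}}.$$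 Further, $(\mathsf{scf}(\mathrm{UT}_\bullet),|(q-1)^\bullet\delta^*_{([\bullet],\emptyset)}\rangle)$ and $(\mathsf{cf}(\mathrm{GL}_\bullet),|\delta^*_{(\bullet)}\rangle)$ are combinatorial Hopf algebras (in particular graded connected Hopf algebras), and $\operatorname{Ind}_{\mathrm{UT}}^{\mathrm{GL}}$ is a CHA morphism $$\big(\mathsf{scf}(\mathrm{UT}_\bullet),|(q-1)^\bullet\delta^*_{([\bullet],\emptyset)}\rangle\big)\longrightarrow\big(\mathsf{cf}(\mathrm{GL}_\bullet),|\delta^*_{(\bullet)}\rangle\big).$$ -/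

import Mathlib

noncomputable section

namespace ClassFunctionHopf

open scoped Classical DirectSum TensorProduct

/-! ## Class functions of finite groups -/

section Groups

variable (G : Type*) [Group G]

/-- The space of complex-valued class functions on a group. -/
def cf : Submodule ℂ (G → ℂ) where
  carrier := {φ | ∀ x g : G, φ (x * g * x⁻¹) = φ g}
  add_mem' := by
    intro φ ψ hφ hψ x g
    simp only [Pi.add_apply, hφ x g, hψ x g]
  zero_mem' := by
    intro x g
    rfl
  smul_mem' := by
    intro c φ hφ x g
    simp only [Pi.smul_apply, hφ x g]

variable {G}

/-- The identifier function of the conjugacy class `C`. -/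
def classIndicator (C : ConjClasses G) : cf G where
  val := fun g => if ConjClasses.mk g = C then 1 else 0
  property := by
    intro x g
    have h : ConjClasses.mk (x * g * x⁻¹) = ConjClasses.mk g :=
      ConjClasses.mk_eq_mk_iff_isConj.2 (isConj_iff.2 ⟨x⁻¹, by group⟩)
    simp only [h]

variable [Fintype G]

/-- The usual inner product `⟨φ, ψ⟩ = |G|⁻¹ ∑ g, φ g * conj (ψ g)`. -/
def cfInner (φ ψ : G → ℂ) : ℂ :=
  (Fintype.card G : ℂ)⁻¹ * ∑ g, φ g * (starRingEnd ℂ) (ψ g)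

/-- The functional `|χ⟩ : ψ ↦ ⟨ψ, χ⟩`. -/
def ket (χ : G → ℂ) : (G → ℂ) →ₗ[ℂ] ℂ where
  toFun ψ := cfInner ψ χ
  map_add' := by
    intro φ ψ
    simp only [cfInner, Pi.add_apply, add_mul, Finset.sum_add_distrib, mul_add]
  map_smul' := by
    intro c φ
    simp only [cfInner, Pi.smul_apply, smul_eq_mul, RingHom.id_apply, mul_assoc,
      ← Finset.mul_sum]
    ring

/-- The normalized functional `|χ*⟩ = |χ⟩ / ⟨χ, χ⟩`. -/
def dualKet (χ : G → ℂ) : (G → ℂ) →ₗ[ℂ] ℂ :=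
  (cfInner χ χ)⁻¹ • ket χ

/-- The extension by zero of a function on a subgroup. -/
def extendByZero (K : Subgroup G) (φ : K → ℂ) (g : G) : ℂ :=
  if h : g ∈ K then φ ⟨g, h⟩ else 0

/-- Induction of a function from a subgroup `K` of `G`:
`(Ind φ)(g) = |K|⁻¹ ∑ φ (x g x⁻¹)`, over those `x` in `G` with `x g x⁻¹ ∈ K`. -/
def indFun (K : Subgroup G) (φ : K → ℂ) (g : G) : ℂ :=
  (Fintype.card K : ℂ)⁻¹ * ∑ x : G, extendByZero K φ (x * g * x⁻¹)

/-- Induction, as a linear map to the class functions of `G`. -/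
def ind (K : Subgroup G) : (K → ℂ) →ₗ[ℂ] cf G where
  toFun φ :=
    { val := indFun K φ
      property := by
        intro y g
        unfold indFun
        congr 1
        refine Fintype.sum_equiv (Equiv.mulRight y) _ _ fun x => ?_
        have h : x * (y * g * y⁻¹) * x⁻¹ = (x * y) * g * (x * y)⁻¹ := by group
        simp only [Equiv.coe_mulRight, h] }
  map_add' := by
    intro φ ψ
    apply Subtype.ext
    funext g
    change indFun K (φ + ψ) g = indFun K φ g + indFun K ψ g
    unfold indFun
    rw [← mul_add, ← Finset.sum_add_distrib]
    congr 1
    refine Finset.sum_congr rfl fun x _ => ?_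
    unfold extendByZero
    split_ifs <;> simp
  map_smul' := by
    intro c φ
    apply Subtype.ext
    funext g
    change indFun K (c • φ) g = c * indFun K φ g
    unfold indFun
    rw [mul_left_comm]
    congr 1
    rw [Finset.mul_sum]
    refine Finset.sum_congr rfl fun x _ => ?_
    unfold extendByZero
    split_ifs <;> simp

end Groups

/-! ## Averages -/

section Averages

variable {X Y V W : Type*} [Fintype X] [Fintype Y]
  [AddCommGroup V] [Module ℂ V] [AddCommGroup W] [Module ℂ W]

/-- The average of a function over the points of the finite type `X` that satisfy `p`. -/
def avg (p : X → Prop) : (X → ℂ) →ₗ[ℂ] ℂ :=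
  ((Finset.univ.filter p).card : ℂ)⁻¹ • ∑ x ∈ Finset.univ.filter p, LinearMap.proj x

/-- Let `δ i`, `i : I`, be the identifier functions of the parts `{x | P i x}` of a set partition
of `X`, and `ε j`, `j : J`, those of the parts `{y | Q j y}` of a set partition of `Y`. This sends
a function `Φ` on `X × Y` which is constant on each `{x | P i x} × {y | Q j y}` to the element
`∑ i j, Φ(i, j) • (δ i ⊗ ε j)`, where `Φ(i, j)` is the value (written as the average) of `Φ` on
`{x | P i x} × {y | Q j y}`. It is the inverse of the isomorphism
`f ⊗ g ↦ ((x, y) ↦ f x * g y)`. -/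
def toTensor {I J : Type*} [Fintype I] [Fintype J] (P : I → X → Prop) (Q : J → Y → Prop)
    (δ : I → V) (ε : J → W) : (X → Y → ℂ) →ₗ[ℂ] V ⊗[ℂ] W :=
  ∑ i, ∑ j, (avg (P i) ∘ₗ (LinearMap.pi fun x => avg (Q j) ∘ₗ LinearMap.proj x)).smulRight
    (δ i ⊗ₜ[ℂ] ε j)

end Averages

/-! ## Graded connected Hopf algebras over `ℂ` and linear characters -/

section Hopf

/-- The structure maps (product, unit, coproduct, counit) of a Hopf algebra on `⨁ n, V n`. -/
structure HopfData (V : ℕ → Type*) [∀ n, AddCommGroup (V n)] [∀ n, Module ℂ (V n)] where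
  mul : (⨁ n, V n) →ₗ[ℂ] (⨁ n, V n) →ₗ[ℂ] ⨁ n, V n
  one : ⨁ n, V n
  comul : (⨁ n, V n) →ₗ[ℂ] (⨁ n, V n) ⊗[ℂ] ⨁ n, V n
  counit : (⨁ n, V n) →ₗ[ℂ] ℂ

variable {V W : ℕ → Type*}
  [∀ n, AddCommGroup (V n)] [∀ n, Module ℂ (V n)]
  [∀ n, AddCommGroup (W n)] [∀ n, Module ℂ (W n)]

/-- The homogeneous part of degree `n` of `⨁ n, V n`. -/
def homog (V : ℕ → Type*) [∀ n, AddCommGroup (V n)] [∀ n, Module ℂ (V n)] (n : ℕ) :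
    Submodule ℂ (⨁ n, V n) :=
  LinearMap.range (DirectSum.lof ℂ ℕ V n)

/-- The homogeneous part of degree `n` of the tensor square of `⨁ n, V n`. -/
def homogTensor (V : ℕ → Type*) [∀ n, AddCommGroup (V n)] [∀ n, Module ℂ (V n)] (n : ℕ) :
    Submodule ℂ ((⨁ n, V n) ⊗[ℂ] ⨁ n, V n) :=
  ⨆ p ∈ Finset.HasAntidiagonal.antidiagonal n,
    LinearMap.range (TensorProduct.map (DirectSum.lof ℂ ℕ V p.1) (DirectSum.lof ℂ ℕ V p.2))

/-- The product of the tensor square, `(a ⊗ b)(c ⊗ d) = ac ⊗ bd`. -/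
def HopfData.mulTensor (D : HopfData V) (s t : (⨁ n, V n) ⊗[ℂ] ⨁ n, V n) :
    (⨁ n, V n) ⊗[ℂ] ⨁ n, V n :=
  TensorProduct.map (TensorProduct.lift D.mul) (TensorProduct.lift D.mul)
    (TensorProduct.tensorTensorTensorComm ℂ _ _ _ _ (s ⊗ₜ[ℂ] t))

/-- The structure maps `D` make `⨁ n, V n` a graded connected Hopf algebra over `ℂ`. -/
structure HopfData.IsHopf (D : HopfData V) : Prop where
  mul_assoc : ∀ x y z, D.mul (D.mul x y) z = D.mul x (D.mul y z)
  one_mul : ∀ x, D.mul D.one x = x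
  mul_one : ∀ x, D.mul x D.one = x
  coassoc : ∀ x, TensorProduct.assoc ℂ _ _ _ (D.comul.rTensor _ (D.comul x)) =
    D.comul.lTensor _ (D.comul x)
  counit_left : ∀ x, TensorProduct.lid ℂ _ (D.counit.rTensor _ (D.comul x)) = x
  counit_right : ∀ x, TensorProduct.rid ℂ _ (D.counit.lTensor _ (D.comul x)) = x
  comul_one : D.comul D.one = D.one ⊗ₜ[ℂ] D.one
  comul_mul : ∀ x y, D.comul (D.mul x y) = D.mulTensor (D.comul x) (D.comul y)
  counit_one : D.counit D.one = 1
  counit_mul : ∀ x y, D.counit (D.mul x y) = D.counit x * D.counit y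
  antipode : ∃ S : (⨁ n, V n) →ₗ[ℂ] ⨁ n, V n,
    (∀ x, TensorProduct.lift D.mul (S.rTensor _ (D.comul x)) = D.counit x • D.one) ∧
    (∀ x, TensorProduct.lift D.mul (S.lTensor _ (D.comul x)) = D.counit x • D.one)
  one_mem : D.one ∈ homog V 0
  mul_mem : ∀ m n, ∀ x ∈ homog V m, ∀ y ∈ homog V n, D.mul x y ∈ homog V (m + n)
  comul_mem : ∀ n, ∀ x ∈ homog V n, D.comul x ∈ homogTensor V n
  counit_mem : ∀ n, n ≠ 0 → ∀ x ∈ homog V n, D.counit x = 0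
  connected : Module.finrank ℂ (homog V 0) = 1

/-- A linear character: a unital algebra homomorphism to `ℂ`. -/
structure HopfData.IsLinearCharacter (D : HopfData V) (ζ : (⨁ n, V n) →ₗ[ℂ] ℂ) : Prop where
  map_one : ζ D.one = 1
  map_mul : ∀ x y, ζ (D.mul x y) = ζ x * ζ y

/-- A combinatorial Hopf algebra: a Hopf algebra together with a linear character. -/
structure HopfData.IsCHA (D : HopfData V) (ζ : (⨁ n, V n) →ₗ[ℂ] ℂ) : Prop where
  isHopf : D.IsHopf
  isLinearCharacter : D.IsLinearCharacter ζ

/-- A graded Hopf algebra homomorphism (compatibility with the antipodes is automatic). -/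
structure IsHopfHom (D : HopfData V) (E : HopfData W)
    (Ψ : (⨁ n, V n) →ₗ[ℂ] ⨁ n, W n) : Prop where
  map_homog : ∀ n, ∀ x ∈ homog V n, Ψ x ∈ homog W n
  map_one : Ψ D.one = E.one
  map_mul : ∀ x y, Ψ (D.mul x y) = E.mul (Ψ x) (Ψ y)
  map_comul : ∀ x, TensorProduct.map Ψ Ψ (D.comul x) = E.comul (Ψ x)
  map_counit : ∀ x, E.counit (Ψ x) = D.counit x

/-- A morphism of combinatorial Hopf algebras `(D, ζ) → (E, ξ)`. -/
structure IsCHAMorphism (D : HopfData V) (ζ : (⨁ n, V n) →ₗ[ℂ] ℂ)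
    (E : HopfData W) (ξ : (⨁ n, W n) →ₗ[ℂ] ℂ)
    (Ψ : (⨁ n, V n) →ₗ[ℂ] ⨁ n, W n) : Prop where
  source : D.IsCHA ζ
  target : E.IsCHA ξ
  isHopfHom : IsHopfHom D E Ψ
  comp_eq : ζ = ξ ∘ₗ Ψ

/-- The bilinear map on `⨁ n, V n` with components `V k × V l → V (k + l)`. -/
def gradedMul (m : ∀ k l : ℕ, V k →ₗ[ℂ] V l →ₗ[ℂ] V (k + l)) :
    (⨁ n, V n) →ₗ[ℂ] (⨁ n, V n) →ₗ[ℂ] ⨁ n, V n :=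
  DirectSum.toModule ℂ ℕ _ fun k =>
    LinearMap.flip (DirectSum.toModule ℂ ℕ _ fun l =>
      LinearMap.flip ((m k l).compr₂ (DirectSum.lof ℂ ℕ V (k + l))))

/-- The map `⨁ n, V n → (⨁ n, V n) ⊗ (⨁ n, V n)` with components `V n → V k ⊗ V l`,
`k + l = n`. -/
def gradedComul (d : ∀ k l n : ℕ, k + l = n → (V n →ₗ[ℂ] V k ⊗[ℂ] V l)) :
    (⨁ n, V n) →ₗ[ℂ] (⨁ n, V n) ⊗[ℂ] ⨁ n, V n :=
  DirectSum.toModule ℂ ℕ _ fun n =>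
    ∑ p ∈ (Finset.HasAntidiagonal.antidiagonal n).attach,
      TensorProduct.map (DirectSum.lof ℂ ℕ V p.1.1) (DirectSum.lof ℂ ℕ V p.1.2) ∘ₗ
        d p.1.1 p.1.2 n (Finset.HasAntidiagonal.mem_antidiagonal.1 p.2)

end Hopf

/-! ## Block matrices -/

section Blocks

variable {F : Type*} [Field F]

/-- For order embeddings `e`, `f` with complementary ranges `A`, `B`: the matrix `M` maps the
span of the basis vectors indexed by `A` to itself, its diagonal block at `A` is `a`, and its
diagonal block at `B` is `b`. -/
def HasBlocks {k l n : ℕ} (e : Fin k ↪o Fin n) (f : Fin l ↪o Fin n)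
    (M : Matrix (Fin n) (Fin n) F) (a : Matrix (Fin k) (Fin k) F)
    (b : Matrix (Fin l) (Fin l) F) : Prop :=
  M.submatrix e e = a ∧ M.submatrix f f = b ∧ M.submatrix f e = 0

/-- The embedding onto the first `k` indices of `Fin n`, `n = k + l`. -/
def firstEmb {k l n : ℕ} (h : k + l = n) : Fin k ↪o Fin n :=
  (Fin.castAddOrderEmb l).trans (Fin.castOrderIso h).toOrderEmbedding

/-- The embedding onto the last `l` indices of `Fin n`, `n = k + l`. -/
def lastEmb {k l n : ℕ} (h : k + l = n) : Fin l ↪o Fin n :=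
  (Fin.natAddOrderEmb k).trans (Fin.castOrderIso h).toOrderEmbedding

/-- Unipotent upper triangular matrices: `M - 1` has nonzero entries only above the diagonal. -/
def IsUnitri {n : ℕ} (M : Matrix (Fin n) (Fin n) F) : Prop :=
  ∀ i j, (M - 1) i j ≠ 0 → i < j

theorem IsUnitri.mul {n : ℕ} {M N : Matrix (Fin n) (Fin n) F} (hM : IsUnitri M)
    (hN : IsUnitri N) : IsUnitri (M * N) := by
  intro i j hij
  by_contra hlt
  apply hij
  have key : M * N - 1 = (M - 1) * (N - 1) + (M - 1) + (N - 1) := by noncomm_ring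
  have h1 : (M - 1) i j = 0 := by_contra fun hne => hlt (hM i j hne)
  have h2 : (N - 1) i j = 0 := by_contra fun hne => hlt (hN i j hne)
  rw [key, Matrix.add_apply, Matrix.add_apply, h1, h2, Matrix.mul_apply, add_zero, add_zero]
  refine Finset.sum_eq_zero fun m _ => ?_
  by_contra hne
  exact hlt ((hM i m (left_ne_zero_of_mul hne)).trans (hN m j (right_ne_zero_of_mul hne)))

theorem IsUnitri.det {n : ℕ} {M : Matrix (Fin n) (Fin n) F} (hM : IsUnitri M) : M.det = 1 := by
  rw [Matrix.det_of_isUpperTriangular]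
  · refine Finset.prod_eq_one fun i _ => ?_
    by_contra hne
    refine lt_irrefl i (hM i i ?_)
    rwa [Matrix.sub_apply, Matrix.one_apply_eq, sub_ne_zero]
  · intro i j hij
    by_contra hne
    have hij' : j < i := hij
    refine lt_asymm hij' (hM i j ?_)
    rwa [Matrix.sub_apply, Matrix.one_apply_ne (ne_of_gt hij'), sub_zero]

theorem IsUnitri.submatrix {k n : ℕ} {M : Matrix (Fin n) (Fin n) F} (hM : IsUnitri M)
    (e : Fin k ↪o Fin n) : IsUnitri (M.submatrix e e) := by
  intro i j hij
  refine e.lt_iff_lt.1 (hM (e i) (e j) ?_)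
  simpa [Matrix.one_apply] using hij

end Blocks

variable (F : Type*) [Field F] [Fintype F]

/-! ## The Hopf algebra of class functions of the general linear groups -/

/-- The group `GL_n` over `F`. -/
abbrev GLn (n : ℕ) : Type _ := Matrix.GeneralLinearGroup (Fin n) F

/-- The inflation of `(a, b) ↦ φ a * ψ b` from `GL_k × GL_l` to the group of block upper
triangular matrices in `GL_{k+l}`, extended by zero to `GL_{k+l}`. -/
def glInfl {k l : ℕ} (φ : GLn F k → ℂ) (ψ : GLn F l → ℂ) (g : GLn F (k + l)) : ℂ :=
  ∑ a : GLn F k, ∑ b : GLn F l,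
    if HasBlocks (firstEmb rfl) (lastEmb rfl) g.val a.val b.val then φ a * ψ b else 0

/-- Parabolic induction: `φ` and `ψ` are inflated to the group `P` of block upper triangular
matrices with diagonal blocks in `GL_k` and `GL_l`, and the result is induced to `GL_{k+l}`.
Here `|P| = |GL_k| |GL_l| q ^ (k l)`. -/
def glMulFun {k l : ℕ} (φ : GLn F k → ℂ) (ψ : GLn F l → ℂ) (g : GLn F (k + l)) : ℂ :=
  ((Fintype.card (GLn F k) * Fintype.card (GLn F l) * Fintype.card F ^ (k * l) : ℕ) : ℂ)⁻¹ *
    ∑ x : GLn F (k + l), glInfl F φ ψ (x * g * x⁻¹)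

theorem glMulFun_conj {k l : ℕ} (φ : GLn F k → ℂ) (ψ : GLn F l → ℂ) (y g : GLn F (k + l)) :
    glMulFun F φ ψ (y * g * y⁻¹) = glMulFun F φ ψ g := by
  unfold glMulFun
  refine congrArg _ (Fintype.sum_equiv (Equiv.mulRight y) _ _ fun x => ?_)
  have h : x * (y * g * y⁻¹) * x⁻¹ = (x * y) * g * (x * y)⁻¹ := by group
  rw [Equiv.coe_mulRight, h]

theorem glMulFun_add_left {k l : ℕ} (φ φ' : GLn F k → ℂ) (ψ : GLn F l → ℂ)
    (g : GLn F (k + l)) :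
    glMulFun F (φ + φ') ψ g = glMulFun F φ ψ g + glMulFun F φ' ψ g := by
  have h : ∀ x, glInfl F (φ + φ') ψ x = glInfl F φ ψ x + glInfl F φ' ψ x := by
    intro x
    simp only [glInfl, ← Finset.sum_add_distrib, Pi.add_apply]
    refine Finset.sum_congr rfl fun a _ => Finset.sum_congr rfl fun b _ => ?_
    split_ifs <;> ring
  unfold glMulFun
  rw [← mul_add, ← Finset.sum_add_distrib]
  exact congrArg _ (Finset.sum_congr rfl fun x _ => h _)

theorem glMulFun_add_right {k l : ℕ} (φ : GLn F k → ℂ) (ψ ψ' : GLn F l → ℂ)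
    (g : GLn F (k + l)) :
    glMulFun F φ (ψ + ψ') g = glMulFun F φ ψ g + glMulFun F φ ψ' g := by
  have h : ∀ x, glInfl F φ (ψ + ψ') x = glInfl F φ ψ x + glInfl F φ ψ' x := by
    intro x
    simp only [glInfl, ← Finset.sum_add_distrib, Pi.add_apply]
    refine Finset.sum_congr rfl fun a _ => Finset.sum_congr rfl fun b _ => ?_
    split_ifs <;> ring
  unfold glMulFun
  rw [← mul_add, ← Finset.sum_add_distrib]
  exact congrArg _ (Finset.sum_congr rfl fun x _ => h _)

theorem glMulFun_smul_left {k l : ℕ} (c : ℂ) (φ : GLn F k → ℂ) (ψ : GLn F l → ℂ)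
    (g : GLn F (k + l)) : glMulFun F (c • φ) ψ g = c * glMulFun F φ ψ g := by
  have h : ∀ x, glInfl F (c • φ) ψ x = c * glInfl F φ ψ x := by
    intro x
    simp only [glInfl, Finset.mul_sum, Pi.smul_apply, smul_eq_mul]
    refine Finset.sum_congr rfl fun a _ => Finset.sum_congr rfl fun b _ => ?_
    split_ifs <;> ring
  unfold glMulFun
  rw [Finset.sum_congr rfl fun x _ => h (x * g * x⁻¹), ← Finset.mul_sum, mul_left_comm]

theorem glMulFun_smul_right {k l : ℕ} (c : ℂ) (φ : GLn F k → ℂ) (ψ : GLn F l → ℂ)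
    (g : GLn F (k + l)) : glMulFun F φ (c • ψ) g = c * glMulFun F φ ψ g := by
  have h : ∀ x, glInfl F φ (c • ψ) x = c * glInfl F φ ψ x := by
    intro x
    simp only [glInfl, Finset.mul_sum, Pi.smul_apply, smul_eq_mul]
    refine Finset.sum_congr rfl fun a _ => Finset.sum_congr rfl fun b _ => ?_
    split_ifs <;> ring
  unfold glMulFun
  rw [Finset.sum_congr rfl fun x _ => h (x * g * x⁻¹), ← Finset.mul_sum, mul_left_comm]

/-- Parabolic induction, as a bilinear map. -/
def glMul (k l : ℕ) : cf (GLn F k) →ₗ[ℂ] cf (GLn F l) →ₗ[ℂ] cf (GLn F (k + l)) :=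
  LinearMap.mk₂ ℂ
    (fun φ ψ => ⟨glMulFun F φ.val ψ.val, fun y g => glMulFun_conj F φ.val ψ.val y g⟩)
    (fun φ φ' ψ => Subtype.ext (funext fun g => glMulFun_add_left F φ.val φ'.val ψ.val g))
    (fun c φ ψ => Subtype.ext (funext fun g => glMulFun_smul_left F c φ.val ψ.val g))
    (fun φ ψ ψ' => Subtype.ext (funext fun g => glMulFun_add_right F φ.val ψ.val ψ'.val g))
    (fun c φ ψ => Subtype.ext (funext fun g => glMulFun_smul_right F c φ.val ψ.val g))

/-- Parabolic restriction, as a function on `GL_k × GL_l`: the restriction of `ψ` to the block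
upper triangular matrices, averaged over the matrices with diagonal blocks `a` and `b`. -/
def glRes {k l n : ℕ} (h : k + l = n) : (GLn F n → ℂ) →ₗ[ℂ] (GLn F k → GLn F l → ℂ) :=
  LinearMap.pi fun a => LinearMap.pi fun b =>
    avg fun g => HasBlocks (firstEmb h) (lastEmb h) g.val a.val b.val

/-- The component `cf(GL_n) → cf(GL_k) ⊗ cf(GL_l)` of the coproduct: parabolic restriction. -/
def glComul (k l n : ℕ) (h : k + l = n) :
    cf (GLn F n) →ₗ[ℂ] cf (GLn F k) ⊗[ℂ] cf (GLn F l) :=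
  toTensor (fun (C : ConjClasses (GLn F k)) a => ConjClasses.mk a = C)
    (fun (C : ConjClasses (GLn F l)) b => ConjClasses.mk b = C)
    classIndicator classIndicator ∘ₗ glRes F h ∘ₗ (cf (GLn F n)).subtype

/-- Zelevinsky's Hopf algebra `cf(GL_•) = ⨁ n, cf(GL_n)`: the unit is the constant function `1`
in degree zero and the counit is the value of the degree zero component. -/
def glHopf : HopfData fun n => cf (GLn F n) where
  mul := gradedMul (glMul F)
  one := DirectSum.lof ℂ ℕ (fun n => cf (GLn F n)) 0 ⟨fun _ => 1, fun _ _ => rfl⟩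
  comul := gradedComul (glComul F)
  counit := DirectSum.toModule ℂ ℕ ℂ fun n =>
    if n = 0 then LinearMap.proj 1 ∘ₗ (cf (GLn F n)).subtype else 0

/-! ## Superclass functions of the unipotent upper triangular groups -/

/-- The unipotent upper triangular subgroup `UT_n` of `GL_n`. -/
def UT (n : ℕ) : Subgroup (GLn F n) where
  carrier := {g | IsUnitri g.val}
  one_mem' := by
    intro i j h
    exact absurd (by simp) h
  mul_mem' := fun hg hh => IsUnitri.mul hg hh
  inv_mem' := by
    intro g hg
    have hpow : ∀ m : ℕ, IsUnitri (g ^ m).val := by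
      intro m
      induction m with
      | zero =>
        intro i j h
        exact absurd (by simp) h
      | succ m ih =>
        rw [pow_succ]
        exact IsUnitri.mul ih hg
    have hinv : g⁻¹ = g ^ (orderOf g - 1) := by
      rw [inv_eq_iff_mul_eq_one, ← pow_succ', Nat.sub_add_cancel (orderOf_pos g),
        pow_orderOf_eq_one]
    change IsUnitri (g⁻¹).val
    rw [hinv]
    exact hpow _

variable {F} in
/-- The element of `UT_n` given by a unipotent upper triangular matrix. -/
def UT.mk {n : ℕ} (M : Matrix (Fin n) (Fin n) F) (h : IsUnitri M) : UT F n :=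
  ⟨Matrix.GeneralLinearGroup.mkOfDetNeZero M (by rw [h.det]; exact one_ne_zero), h⟩

variable {F} in
/-- The diagonal block of an element of `UT_n` at the range of an order embedding. -/
def UT.block {k n : ℕ} (e : Fin k ↪o Fin n) (u : UT F n) : UT F k :=
  UT.mk (u.val.val.submatrix e e) (IsUnitri.submatrix u.property e)

/-- Indifference graphs on the vertex set `Fin n`. -/
def IsIndifference {n : ℕ} (γ : SimpleGraph (Fin n)) : Prop :=
  ∀ i l, i < l → γ.Adj i l → ∀ j k, i ≤ j → j < k → k ≤ l → γ.Adj j k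

/-- The type of indifference graphs of size `n`. -/
abbrev IndiffGraph (n : ℕ) : Type := {γ : SimpleGraph (Fin n) // IsIndifference γ}

/-- The edgeless graph, as an indifference graph. -/
def edgeless (n : ℕ) : IndiffGraph n :=
  ⟨⊥, fun _ _ _ h => h.elim⟩

variable {F} in
/-- Membership in the normal pattern subgroup `UT_γ`: the entries at the edges of `γ` vanish. -/
def InPattern {n : ℕ} (γ : IndiffGraph n) (u : UT F n) : Prop :=
  ∀ i j, γ.val.Adj i j → u.val.val i j = 0

variable {F} in
/-- Membership in the superclass of `γ`: the elements of `UT_γ` which lie in no `UT_σ` for an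
indifference graph `σ` that properly contains `γ`. -/
def InSuperclass {n : ℕ} (γ : IndiffGraph n) (u : UT F n) : Prop :=
  InPattern γ u ∧ ∀ σ : IndiffGraph n, γ < σ → ¬ InPattern σ u

/-- The space `scf(UT_n)` of functions which are constant on each superclass. -/
def scf (n : ℕ) : Submodule ℂ (UT F n → ℂ) where
  carrier := {φ | ∀ γ : IndiffGraph n, ∀ u v, InSuperclass γ u → InSuperclass γ v → φ u = φ v}
  add_mem' := by
    intro φ ψ hφ hψ γ u v hu hv
    simp only [Pi.add_apply, hφ γ u v hu hv, hψ γ u v hu hv]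
  zero_mem' := by
    intro γ u v hu hv
    rfl
  smul_mem' := by
    intro c φ hφ γ u v hu hv
    simp only [Pi.smul_apply, hφ γ u v hu hv]

variable {F} in
theorem InSuperclass.eq {n : ℕ} {γ σ : IndiffGraph n} {u : UT F n} (h : InSuperclass γ u)
    (h' : InSuperclass σ u) : γ = σ := by
  let τ : IndiffGraph n := ⟨γ.val ⊔ σ.val, by
    intro i l hil hadj j k hij hjk hkl
    rcases hadj with hadj | hadj
    · exact Or.inl (γ.property i l hil hadj j k hij hjk hkl)
    · exact Or.inr (σ.property i l hil hadj j k hij hjk hkl)⟩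
  have hτ : InPattern τ u := by
    intro i j hadj
    rcases hadj with hadj | hadj
    · exact h.1 i j hadj
    · exact h'.1 i j hadj
  have h1 : γ ≤ τ := (le_sup_left : γ.val ≤ γ.val ⊔ σ.val)
  have h2 : σ ≤ τ := (le_sup_right : σ.val ≤ γ.val ⊔ σ.val)
  have e1 : γ = τ := by
    by_contra hne
    exact h.2 τ (lt_of_le_of_ne h1 hne) hτ
  have e2 : σ = τ := by
    by_contra hne
    exact h'.2 τ (lt_of_le_of_ne h2 hne) hτ
  exact e1.trans e2.symm

/-- The identifier function `δ_γ` of the superclass of `γ`. -/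
def superclassIndicator {n : ℕ} (γ : IndiffGraph n) : scf F n where
  val := fun u => if InSuperclass γ u then 1 else 0
  property := by
    intro σ u v hu hv
    by_cases h : γ = σ
    · subst h
      simp only [hu, hv]
    · have hu' : ¬ InSuperclass γ u := fun h' => h (h'.eq hu)
      have hv' : ¬ InSuperclass γ v := fun h' => h (h'.eq hv)
      simp only [hu', hv']

/-- If `u` and `v` lie in one superclass, then so do their diagonal blocks at an interval. -/
theorem InSuperclass.block {k n : ℕ} {γ : IndiffGraph n} {u v : UT F n}
    (hu : InSuperclass γ u) (hv : InSuperclass γ v) (e : Fin k ↪o Fin n)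
    (he : ∀ a b : Fin k, ∀ c, e a ≤ c → c ≤ e b → c ∈ Set.range e) :
    ∃ σ : IndiffGraph k, InSuperclass σ (UT.block e u) ∧ InSuperclass σ (UT.block e v) := by
  let σ : IndiffGraph k := ⟨γ.val.comap e, by
    intro i l hil hadj j m hij hjm hml
    exact γ.property (e i) (e l) (e.lt_iff_lt.2 hil) hadj (e j) (e m) (e.le_iff_le.2 hij)
      (e.lt_iff_lt.2 hjm) (e.le_iff_le.2 hml)⟩
  have key : ∀ w : UT F n, InSuperclass γ w → InSuperclass σ (UT.block e w) := by
    intro w hw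
    refine ⟨fun i j hadj => hw.1 (e i) (e j) hadj, fun τ hτ hin => ?_⟩
    let ρ : IndiffGraph n := ⟨γ.val ⊔ τ.val.map e.toEmbedding, by
      intro i l hil hadj j m hij hjm hml
      rcases hadj with hadj | hadj
      · exact Or.inl (γ.property i l hil hadj j m hij hjm hml)
      · obtain ⟨a, b, hab, rfl, rfl⟩ := (SimpleGraph.map_adj _ _ _ _).1 hadj
        obtain ⟨c, rfl⟩ := he a b j hij (hjm.le.trans hml)
        obtain ⟨d, rfl⟩ := he a b m (hij.trans hjm.le) hml
        exact Or.inr ((SimpleGraph.map_adj _ _ _ _).2 ⟨c, d, τ.property a b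
          (e.lt_iff_lt.1 hil) hab c d (e.le_iff_le.1 hij) (e.lt_iff_lt.1 hjm)
          (e.le_iff_le.1 hml), rfl, rfl⟩)⟩
    refine hw.2 ρ (lt_of_le_not_ge (le_sup_left : γ.val ≤ ρ.val) fun hle => ?_) ?_
    · refine not_le_of_gt hτ ?_
      intro i j hadj
      exact hle (Or.inr ((SimpleGraph.map_adj _ _ _ _).2 ⟨i, j, hadj, rfl, rfl⟩))
    · intro i j hadj
      rcases hadj with hadj | hadj
      · exact hw.1 i j hadj
      · obtain ⟨a, b, hab, rfl, rfl⟩ := (SimpleGraph.map_adj _ _ _ _).1 hadj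
        exact hin a b hab
  exact ⟨σ, key u hu, key v hv⟩

theorem firstEmb_interval {k l n : ℕ} (h : k + l = n) (a b : Fin k) (c : Fin n)
    (_ : firstEmb h a ≤ c) (hc : c ≤ firstEmb h b) : c ∈ Set.range (firstEmb h) := by
  have hc' : (c : ℕ) ≤ (b : ℕ) := hc
  exact ⟨⟨c, hc'.trans_lt b.isLt⟩, rfl⟩

theorem lastEmb_interval {k l n : ℕ} (h : k + l = n) (a b : Fin l) (c : Fin n)
    (hc : lastEmb h a ≤ c) (_ : c ≤ lastEmb h b) : c ∈ Set.range (lastEmb h) := by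
  have hc' : k + (a : ℕ) ≤ (c : ℕ) := hc
  have hcn : (c : ℕ) < n := c.isLt
  refine ⟨⟨c - k, by omega⟩, Fin.ext ?_⟩
  change k + ((c : ℕ) - k) = c
  omega

/-- The component `scf(UT_k) × scf(UT_l) → scf(UT_{k+l})` of the product: inflation along the
homomorphism `UT_{k+l} → UT_k × UT_l` onto the two diagonal blocks. -/
def utMul (k l : ℕ) : scf F k →ₗ[ℂ] scf F l →ₗ[ℂ] scf F (k + l) :=
  LinearMap.mk₂ ℂ
    (fun φ ψ =>
      { val := fun u => φ.val (UT.block (firstEmb rfl) u) * ψ.val (UT.block (lastEmb rfl) u)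
        property := by
          intro γ u v hu hv
          obtain ⟨σ, h1, h2⟩ := hu.block F hv (firstEmb rfl) (firstEmb_interval rfl)
          obtain ⟨τ, h3, h4⟩ := hu.block F hv (lastEmb rfl) (lastEmb_interval rfl)
          simp only [φ.property σ _ _ h1 h2, ψ.property τ _ _ h3 h4] })
    (fun φ φ' ψ => Subtype.ext (funext fun u => add_mul _ _ _))
    (fun c φ ψ => Subtype.ext (funext fun u => mul_assoc _ _ _))
    (fun φ ψ ψ' => Subtype.ext (funext fun u => mul_add _ _ _))
    (fun c φ ψ => Subtype.ext (funext fun u => mul_left_comm _ _ _))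

/-- The sum over the set compositions `(A, B)` of the `n` indices with `|A| = k`, `|B| = l` (given
by the order embeddings `e`, `f` onto `A`, `B`) of the following function on `UT_k × UT_l`:
restrict `φ` to the subgroup of the matrices in `UT_n` with zero entries at `B × A`, and deflate
to the quotient `UT_A × UT_B ≅ UT_k × UT_l` of this subgroup, that is, average over the matrices
with diagonal blocks `a` and `b`. -/
def utRes (k l n : ℕ) : (UT F n → ℂ) →ₗ[ℂ] (UT F k → UT F l → ℂ) :=
  LinearMap.pi fun a => LinearMap.pi fun b =>
    ∑ e : Fin k ↪o Fin n, ∑ f : Fin l ↪o Fin n,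
      if IsCompl (Set.range e) (Set.range f) then
        avg fun u => HasBlocks e f u.val.val a.val.val b.val.val
      else 0

/-- The component `scf(UT_n) → scf(UT_k) ⊗ scf(UT_l)` of the coproduct. -/
def utComul (k l n : ℕ) (_ : k + l = n) : scf F n →ₗ[ℂ] scf F k ⊗[ℂ] scf F l :=
  toTensor (fun (γ : IndiffGraph k) a => InSuperclass γ a)
    (fun (γ : IndiffGraph l) b => InSuperclass γ b)
    (superclassIndicator F) (superclassIndicator F) ∘ₗ utRes F k l n ∘ₗ (scf F n).subtype

/-- The Hopf algebra `scf(UT_•) = ⨁ n, scf(UT_n)`: the unit is the constant function `1`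
in degree zero and the counit is the value of the degree zero component. -/
def utHopf : HopfData fun n => scf F n where
  mul := gradedMul (utMul F)
  one := DirectSum.lof ℂ ℕ (fun n => scf F n) 0 ⟨fun _ => 1, fun _ _ _ _ _ => rfl⟩
  comul := gradedComul (utComul F)
  counit := DirectSum.toModule ℂ ℕ ℂ fun n =>
    if n = 0 then LinearMap.proj 1 ∘ₗ (scf F n).subtype else 0

/-! ## The linear functionals and induction -/

/-- The unipotent Jordan block of size `n`. -/
def jordanBlock (n : ℕ) : UT F n :=
  UT.mk (Matrix.of fun i j => if i = j ∨ (i : ℕ) + 1 = j then 1 else 0) (by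
    intro i j h
    by_contra hlt
    apply h
    rw [Matrix.sub_apply, Matrix.of_apply, Matrix.one_apply]
    by_cases hij : i = j
    · simp [hij]
    · have : ¬ (i : ℕ) + 1 = j := fun h' => hlt (Fin.lt_def.2 (by omega))
      simp [hij, this])

/-- The functional `(|δ*_{(n)}⟩)_n` on `cf(GL_•)`, where `δ_{(n)}` is the identifier function of
the conjugacy class of regular unipotent elements of `GL_n`. -/
def glChar : (⨁ n, cf (GLn F n)) →ₗ[ℂ] ℂ :=
  DirectSum.toModule ℂ ℕ ℂ fun n =>
    dualKet (classIndicator (ConjClasses.mk (jordanBlock F n).val)).val ∘ₗ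
      (cf (GLn F n)).subtype

/-- The functional `((q - 1) ^ n |δ*_{([n], ∅)}⟩)_n` on `scf(UT_•)`. -/
def utChar : (⨁ n, scf F n) →ₗ[ℂ] ℂ :=
  DirectSum.toModule ℂ ℕ ℂ fun n =>
    ((Fintype.card F : ℂ) - 1) ^ n •
      (dualKet (superclassIndicator F (edgeless n)).val ∘ₗ (scf F n).subtype)

/-- Induction `scf(UT_•) → cf(GL_•)`, which is induction from `UT_n` to `GL_n` in degree `n`. -/
def indUTGL : (⨁ n, scf F n) →ₗ[ℂ] ⨁ n, cf (GLn F n) :=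
  DirectSum.toModule ℂ ℕ _ fun n =>
    DirectSum.lof ℂ ℕ (fun n => cf (GLn F n)) n ∘ₗ ind (UT F n) ∘ₗ (scf F n).subtype

end ClassFunctionHopf

end

/-! Elements of `cf(GL_•)` are determined by their values at invertible matrices, and tensors by the
products of two such evaluations. The Hopf axioms for `cf(GL_•)` and the compatibility of induction
with products and coproducts thus become identities between finite sums over groups of matrices.
Matrices are indexed by arbitrary finite types, so that block decompositions are sums of types.

In these terms the product of `cf(GL_•)` sums an inflated function over all conjugates, and the
coproduct averages over the block above the diagonal. Associativity is transitivity of induction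
(`conjSum_infl_conjSum`), and coassociativity regroups blocks. The hard axiom is multiplicativity of
the coproduct. It rests on a Mackey formula (`sum_conjSum_blockUpper`): a function induced from a
subgroup `K` and restricted to a parabolic subgroup `P` splits over the double cosets of `K` and
`P`. If `K` is parabolic as well, these are indexed by the two-by-two arrays of natural numbers with
given margins, which also index the terms of the product of the two coproducts.

For `scf(UT_•)` the indicators of the pattern subgroups span. On them the product places two graphs
side by side, and the coproduct runs over all ways to split the vertex set into `A` and `B`, with
weight `q⁻¹` for each edge that ascends from `A` to `B` (`comul_finsetElem`). The axioms reduce to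
set combinatorics and to the multiplicativity of these weights. In both cases the antipode is a
geometric series, finite in each degree by connectedness.

Induction respects products by transitivity, since `UT_(k+l)` is the preimage of `UT_k × UT_l` in
the block upper triangular group. It respects coproducts by the same Mackey formula with `K = UT_n`:
Gaussian elimination (`exists_mul_support`) shows that the double cosets of `UT_n` and `P`
correspond to the pairs `(A, B)`, that is, to the terms of the coproduct of `scf(UT_•)`.

Both functionals are evaluations at the Jordan block `J`, up to the factor `(q - 1) ^ n`. On
`scf(UT_•)` this is multiplicative because diagonal blocks of `J` are Jordan blocks. On `cf(GL_•)`
it is multiplicative because the only subspaces invariant under `J` are those of the standard flag,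
so that only conjugation by elements of `P` contributes to an induced value. Finally, all
unitriangular conjugates of `J` lie in the superclass of the edgeless graph. Hence the induced value
of `φ` at `J` is `c_n φ(J)`, where `c_n` is the value for `φ = 1`. The constant functions are powers
of the one in degree one, so `c_n = c_1 ^ n`, and `c_1 = |GL_1| = q - 1`. -/

noncomputable section

namespace ClassFunctionHopf

open scoped Classical DirectSum TensorProduct

/-! ## Separating functionals on tensor products -/

section Separation

variable {V W U : Type*} [AddCommMonoid V] [Module ℂ V] [AddCommMonoid W] [Module ℂ W]
  [AddCommMonoid U] [Module ℂ U]

/-- The functional `v ⊗ w ↦ p v * q w`. -/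
def tensorEval (p : V →ₗ[ℂ] ℂ) (q : W →ₗ[ℂ] ℂ) : V ⊗[ℂ] W →ₗ[ℂ] ℂ :=
  TensorProduct.lift ((LinearMap.mul ℂ ℂ).compl₁₂ p q)

@[simp]
theorem tensorEval_tmul (p : V →ₗ[ℂ] ℂ) (q : W →ₗ[ℂ] ℂ) (v : V) (w : W) :
    tensorEval p q (v ⊗ₜ[ℂ] w) = p v * q w := rfl

/-- A family of functionals that separates points. -/
def Separates {I : Type*} (p : I → V →ₗ[ℂ] ℂ) : Prop :=
  ∀ v w, (∀ i, p i v = p i w) → v = w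

theorem Separates.ext {I : Type*} {p : I → V →ₗ[ℂ] ℂ} (hp : Separates p) {v w : V}
    (h : ∀ i, p i v = p i w) : v = w := hp v w h

/-- Contracting the second factor with `q j` leaves an element of `V`, which the functionals `p i`
determine. In a basis of `V`, a tensor is a family of elements of `W`, and the value of `q j` at
such an element is a coordinate of the contraction by `q j`. -/
theorem Separates.tensor {I J : Type*} {p : I → V →ₗ[ℂ] ℂ} {q : J → W →ₗ[ℂ] ℂ}
    (hp : Separates p) (hq : Separates q) :
    Separates fun x : I × J => tensorEval (p x.1) (q x.2) := by
  intro t t' ht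
  let _ := Module.addCommMonoidToAddCommGroup ℂ (M := V)
  let b := Module.Basis.ofVectorSpace ℂ V
  have h1 : ∀ j, TensorProduct.rid ℂ V ((q j).lTensor V t) =
      TensorProduct.rid ℂ V ((q j).lTensor V t') := by
    intro j
    refine hp _ _ fun i => ?_
    have h2 : p i ∘ₗ (TensorProduct.rid ℂ V).toLinearMap ∘ₗ (q j).lTensor V
        = tensorEval (p i) (q j) := by
      ext v w
      simp [mul_comm]
    exact (LinearMap.congr_fun h2 t).trans
      ((ht (i, j)).trans (LinearMap.congr_fun h2 t').symm)
  apply (TensorProduct.equivFinsuppOfBasisLeft (N := W) b).injective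
  refine Finsupp.ext fun s => hq _ _ fun j => ?_
  have h4 : q j ∘ₗ Finsupp.lapply s ∘ₗ (TensorProduct.equivFinsuppOfBasisLeft (N := W) b).toLinearMap
      = Finsupp.lapply s ∘ₗ b.repr.toLinearMap ∘ₗ
        (TensorProduct.rid ℂ V).toLinearMap ∘ₗ (q j).lTensor V := by
    ext v w
    simp [mul_comm]
  refine (LinearMap.congr_fun h4 t).trans (Eq.trans ?_ (LinearMap.congr_fun h4 t').symm)
  simp only [LinearMap.comp_apply, LinearEquiv.coe_coe, h1]

variable {V W : Type*} [AddCommGroup V] [Module ℂ V] [AddCommGroup W] [Module ℂ W]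
variable {X Y : Type*} [Fintype X] [Fintype Y]

theorem avg_apply (P : X → Prop) (f : X → ℂ) :
    avg P f = ((Finset.univ.filter P).card : ℂ)⁻¹ * ∑ x ∈ Finset.univ.filter P, f x := by
  simp [avg, LinearMap.sum_apply]

theorem avg_eq_of_forall (P : X → Prop) (f : X → ℂ) (x : X) (hx : P x)
    (h : ∀ y, P y → f y = f x) : avg P f = f x := by
  rw [avg_apply, Finset.sum_congr rfl fun y hy => h y (Finset.mem_filter.1 hy).2,
    Finset.sum_const, nsmul_eq_mul, ← mul_assoc, inv_mul_cancel₀, one_mul]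
  have : x ∈ Finset.univ.filter P := by simpa using hx
  exact_mod_cast (Finset.card_pos.2 ⟨x, this⟩).ne'

/-- By `hp` and `hq` the functionals act on the indicators like evaluation at points of the parts
`i` and `j`. Only the term `(i, j)` survives, and it is the average of a constant. -/
theorem tensorEval_toTensor {I J : Type*} [Fintype I] [Fintype J] {P : I → X → Prop}
    {Q : J → Y → Prop} {δ : I → V} {ε : J → W} (p : V →ₗ[ℂ] ℂ) (q : W →ₗ[ℂ] ℂ)
    {Φ : X → Y → ℂ} (x : X) (y : Y) (i : I) (j : J) (hi : P i x) (hj : Q j y)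
    (hp : ∀ i', p (δ i') = if i' = i then 1 else 0)
    (hq : ∀ j', q (ε j') = if j' = j then 1 else 0)
    (hΦ : ∀ x' y', P i x' → Q j y' → Φ x' y' = Φ x y) :
    tensorEval p q (toTensor P Q δ ε Φ) = Φ x y := by
  unfold toTensor
  simp only [LinearMap.sum_apply, map_sum, LinearMap.smulRight_apply, map_smul, tensorEval_tmul,
    hp, hq, smul_eq_mul]
  rw [Finset.sum_eq_single i, Finset.sum_eq_single j]
  · simp only [if_true, mul_one]
    rw [LinearMap.comp_apply]
    refine (avg_eq_of_forall (P i) _ x hi ?_).trans ?_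
    · intro x' hx'
      simp only [LinearMap.pi_apply, LinearMap.comp_apply, LinearMap.proj_apply]
      rw [avg_eq_of_forall (Q j) _ y hj fun y' hy' => by rw [hΦ _ _ hx' hy', hΦ _ _ hx' hj],
        avg_eq_of_forall (Q j) _ y hj fun y' hy' => by rw [hΦ _ _ hi hy'], hΦ _ _ hx' hj]
    · simp only [LinearMap.pi_apply, LinearMap.comp_apply, LinearMap.proj_apply]
      exact avg_eq_of_forall (Q j) _ y hj fun y' hy' => by rw [hΦ _ _ hi hy']
  · intro j' _ hj'
    simp [hj']
  · simp
  · intro i' _ hi'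
    simp [hi']
  · simp

end Separation

/-! ## Graded structure maps -/

section Graded

variable {V W : ℕ → Type*}
  [∀ n, AddCommGroup (V n)] [∀ n, Module ℂ (V n)]
  [∀ n, AddCommGroup (W n)] [∀ n, Module ℂ (W n)]

@[simp]
theorem gradedMul_lof (m : ∀ k l : ℕ, V k →ₗ[ℂ] V l →ₗ[ℂ] V (k + l)) (k l : ℕ) (x : V k)
    (y : V l) : gradedMul m (DirectSum.lof ℂ ℕ V k x) (DirectSum.lof ℂ ℕ V l y) =
      DirectSum.lof ℂ ℕ V (k + l) (m k l x y) := by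
  simp [gradedMul, LinearMap.flip_apply, DirectSum.toModule_lof]

theorem gradedComul_lof (d : ∀ k l n : ℕ, k + l = n → (V n →ₗ[ℂ] V k ⊗[ℂ] V l)) (n : ℕ)
    (x : V n) : gradedComul d (DirectSum.lof ℂ ℕ V n x) =
      ∑ p ∈ (Finset.HasAntidiagonal.antidiagonal n).attach,
      TensorProduct.map (DirectSum.lof ℂ ℕ V p.1.1) (DirectSum.lof ℂ ℕ V p.1.2)
        (d p.1.1 p.1.2 n (Finset.HasAntidiagonal.mem_antidiagonal.1 p.2) x) := by
  simp [gradedComul, DirectSum.toModule_lof, LinearMap.sum_apply]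

theorem gradedMul_mem (m : ∀ k l : ℕ, V k →ₗ[ℂ] V l →ₗ[ℂ] V (k + l)) (k l : ℕ) :
    ∀ x ∈ homog V k, ∀ y ∈ homog V l, gradedMul m x y ∈ homog V (k + l) := by
  rintro _ ⟨x, rfl⟩ _ ⟨y, rfl⟩
  rw [gradedMul_lof]
  exact ⟨_, rfl⟩

theorem gradedComul_mem (d : ∀ k l n : ℕ, k + l = n → (V n →ₗ[ℂ] V k ⊗[ℂ] V l)) (n : ℕ) :
    ∀ x ∈ homog V n, gradedComul d x ∈ homogTensor V n := by
  rintro _ ⟨x, rfl⟩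
  rw [gradedComul_lof]
  refine Submodule.sum_mem _ fun p _ => ?_
  exact Submodule.mem_iSup_of_mem p.1 (Submodule.mem_iSup_of_mem p.2 ⟨_, rfl⟩)

/-- All the axioms of a graded connected Hopf algebra except for the antipode. -/
structure HopfData.IsBialgebra (D : HopfData V) : Prop where
  mul_assoc : ∀ x y z, D.mul (D.mul x y) z = D.mul x (D.mul y z)
  one_mul : ∀ x, D.mul D.one x = x
  mul_one : ∀ x, D.mul x D.one = x
  coassoc : ∀ x, TensorProduct.assoc ℂ _ _ _ (D.comul.rTensor _ (D.comul x)) =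
    D.comul.lTensor _ (D.comul x)
  counit_left : ∀ x, TensorProduct.lid ℂ _ (D.counit.rTensor _ (D.comul x)) = x
  counit_right : ∀ x, TensorProduct.rid ℂ _ (D.counit.lTensor _ (D.comul x)) = x
  comul_one : D.comul D.one = D.one ⊗ₜ[ℂ] D.one
  comul_mul : ∀ x y, D.comul (D.mul x y) = D.mulTensor (D.comul x) (D.comul y)
  counit_one : D.counit D.one = 1
  counit_mul : ∀ x y, D.counit (D.mul x y) = D.counit x * D.counit y
  one_mem : D.one ∈ homog V 0
  mul_mem : ∀ m n, ∀ x ∈ homog V m, ∀ y ∈ homog V n, D.mul x y ∈ homog V (m + n)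
  comul_mem : ∀ n, ∀ x ∈ homog V n, D.comul x ∈ homogTensor V n
  counit_mem : ∀ n, n ≠ 0 → ∀ x ∈ homog V n, D.counit x = 0
  connected : Module.finrank ℂ (homog V 0) = 1

namespace HopfData.IsBialgebra

variable {D : HopfData V} (h : D.IsBialgebra)

/-- The ring structure given by the product. -/
abbrev ring : Ring (⨁ n, V n) where
  __ := (inferInstance : AddCommGroup (⨁ n, V n))
  mul x y := D.mul x y
  one := D.one
  mul_assoc := h.mul_assoc
  one_mul := h.one_mul
  mul_one := h.mul_one
  left_distrib x y z := (D.mul x).map_add y z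
  right_distrib x y z := D.mul.map_add₂ x y z
  zero_mul x := D.mul.map_zero₂ x
  mul_zero x := (D.mul x).map_zero

/-- The algebra structure given by the product. -/
abbrev algebra : @Algebra ℂ (⨁ n, V n) _ h.ring.toSemiring :=
  letI := h.ring
  Algebra.ofModule (fun c x y => D.mul.map_smul₂ c x y) (fun c x y => (D.mul x).map_smul c y)

/-- The coalgebra structure given by the coproduct. -/
abbrev coalgebra : Coalgebra ℂ (⨁ n, V n) where
  comul := D.comul
  counit := D.counit
  coassoc := LinearMap.ext h.coassoc
  rTensor_counit_comp_comul := LinearMap.ext fun x => by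
    apply (TensorProduct.lid ℂ _).injective
    simpa using h.counit_left x
  lTensor_counit_comp_comul := LinearMap.ext fun x => by
    apply (TensorProduct.rid ℂ _).injective
    simpa using h.counit_right x

-- Degree zero is a line spanned by the unit, which is nonzero because its counit is `1`; the counit
-- reads off the coefficient.
include h in
theorem eq_counit_smul_one (x : ⨁ n, V n) (hx : x ∈ homog V 0) : x = D.counit x • D.one := by
  have h0 : (⟨D.one, h.one_mem⟩ : homog V 0) ≠ 0 := by
    intro h0
    have h1 : D.one = 0 := congrArg Subtype.val h0
    have h2 := h.counit_one
    rw [h1, map_zero] at h2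
    exact zero_ne_one h2
  obtain ⟨c, hc⟩ := (finrank_eq_one_iff_of_nonzero' _ h0).1 h.connected ⟨x, hx⟩
  have hc' : c • D.one = x := congrArg Subtype.val hc
  rw [← hc', map_smul, h.counit_one, smul_eq_mul, _root_.mul_one]

/-- Two convolution products agree in degree `n` if the products of their factors agree on all
pairs of homogeneous elements of total degree `n`. -/
theorem conv_congr (hD : ∀ n, ∀ x ∈ homog V n, D.comul x ∈ homogTensor V n)
    {a b a' b' : (⨁ n, V n) →ₗ[ℂ] ⨁ n, V n} (n : ℕ)
    (hab : ∀ i j, i + j = n → ∀ u ∈ homog V i, ∀ v ∈ homog V j,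
      D.mul (a u) (b v) = D.mul (a' u) (b' v)) (x : ⨁ n, V n) (hx : x ∈ homog V n) :
    TensorProduct.lift D.mul (TensorProduct.map a b (D.comul x)) =
      TensorProduct.lift D.mul (TensorProduct.map a' b' (D.comul x)) := by
  suffices H : homogTensor V n ≤ LinearMap.eqLocus
      (TensorProduct.lift D.mul ∘ₗ TensorProduct.map a b)
      (TensorProduct.lift D.mul ∘ₗ TensorProduct.map a' b') from H (hD n x hx)
  refine iSup₂_le fun p hp => ?_
  rintro _ ⟨t, rfl⟩
  induction t using TensorProduct.induction_on with
  | zero => simp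
  | tmul u v =>
    simpa using hab _ _ (Finset.HasAntidiagonal.mem_antidiagonal.1 hp) _ ⟨u, rfl⟩ _ ⟨v, rfl⟩
  | add s t hs ht =>
    rw [map_add]
    exact Submodule.add_mem _ hs ht

-- In the convolution algebra of endomorphisms, whose unit is `x ↦ counit x • one`, an antipode is
-- an inverse of the identity map `1 - f`. Since `f` vanishes in degree zero, `f ^ n` vanishes in
-- all degrees below `n`. The geometric series of `f` is therefore finite in each degree, and it is
-- a two-sided inverse.
include h in
theorem exists_antipode : ∃ S : (⨁ n, V n) →ₗ[ℂ] ⨁ n, V n,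
    (∀ x, TensorProduct.lift D.mul (S.rTensor _ (D.comul x)) = D.counit x • D.one) ∧
    (∀ x, TensorProduct.lift D.mul (S.lTensor _ (D.comul x)) = D.counit x • D.one) := by
  let _ := h.ring
  let _ := h.algebra
  let _ := h.coalgebra
  have hmul : ∀ a b : WithConv ((⨁ n, V n) →ₗ[ℂ] ⨁ n, V n), ∀ x, (a * b).ofConv x =
      TensorProduct.lift D.mul (TensorProduct.map a.ofConv b.ofConv (D.comul x)) :=
    fun a b x => rfl
  have hone : ∀ x, (1 : WithConv ((⨁ n, V n) →ₗ[ℂ] ⨁ n, V n)).ofConv x =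
      D.counit x • D.one := fun x => rfl
  obtain ⟨f, hf⟩ : ∃ f : WithConv ((⨁ n, V n) →ₗ[ℂ] ⨁ n, V n),
    f = 1 - WithConv.toConv LinearMap.id := ⟨_, rfl⟩
  have hf0 : ∀ x ∈ homog V 0, f.ofConv x = 0 := by
    intro x hx
    rw [hf]
    change (1 : WithConv ((⨁ n, V n) →ₗ[ℂ] ⨁ n, V n)).ofConv x - x = 0
    rw [hone, ← h.eq_counit_smul_one x hx, sub_self]
  have hpow : ∀ n m, m < n → ∀ x ∈ homog V m, (f ^ n).ofConv x = 0 := by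
    intro n
    induction n with
    | zero => intro m hm; omega
    | succ n ih =>
      intro m hm x hx
      rw [pow_succ, hmul]
      -- Comparison with the zero maps: if `i + j = m ≤ n`, then `i < n` and `f ^ n` kills the left
      -- factor, or `j = 0` and `f` kills the right one.
      refine (conv_congr h.comul_mem (a' := 0) (b' := 0) m ?_ x hx).trans (by simp)
      intro i j hij u hu v hv
      by_cases hi : i < n
      · rw [ih i hi u hu]
        simp
      · have : j = 0 := by omega
        subst this
        rw [hf0 v hv]
        simp
  -- In degree `n` the series may be cut off after `f ^ n`; by `hS` below, any later cut-off gives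
  -- the same map, so one partial sum serves all tensor factors of total degree `n`.
  let S : (⨁ n, V n) →ₗ[ℂ] ⨁ n, V n := DirectSum.toModule ℂ ℕ _ fun n =>
    (∑ i ∈ Finset.range (n + 1), f ^ i).ofConv ∘ₗ DirectSum.lof ℂ ℕ V n
  have hS : ∀ n m, m ≤ n → ∀ x ∈ homog V m,
      S x = (∑ i ∈ Finset.range (n + 1), f ^ i).ofConv x := by
    rintro n m hm _ ⟨x, rfl⟩
    have h1 : ∀ s : Finset ℕ, ∀ y, (∑ i ∈ s, f ^ i).ofConv y = ∑ i ∈ s, (f ^ i).ofConv y := by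
      intro s y
      induction s using Finset.induction_on with
      | empty => rfl
      | insert a s ha ih =>
        rw [Finset.sum_insert ha, Finset.sum_insert ha, ← ih]
        rfl
    simp only [S, DirectSum.toModule_lof, LinearMap.comp_apply, h1]
    refine Finset.sum_subset (fun i => ?_) fun i _ hi => ?_
    · simp only [Finset.mem_range]; omega
    · exact hpow i m (by simpa [Nat.lt_succ_iff] using hi) _ ⟨x, rfl⟩
  have hid : WithConv.toConv LinearMap.id = 1 - f := by rw [hf, sub_sub_cancel]
  have hext : ∀ (a b : (⨁ n, V n) →ₗ[ℂ] ⨁ n, V n),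
      (∀ n, ∀ x ∈ homog V n, a x = b x) → ∀ x, a x = b x := by
    intro a b hab x
    have : a = b := DirectSum.linearMap_ext ℂ fun n => LinearMap.ext fun y => hab n _ ⟨y, rfl⟩
    rw [this]
  refine ⟨S, ?_, ?_⟩
  · refine hext (TensorProduct.lift D.mul ∘ₗ S.rTensor _ ∘ₗ D.comul)
      (1 : WithConv ((⨁ n, V n) →ₗ[ℂ] ⨁ n, V n)).ofConv fun n x hx => ?_
    refine (conv_congr h.comul_mem (b := LinearMap.id)
      (a' := (∑ i ∈ Finset.range (n + 1), f ^ i).ofConv) (b' := LinearMap.id) n ?_ x hx).trans ?_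
    · intro i j hij u hu v hv
      rw [hS n i (by omega) u hu]
    · refine (hmul (∑ i ∈ Finset.range (n + 1), f ^ i) (WithConv.toConv LinearMap.id) x).symm.trans
        ?_
      -- The partial sum telescopes to `1 - f ^ (n + 1)`, and the power vanishes in degree `n`.
      rw [hid, geom_sum_mul_neg]
      change _ - (f ^ (n + 1)).ofConv x = _
      rw [hpow (n + 1) n (by omega) x hx, sub_zero]
      rfl
  · refine hext (TensorProduct.lift D.mul ∘ₗ S.lTensor _ ∘ₗ D.comul)
      (1 : WithConv ((⨁ n, V n) →ₗ[ℂ] ⨁ n, V n)).ofConv fun n x hx => ?_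
    refine (conv_congr h.comul_mem (a := LinearMap.id)
      (b' := (∑ i ∈ Finset.range (n + 1), f ^ i).ofConv) (a' := LinearMap.id) n ?_ x hx).trans ?_
    · intro i j hij u hu v hv
      rw [hS n j (by omega) v hv]
    · refine (hmul (WithConv.toConv LinearMap.id) (∑ i ∈ Finset.range (n + 1), f ^ i) x).symm.trans
        ?_
      rw [hid, mul_neg_geom_sum]
      change _ - (f ^ (n + 1)).ofConv x = _
      rw [hpow (n + 1) n (by omega) x hx, sub_zero]
      rfl

include h in
theorem isHopf : D.IsHopf :=
  { h with antipode := h.exists_antipode }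

end HopfData.IsBialgebra

end Graded

open Matrix

/-! ## General linear groups indexed by finite types -/

section BlockUpper

variable {F : Type*} [Field F]
variable {ι κ μ : Type} [Fintype ι] [DecidableEq ι] [Fintype κ] [DecidableEq κ]
  [Fintype μ] [DecidableEq μ]

/-- Relabelling of the rows and columns of invertible matrices. -/
def relabel (e : ι ≃ κ) : GeneralLinearGroup ι F ≃* GeneralLinearGroup κ F :=
  Units.mapEquiv (Matrix.reindexAlgEquiv F F e).toMulEquiv

@[simp]
theorem relabel_val (e : ι ≃ κ) (g : GeneralLinearGroup ι F) :
    (relabel e g).val = g.val.submatrix e.symm e.symm := rfl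

theorem relabel_trans (e : ι ≃ κ) (f : κ ≃ μ) (g : GeneralLinearGroup ι F) :
    relabel (e.trans f) g = relabel f (relabel e g) := rfl

theorem relabel_symm_relabel (e : ι ≃ κ) (g : GeneralLinearGroup ι F) :
    relabel e.symm (relabel e g) = g := by
  apply Units.ext
  ext i j
  simp

theorem relabel_relabel_symm (e : ι ≃ κ) (g : GeneralLinearGroup κ F) :
    relabel e (relabel e.symm g) = g := relabel_symm_relabel e.symm g

/-- Two relabellings differ by conjugation with a permutation matrix. -/
theorem exists_conj_relabel (e₀ e : ι ≃ κ) : ∃ p : GeneralLinearGroup κ F,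
    p.val = (1 : Matrix ι ι F).submatrix e.symm e₀.symm ∧
      ∀ g, p * relabel e₀ g * p⁻¹ = relabel e g := by
  let p : GeneralLinearGroup κ F :=
    GeneralLinearGroup.mkOfDetNeZero ((1 : Matrix ι ι F).submatrix e.symm e₀.symm) (by
      have : (1 : Matrix ι ι F).submatrix e.symm e₀.symm =
          (Equiv.Perm.permMatrix F (e.symm.trans e₀)) := by
        ext i j
        simp only [Matrix.submatrix_apply, Matrix.one_apply, PEquiv.toMatrix_apply,
          Equiv.Perm.permMatrix, Equiv.toPEquiv_apply, Option.mem_def, Option.some.injEq,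
          Equiv.trans_apply]
        simp only [Equiv.eq_symm_apply]
      rw [this, Matrix.det_permutation]
      rcases Int.units_eq_one_or (Equiv.Perm.sign (e.symm.trans e₀)) with h | h <;> simp [h])
  refine ⟨p, rfl, fun g => ?_⟩
  rw [mul_inv_eq_iff_eq_mul]
  apply Units.ext
  change (1 : Matrix ι ι F).submatrix e.symm e₀.symm * g.val.submatrix e₀.symm e₀.symm =
    g.val.submatrix e.symm e.symm * (1 : Matrix ι ι F).submatrix e.symm e₀.symm
  rw [Matrix.submatrix_mul_equiv, Matrix.submatrix_mul_equiv, Matrix.one_mul, Matrix.mul_one]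

/-- The block upper triangular matrix with blocks `a`, `u`, `b`. -/
def blockUpper (a : GeneralLinearGroup ι F) (u : Matrix ι κ F) (b : GeneralLinearGroup κ F) :
    GeneralLinearGroup (ι ⊕ κ) F where
  val := fromBlocks a.val u 0 b.val
  inv := fromBlocks a.inv (-(a.inv * u * b.inv)) 0 b.inv
  val_inv := by
    rw [fromBlocks_multiply, ← fromBlocks_one]
    simp [← Matrix.mul_assoc]
  inv_val := by
    rw [fromBlocks_multiply, ← fromBlocks_one]
    simp [Matrix.mul_assoc]

@[simp]
theorem blockUpper_val (a : GeneralLinearGroup ι F) (u : Matrix ι κ F)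
    (b : GeneralLinearGroup κ F) : (blockUpper a u b).val = fromBlocks a.val u 0 b.val := rfl

theorem blockUpper_mul (a a' : GeneralLinearGroup ι F) (u u' : Matrix ι κ F)
    (b b' : GeneralLinearGroup κ F) : blockUpper a u b * blockUpper a' u' b' =
      blockUpper (a * a') (a.val * u' + u * b'.val) (b * b') := by
  apply Units.ext
  simp [fromBlocks_multiply]

theorem blockUpper_inv (a : GeneralLinearGroup ι F) (u : Matrix ι κ F)
    (b : GeneralLinearGroup κ F) : (blockUpper a u b)⁻¹ =
      blockUpper a⁻¹ (-(a⁻¹.val * u * b⁻¹.val)) b⁻¹ := by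
  rw [inv_eq_iff_mul_eq_one, blockUpper_mul]
  apply Units.ext
  simp [← Matrix.mul_assoc]

theorem blockUpper_inj {a a' : GeneralLinearGroup ι F} {u u' : Matrix ι κ F}
    {b b' : GeneralLinearGroup κ F} (h : blockUpper a u b = blockUpper a' u' b') :
    a = a' ∧ u = u' ∧ b = b' := by
  have h' := congrArg Units.val h
  rw [blockUpper_val, blockUpper_val, fromBlocks_inj] at h'
  exact ⟨Units.ext h'.1, h'.2.1, Units.ext h'.2.2.2⟩

/-- The determinant is the product of those of the diagonal blocks, so both blocks are invertible.
-/
theorem exists_blockUpper (g : GeneralLinearGroup (ι ⊕ κ) F) (h : g.val.toBlocks₂₁ = 0) :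
    ∃ a u b, g = blockUpper a u b := by
  have hg : g.val = fromBlocks g.val.toBlocks₁₁ g.val.toBlocks₁₂ 0 g.val.toBlocks₂₂ := by
    rw [← h, fromBlocks_toBlocks]
  have hdet : g.val.toBlocks₁₁.det * g.val.toBlocks₂₂.det ≠ 0 := by
    rw [← det_fromBlocks_zero₂₁, ← hg]
    exact ((Matrix.isUnit_iff_isUnit_det _).1 g.isUnit).ne_zero
  exact ⟨GeneralLinearGroup.mkOfDetNeZero _ (left_ne_zero_of_mul hdet), g.val.toBlocks₁₂,
    GeneralLinearGroup.mkOfDetNeZero _ (right_ne_zero_of_mul hdet), Units.ext hg⟩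

theorem blockUpper_conj (x a : GeneralLinearGroup ι F) (z u : Matrix ι κ F)
    (y b : GeneralLinearGroup κ F) :
    ∃ v, blockUpper x z y * blockUpper a u b * (blockUpper x z y)⁻¹ =
      blockUpper (x * a * x⁻¹) v (y * b * y⁻¹) := by
  rw [blockUpper_inv, blockUpper_mul, blockUpper_mul]
  exact ⟨_, rfl⟩

end BlockUpper

/-! ### Inflation and sums over conjugates -/

section Sums

variable {F : Type*} [Field F] [Fintype F]
variable {ι κ μ : Type} [Fintype ι] [DecidableEq ι] [Fintype κ] [DecidableEq κ]
  [Fintype μ] [DecidableEq μ]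

/-- For fixed diagonal blocks, conjugation induces a map on the block above the diagonal. It is
injective because conjugation is, hence a bijection of a finite set. -/
theorem sum_blockUpper_conj (x a : GeneralLinearGroup ι F) (z : Matrix ι κ F)
    (y b : GeneralLinearGroup κ F) (Ψ : GeneralLinearGroup (ι ⊕ κ) F → ℂ) :
    ∑ u, Ψ (blockUpper x z y * blockUpper a u b * (blockUpper x z y)⁻¹) =
      ∑ u, Ψ (blockUpper (x * a * x⁻¹) u (y * b * y⁻¹)) := by
  choose T hT using fun u => blockUpper_conj x a z u y b
  have hinj : Function.Injective T := by
    intro u u' h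
    have h1 : blockUpper a u b = blockUpper a u' b := by
      have h2 := (hT u).trans
        ((congrArg (fun v => blockUpper (x * a * x⁻¹) v (y * b * y⁻¹)) h).trans (hT u').symm)
      exact mul_left_cancel (mul_right_cancel h2)
    exact (blockUpper_inj h1).2.1
  simp only [hT]
  exact (Equiv.ofBijective T (Finite.injective_iff_bijective.1 hinj)).sum_comp
    fun u => Ψ (blockUpper (x * a * x⁻¹) u (y * b * y⁻¹))

/-- The inflation of a function on `GL ι × GL κ` to the block upper triangular matrices, extended
by zero. -/
def infl (Φ : GeneralLinearGroup ι F → GeneralLinearGroup κ F → ℂ)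
    (g : GeneralLinearGroup (ι ⊕ κ) F) : ℂ :=
  ∑ a, ∑ b, if ∃ u, g = blockUpper a u b then Φ a b else 0

variable (Φ : GeneralLinearGroup ι F → GeneralLinearGroup κ F → ℂ)

@[simp]
theorem infl_blockUpper (a : GeneralLinearGroup ι F) (u : Matrix ι κ F)
    (b : GeneralLinearGroup κ F) : infl Φ (blockUpper a u b) = Φ a b := by
  unfold infl
  rw [Finset.sum_eq_single a, Finset.sum_eq_single b]
  · rw [if_pos ⟨u, rfl⟩]
  · rintro b' - hb'
    rw [if_neg]
    rintro ⟨u', h⟩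
    exact hb' (blockUpper_inj h).2.2.symm
  · simp
  · rintro a' - ha'
    refine Finset.sum_eq_zero fun b' _ => ?_
    rw [if_neg]
    rintro ⟨u', h⟩
    exact ha' (blockUpper_inj h).1.symm
  · simp

theorem infl_eq_zero (g : GeneralLinearGroup (ι ⊕ κ) F) (h : ¬ ∃ a u b, g = blockUpper a u b) :
    infl Φ g = 0 := by
  refine Finset.sum_eq_zero fun a _ => Finset.sum_eq_zero fun b _ => ?_
  rw [if_neg]
  rintro ⟨u, hu⟩
  exact h ⟨a, u, b, hu⟩

theorem eq_infl (Ψ : GeneralLinearGroup (ι ⊕ κ) F → ℂ)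
    (h1 : ∀ a u b, Ψ (blockUpper a u b) = Φ a b)
    (h2 : ∀ g, (¬ ∃ a u b, g = blockUpper a u b) → Ψ g = 0) : Ψ = infl Φ := by
  funext g
  by_cases h : ∃ a u b, g = blockUpper a u b
  · obtain ⟨a, u, b, rfl⟩ := h
    rw [h1, infl_blockUpper]
  · rw [h2 g h, infl_eq_zero Φ g h]

theorem sum_eq_sum_blockUpper (Ψ : GeneralLinearGroup (ι ⊕ κ) F → ℂ)
    (h2 : ∀ g, (¬ ∃ a u b, g = blockUpper a u b) → Ψ g = 0) :
    ∑ g, Ψ g = ∑ a, ∑ b, ∑ u, Ψ (blockUpper a u b) := by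
  simp_rw [← Fintype.sum_prod_type']
  symm
  refine Finset.sum_bij_ne_zero (fun p _ _ => blockUpper p.1 p.2.2 p.2.1) (fun _ _ _ => by simp)
    ?_ ?_ (fun _ _ _ => rfl)
  · rintro ⟨a, b, u⟩ - - ⟨a', b', u'⟩ - - h
    obtain ⟨rfl, rfl, rfl⟩ := blockUpper_inj h
    rfl
  · rintro g - hg
    by_contra hcon
    refine hg (h2 g ?_)
    rintro ⟨a, u, b, rfl⟩
    exact hcon ⟨(a, b, u), Finset.mem_univ _, hg, rfl⟩

/-- The sum of a function over all conjugates of `g`. -/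
def conjSum {G : Type*} [Group G] [Fintype G] (Ψ : G → ℂ) (g : G) : ℂ :=
  ∑ x, Ψ (x * g * x⁻¹)

theorem conjSum_comp_conj {G : Type*} [Group G] [Fintype G] (Ψ : G → ℂ) (y g : G) :
    conjSum (fun h => Ψ (y * h * y⁻¹)) g = conjSum Ψ g := by
  refine Fintype.sum_equiv (Equiv.mulLeft y) _ _ fun x => ?_
  simp only [Equiv.coe_mulLeft]
  congr 1
  group

theorem conjSum_mulEquiv {G H : Type*} [Group G] [Fintype G] [Group H] [Fintype H] (e : G ≃* H)
    (Ψ : H → ℂ) (g : G) : conjSum Ψ (e g) = conjSum (fun h => Ψ (e h)) g := by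
  refine (Fintype.sum_equiv e.toEquiv _ _ fun x => ?_).symm
  simp

theorem conjSum_of_conj {G : Type*} [Group G] [Fintype G] (Ψ : G → ℂ)
    (hΨ : ∀ x g, Ψ (x * g * x⁻¹) = Ψ g) (g : G) : conjSum Ψ g = Fintype.card G * Ψ g := by
  simp [conjSum, hΨ]

/-- Transitivity of induction, without normalizing factors. -/
theorem conjSum_infl_conjSum (Φ : GeneralLinearGroup ι F → GeneralLinearGroup κ F → ℂ)
    (g : GeneralLinearGroup (ι ⊕ κ) F) :
    conjSum (infl fun a b => ∑ x, ∑ y, Φ (x * a * x⁻¹) (y * b * y⁻¹)) g =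
      Fintype.card (GeneralLinearGroup ι F) * Fintype.card (GeneralLinearGroup κ F) *
        conjSum (infl Φ) g := by
  -- Conjugating the diagonal blocks by `x` and `y` is conjugation by a block diagonal matrix, which
  -- the sum over all conjugates absorbs.
  have h : (infl fun a b => ∑ x, ∑ y, Φ (x * a * x⁻¹) (y * b * y⁻¹)) =
      fun g => ∑ x, ∑ y, infl Φ (blockUpper x 0 y * g * (blockUpper x 0 y)⁻¹) := by
    symm
    apply eq_infl
    · intro a u b
      refine Finset.sum_congr rfl fun x _ => Finset.sum_congr rfl fun y _ => ?_
      obtain ⟨v, hv⟩ := blockUpper_conj x a 0 u y b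
      rw [hv, infl_blockUpper]
    · intro g hg
      refine Finset.sum_eq_zero fun x _ => Finset.sum_eq_zero fun y _ => infl_eq_zero _ _ ?_
      rintro ⟨a, u, b, h⟩
      apply hg
      obtain ⟨v, hv⟩ := blockUpper_conj x⁻¹ a 0 u y⁻¹ b
      refine ⟨x⁻¹ * a * x⁻¹⁻¹, v, y⁻¹ * b * y⁻¹⁻¹, ?_⟩
      rw [← hv, ← h]
      have : (blockUpper x⁻¹ (0 : Matrix ι κ F) y⁻¹) = (blockUpper x 0 y)⁻¹ := by
        rw [blockUpper_inv]; simp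
      rw [this]
      group
  rw [h]
  have h' : conjSum (fun g => ∑ x, ∑ y, infl Φ (blockUpper x 0 y * g * (blockUpper x 0 y)⁻¹)) g =
      ∑ x : GeneralLinearGroup ι F, ∑ y : GeneralLinearGroup κ F,
        conjSum (fun g => infl Φ (blockUpper x 0 y * g * (blockUpper x 0 y)⁻¹)) g := by
    unfold conjSum
    rw [Finset.sum_comm]
    refine Finset.sum_congr rfl fun x _ => ?_
    rw [Finset.sum_comm]
  rw [h']
  simp only [conjSum_comp_conj (infl Φ), Finset.sum_const, Finset.card_univ, nsmul_eq_mul]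
  rw [mul_assoc]

end Sums

/-! ## Complementary order embeddings -/

section Complementary

variable {F : Type*} [Field F]

/-- The bijection given by two embeddings with complementary ranges. -/
def complEquiv {k l n : ℕ} (e : Fin k ↪o Fin n) (f : Fin l ↪o Fin n)
    (h : IsCompl (Set.range e) (Set.range f)) : Fin k ⊕ Fin l ≃ Fin n :=
  Equiv.ofBijective (Sum.elim e f) <| by
    refine ⟨e.injective.sumElim f.injective fun a b hab => ?_, fun c => ?_⟩
    · exact Set.disjoint_left.1 h.disjoint ⟨a, rfl⟩ ⟨b, hab.symm⟩
    · have hc : c ∈ (⊤ : Set (Fin n)) := trivial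
      rw [← h.sup_eq_top] at hc
      rcases hc with ⟨a, rfl⟩ | ⟨b, rfl⟩
      · exact ⟨Sum.inl a, rfl⟩
      · exact ⟨Sum.inr b, rfl⟩

@[simp]
theorem complEquiv_inl {k l n : ℕ} (e : Fin k ↪o Fin n) (f : Fin l ↪o Fin n)
    (h : IsCompl (Set.range e) (Set.range f)) (i : Fin k) :
    complEquiv e f h (Sum.inl i) = e i := rfl

@[simp]
theorem complEquiv_inr {k l n : ℕ} (e : Fin k ↪o Fin n) (f : Fin l ↪o Fin n)
    (h : IsCompl (Set.range e) (Set.range f)) (i : Fin l) :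
    complEquiv e f h (Sum.inr i) = f i := rfl

theorem isCompl_firstEmb_lastEmb {k l n : ℕ} (h : k + l = n) :
    IsCompl (Set.range (firstEmb h : Fin k ↪o Fin n)) (Set.range (lastEmb h : Fin l ↪o Fin n)) := by
  subst h
  constructor
  · rw [Set.disjoint_left]
    rintro _ ⟨a, rfl⟩ ⟨b, hb⟩
    have h1 : k + (b : ℕ) = a := congrArg Fin.val hb
    omega
  · refine codisjoint_iff.2 (Set.eq_univ_iff_forall.2 fun c => ?_)
    by_cases hc : (c : ℕ) < k
    · exact Or.inl ⟨⟨c, hc⟩, rfl⟩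
    · refine Or.inr ⟨⟨c - k, by omega⟩, Fin.ext ?_⟩
      change k + ((c : ℕ) - k) = c
      omega

/-- This passes from the block condition in the definitions of product and coproduct to explicit
block matrices indexed by a sum type. -/
theorem hasBlocks_relabel_iff {k l n : ℕ} (e : Fin k ↪o Fin n) (f : Fin l ↪o Fin n)
    (h : IsCompl (Set.range e) (Set.range f)) (g : GeneralLinearGroup (Fin k ⊕ Fin l) F)
    (a : GeneralLinearGroup (Fin k) F) (b : GeneralLinearGroup (Fin l) F) :
    HasBlocks e f (relabel (complEquiv e f h) g).val a.val b.val ↔ ∃ u, g = blockUpper a u b := by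
  have h1 : ∀ i, (complEquiv e f h).symm (e i) = Sum.inl i := fun i =>
    (complEquiv e f h).symm_apply_eq.2 rfl
  have h2 : ∀ i, (complEquiv e f h).symm (f i) = Sum.inr i := fun i =>
    (complEquiv e f h).symm_apply_eq.2 rfl
  constructor
  · rintro ⟨ha, hb, hz⟩
    refine ⟨g.val.toBlocks₁₂, Units.ext ?_⟩
    ext (i | i) (j | j)
    · simpa [h1] using congrFun (congrFun ha i) j
    · rfl
    · simpa [h1, h2] using congrFun (congrFun hz i) j
    · simpa [h2] using congrFun (congrFun hb i) j
  · rintro ⟨u, rfl⟩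
    refine ⟨?_, ?_, ?_⟩ <;> ext i j <;> simp [h1, h2]

end Complementary

/-! ## Evaluation at invertible matrices with arbitrary index types -/

section Evaluation

variable {F : Type*} [Field F]
variable {ι κ μ : Type} [Fintype ι] [DecidableEq ι] [Fintype κ] [DecidableEq κ]
  [Fintype μ] [DecidableEq μ]

/-- The value at `g` of the component of degree `card ι` of an element of `⨁ n, cf(GL_n)`. -/
def evalGL (g : GeneralLinearGroup ι F) : (⨁ n, cf (GLn F n)) →ₗ[ℂ] ℂ :=
  LinearMap.proj (relabel (Fintype.equivFin ι) g) ∘ₗ (cf (GLn F (Fintype.card ι))).subtype ∘ₗ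
    DirectSum.component ℂ ℕ (fun n => cf (GLn F n)) (Fintype.card ι)

/-- Two relabellings differ by conjugation, which a class function does not see, so any bijection
may be used. Sum types as index types then avoid casts between degrees such as `(k + l) + m` and `k
+ (l + m)`. -/
theorem evalGL_lof {n : ℕ} (e : ι ≃ Fin n) (g : GeneralLinearGroup ι F) (φ : cf (GLn F n)) :
    evalGL g (DirectSum.lof ℂ ℕ (fun n => cf (GLn F n)) n φ) = φ.val (relabel e g) := by
  obtain rfl : Fintype.card ι = n := by simpa using Fintype.card_congr e
  simp only [evalGL, LinearMap.comp_apply, DirectSum.component.lof_self, Submodule.subtype_apply,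
    LinearMap.proj_apply]
  obtain ⟨p, -, hp⟩ := exists_conj_relabel (F := F) (Fintype.equivFin ι) e
  rw [← hp, φ.property]

theorem evalGL_lof_of_ne {n : ℕ} (h : Fintype.card ι ≠ n) (g : GeneralLinearGroup ι F)
    (φ : cf (GLn F n)) : evalGL g (DirectSum.lof ℂ ℕ (fun n => cf (GLn F n)) n φ) = 0 := by
  have : DirectSum.component ℂ ℕ (fun n => cf (GLn F n)) (Fintype.card ι)
      (DirectSum.lof ℂ ℕ (fun n => cf (GLn F n)) n φ) = 0 := by
    rw [DirectSum.component.of, dif_neg h.symm]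
  simp [evalGL, this]

theorem evalGL_relabel (e : ι ≃ κ) (g : GeneralLinearGroup ι F) :
    evalGL (relabel e g) = evalGL g := by
  refine DirectSum.linearMap_ext ℂ fun n => LinearMap.ext fun φ => ?_
  by_cases h : Fintype.card ι = n
  · subst h
    change evalGL _ (DirectSum.lof ℂ ℕ _ _ φ) = evalGL _ (DirectSum.lof ℂ ℕ _ _ φ)
    rw [evalGL_lof (e.symm.trans (Fintype.equivFin ι)), evalGL_lof (Fintype.equivFin ι),
      relabel_trans, relabel_symm_relabel]
  · change evalGL _ (DirectSum.lof ℂ ℕ _ _ φ) = evalGL _ (DirectSum.lof ℂ ℕ _ _ φ)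
    rw [evalGL_lof_of_ne h, evalGL_lof_of_ne (by rwa [← Fintype.card_congr e])]

theorem evalGL_conj (x g : GeneralLinearGroup ι F) : evalGL (x * g * x⁻¹) = evalGL g := by
  refine LinearMap.ext fun φ => ?_
  simp only [evalGL, LinearMap.comp_apply, LinearMap.proj_apply, map_mul, map_inv]
  exact (DirectSum.component ℂ ℕ (fun n => cf (GLn F n)) (Fintype.card ι) φ).property _ _

theorem evalGL_of_mem {n : ℕ} (h : Fintype.card ι ≠ n) (g : GeneralLinearGroup ι F)
    (x : ⨁ n, cf (GLn F n)) (hx : x ∈ homog (fun n => cf (GLn F n)) n) : evalGL g x = 0 := by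
  obtain ⟨φ, rfl⟩ := hx
  exact evalGL_lof_of_ne h g φ

theorem evalGL_eq {n : ℕ} (e : ι ≃ Fin n) (g : GeneralLinearGroup ι F) (x : ⨁ n, cf (GLn F n)) :
    evalGL g x = (DirectSum.component ℂ ℕ (fun n => cf (GLn F n)) n x).val (relabel e g) := by
  suffices h : evalGL g = LinearMap.proj (relabel e g) ∘ₗ (cf (GLn F n)).subtype ∘ₗ
      DirectSum.component ℂ ℕ (fun n => cf (GLn F n)) n from LinearMap.congr_fun h x
  refine DirectSum.linearMap_ext ℂ fun m => LinearMap.ext fun φ => ?_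
  simp only [LinearMap.comp_apply]
  by_cases h : m = n
  · subst h
    rw [evalGL_lof e, DirectSum.component.lof_self]
    rfl
  · have hc : Fintype.card ι = n := by simpa using Fintype.card_congr e
    rw [evalGL_lof_of_ne (by omega), DirectSum.component.of, dif_neg h]
    rfl

variable (F) in
theorem separates_evalGL :
    Separates (V := ⨁ n, cf (GLn F n)) fun p : Σ n, GLn F n => evalGL p.2 := by
  intro x y hx
  refine DirectSum.ext_component ℂ fun n => Subtype.ext (funext fun g => ?_)
  have h := hx ⟨n, g⟩
  rwa [evalGL_eq (Equiv.refl _), evalGL_eq (Equiv.refl _)] at h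

/-- Products of homogeneous elements are compared through this at matrices indexed by the sum type
that suits their blocks. -/
theorem ext_of_mem_homog {n : ℕ} (hn : Fintype.card ι = n) (x y : ⨁ n, cf (GLn F n))
    (hx : x ∈ homog (fun n => cf (GLn F n)) n) (hy : y ∈ homog (fun n => cf (GLn F n)) n)
    (h : ∀ g : GeneralLinearGroup ι F, evalGL g x = evalGL g y) : x = y := by
  obtain ⟨φ, rfl⟩ := hx
  obtain ⟨ψ, rfl⟩ := hy
  subst hn
  congr 1
  refine Subtype.ext (funext fun g => ?_)
  have h' := h (relabel (Fintype.equivFin ι).symm g)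
  rwa [evalGL_lof (Fintype.equivFin ι), evalGL_lof (Fintype.equivFin ι),
    relabel_relabel_symm] at h'

end Evaluation

/-! ## Functionals on tensor products -/

section Functionals

variable {V W U : Type*} [AddCommMonoid V] [Module ℂ V] [AddCommMonoid W] [Module ℂ W]
  [AddCommMonoid U] [Module ℂ U]
  {V' W' : Type*} [AddCommMonoid V'] [Module ℂ V'] [AddCommMonoid W'] [Module ℂ W']

theorem tensorEval_map (p : V' →ₗ[ℂ] ℂ) (q : W' →ₗ[ℂ] ℂ) (f : V →ₗ[ℂ] V') (g : W →ₗ[ℂ] W')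
    (t : V ⊗[ℂ] W) :
    tensorEval p q (TensorProduct.map f g t) = tensorEval (p ∘ₗ f) (q ∘ₗ g) t := by
  have : tensorEval p q ∘ₗ TensorProduct.map f g = tensorEval (p ∘ₗ f) (q ∘ₗ g) := by
    ext; simp
  exact LinearMap.congr_fun this t

theorem tensorEval_rTensor (p : V' →ₗ[ℂ] ℂ) (q : W →ₗ[ℂ] ℂ) (f : V →ₗ[ℂ] V')
    (t : V ⊗[ℂ] W) : tensorEval p q (f.rTensor W t) = tensorEval (p ∘ₗ f) q t :=
  tensorEval_map p q f LinearMap.id t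

theorem tensorEval_lTensor (p : V →ₗ[ℂ] ℂ) (q : W' →ₗ[ℂ] ℂ) (f : W →ₗ[ℂ] W')
    (t : V ⊗[ℂ] W) : tensorEval p q (f.lTensor V t) = tensorEval p (q ∘ₗ f) t :=
  tensorEval_map p q LinearMap.id f t

theorem tensorEval_assoc (p : V →ₗ[ℂ] ℂ) (q : W →ₗ[ℂ] ℂ) (r : U →ₗ[ℂ] ℂ)
    (t : (V ⊗[ℂ] W) ⊗[ℂ] U) : tensorEval p (tensorEval q r) (TensorProduct.assoc ℂ V W U t) =
      tensorEval (tensorEval p q) r t := by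
  have : tensorEval p (tensorEval q r) ∘ₗ (TensorProduct.assoc ℂ V W U).toLinearMap =
      tensorEval (tensorEval p q) r := by
    ext; simp [mul_assoc]
  exact LinearMap.congr_fun this t

theorem eval_lid_rTensor (p : V →ₗ[ℂ] ℂ) (q : W →ₗ[ℂ] ℂ) (t : V ⊗[ℂ] W) :
    q (TensorProduct.lid ℂ W (p.rTensor W t)) = tensorEval p q t := by
  have : q ∘ₗ (TensorProduct.lid ℂ W).toLinearMap ∘ₗ p.rTensor W = tensorEval p q := by
    ext; simp
  exact LinearMap.congr_fun this t

theorem eval_rid_lTensor (p : V →ₗ[ℂ] ℂ) (q : W →ₗ[ℂ] ℂ) (t : V ⊗[ℂ] W) :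
    p (TensorProduct.rid ℂ V (q.lTensor V t)) = tensorEval p q t := by
  have : p ∘ₗ (TensorProduct.rid ℂ V).toLinearMap ∘ₗ q.lTensor V = tensorEval p q := by
    ext; simp [mul_comm]
  exact LinearMap.congr_fun this t

theorem tensorEval_smul_sum_left {I : Type*} [Fintype I] (c : ℂ) (p : I → V →ₗ[ℂ] ℂ)
    (q : W →ₗ[ℂ] ℂ) (t : V ⊗[ℂ] W) :
    tensorEval (c • ∑ i, p i) q t = c * ∑ i, tensorEval (p i) q t := by
  have : tensorEval (c • ∑ i, p i) q = c • ∑ i, tensorEval (p i) q := by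
    ext
    simp only [TensorProduct.AlgebraTensorModule.curry_apply, TensorProduct.curry_apply,
      LinearMap.coe_restrictScalars, tensorEval_tmul, LinearMap.smul_apply, LinearMap.sum_apply,
      smul_eq_mul, Finset.sum_mul, mul_assoc]
  rw [this]
  simp

theorem tensorEval_smul_sum_right {I : Type*} [Fintype I] (c : ℂ) (p : V →ₗ[ℂ] ℂ)
    (q : I → W →ₗ[ℂ] ℂ) (t : V ⊗[ℂ] W) :
    tensorEval p (c • ∑ i, q i) t = c * ∑ i, tensorEval p (q i) t := by
  have : tensorEval p (c • ∑ i, q i) = c • ∑ i, tensorEval p (q i) := by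
    ext
    simp only [TensorProduct.AlgebraTensorModule.curry_apply, TensorProduct.curry_apply,
      LinearMap.coe_restrictScalars, tensorEval_tmul, LinearMap.smul_apply, LinearMap.sum_apply,
      smul_eq_mul, Finset.mul_sum]
    exact Finset.sum_congr rfl fun _ _ => by ring
  rw [this]
  simp

theorem homog_induction {V : ℕ → Type*} [∀ n, AddCommGroup (V n)] [∀ n, Module ℂ (V n)]
    {p : (⨁ n, V n) → Prop} (h0 : p 0) (hadd : ∀ x y, p x → p y → p (x + y))
    (h : ∀ n, ∀ x ∈ homog V n, p x) (x : ⨁ n, V n) : p x :=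
  DirectSum.induction_on x h0 (fun n x => h n _ ⟨x, rfl⟩) hadd

theorem avg_eq_sum {X Y : Type*} [Fintype X] [Fintype Y] (P : X → Prop) (T : Y → X)
    (hT : Function.Injective T) (hP : ∀ x, P x ↔ ∃ y, x = T y) (f : X → ℂ) :
    avg P f = (Fintype.card Y : ℂ)⁻¹ * ∑ y, f (T y) := by
  have h : Finset.univ.filter P = Finset.univ.map ⟨T, hT⟩ := by
    ext x
    simp [hP, eq_comm]
  rw [avg_apply, h, Finset.card_map, Finset.card_univ, Finset.sum_map]
  rfl

end Functionals

/-! ## Product and coproduct of `cf(GL_•)` at matrices with arbitrary index types -/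

section GLStructure

variable {F : Type*} [Field F] [Fintype F]
variable {ι κ μ ι' κ' : Type} [Fintype ι] [DecidableEq ι] [Fintype κ] [DecidableEq κ]
  [Fintype μ] [DecidableEq μ] [Fintype ι'] [DecidableEq ι'] [Fintype κ'] [DecidableEq κ']

variable (F ι κ) in
/-- The order of the group of block upper triangular matrices. -/
def parCard : ℂ :=
  Fintype.card (GeneralLinearGroup ι F) * Fintype.card (GeneralLinearGroup κ F) *
    (Fintype.card F : ℂ) ^ (Fintype.card ι * Fintype.card κ)

theorem card_ne_zero' : (Fintype.card F : ℂ) ≠ 0 := by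
  exact_mod_cast Fintype.card_ne_zero

variable (F) in
theorem card_GL_congr (e : ι ≃ κ) :
    Fintype.card (GeneralLinearGroup ι F) = Fintype.card (GeneralLinearGroup κ F) :=
  Fintype.card_congr (relabel e).toEquiv

theorem card_matrix_eq :
    (Fintype.card (Matrix ι κ F) : ℂ) = (Fintype.card F : ℂ) ^ (Fintype.card ι * Fintype.card κ) := by
  have : Fintype.card (Matrix ι κ F) = Fintype.card F ^ (Fintype.card ι * Fintype.card κ) := by
    rw [Fintype.card_congr (Matrix.of.symm : Matrix ι κ F ≃ (ι → κ → F)), Fintype.card_fun,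
      Fintype.card_fun, ← pow_mul, mul_comm]
  exact_mod_cast this

theorem relabel_sumCongr_blockUpper (e : ι ≃ ι') (f : κ ≃ κ') (a : GeneralLinearGroup ι F)
    (u : Matrix ι κ F) (b : GeneralLinearGroup κ F) :
    relabel (e.sumCongr f) (blockUpper a u b) =
      blockUpper (relabel e a) (u.submatrix e.symm f.symm) (relabel f b) := by
  apply Units.ext
  ext (i | i) (j | j) <;> rfl

theorem infl_relabel_sumCongr (e : ι ≃ ι') (f : κ ≃ κ')
    (Φ : GeneralLinearGroup ι' F → GeneralLinearGroup κ' F → ℂ)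
    (g : GeneralLinearGroup (ι ⊕ κ) F) :
    infl Φ (relabel (e.sumCongr f) g) = infl (fun a b => Φ (relabel e a) (relabel f b)) g := by
  refine congrFun (eq_infl _ (fun g => infl Φ (relabel (e.sumCongr f) g)) ?_ ?_) g
  · intro a u b
    rw [relabel_sumCongr_blockUpper, infl_blockUpper]
  · intro g hg
    refine infl_eq_zero _ _ ?_
    rintro ⟨a, u, b, h⟩
    apply hg
    have h' := congrArg (relabel (e.sumCongr f).symm) h
    rw [relabel_symm_relabel, Equiv.sumCongr_symm, relabel_sumCongr_blockUpper] at h'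
    exact ⟨_, _, _, h'⟩

theorem glInfl_relabel {k l : ℕ} (φ : GLn F k → ℂ) (ψ : GLn F l → ℂ)
    (g : GeneralLinearGroup (Fin k ⊕ Fin l) F) :
    glInfl F φ ψ (relabel (complEquiv _ _ (isCompl_firstEmb_lastEmb rfl)) g) =
      infl (fun a b => φ a * ψ b) g := by
  unfold glInfl infl
  simp only [hasBlocks_relabel_iff]

theorem glHopf_mul_mem (k l : ℕ) :
    ∀ x ∈ homog (fun n => cf (GLn F n)) k, ∀ y ∈ homog (fun n => cf (GLn F n)) l,
      (glHopf F).mul x y ∈ homog (fun n => cf (GLn F n)) (k + l) :=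
  gradedMul_mem _ k l

theorem glHopf_mul_lof (k l : ℕ) (φ : cf (GLn F k)) (ψ : cf (GLn F l)) :
    (glHopf F).mul (DirectSum.lof ℂ ℕ (fun n => cf (GLn F n)) k φ)
      (DirectSum.lof ℂ ℕ (fun n => cf (GLn F n)) l ψ) =
      DirectSum.lof ℂ ℕ (fun n => cf (GLn F n)) (k + l) (glMul F k l φ ψ) :=
  gradedMul_lof (V := fun n => cf (GLn F n)) (glMul F) k l φ ψ

theorem glMul_val (k l : ℕ) (φ : cf (GLn F k)) (ψ : cf (GLn F l)) (g : GLn F (k + l)) :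
    (glMul F k l φ ψ).val g = (parCard F (Fin k) (Fin l))⁻¹ *
      conjSum (glInfl F φ.val ψ.val) g := by
  change glMulFun F φ.val ψ.val g = _
  rw [glMulFun, parCard, Fintype.card_fin, Fintype.card_fin]
  push_cast
  rfl

theorem parCard_congr (e : ι ≃ ι') (f : κ ≃ κ') : parCard F ι κ = parCard F ι' κ' := by
  rw [parCard, parCard, card_GL_congr F e, card_GL_congr F f, Fintype.card_congr e,
    Fintype.card_congr f]

theorem evalGL_mul {k l : ℕ} (hk : Fintype.card ι = k) (hl : Fintype.card κ = l)
    (x y : ⨁ n, cf (GLn F n)) (hx : x ∈ homog (fun n => cf (GLn F n)) k)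
    (hy : y ∈ homog (fun n => cf (GLn F n)) l) (g : GeneralLinearGroup (ι ⊕ κ) F) :
    evalGL g ((glHopf F).mul x y) =
      (parCard F ι κ)⁻¹ * conjSum (infl fun a b => evalGL a x * evalGL b y) g := by
  obtain ⟨φ, rfl⟩ := hx
  obtain ⟨ψ, rfl⟩ := hy
  let e : ι ≃ Fin k := Fintype.equivFinOfCardEq hk
  let f : κ ≃ Fin l := Fintype.equivFinOfCardEq hl
  let s := complEquiv (firstEmb (rfl : k + l = k + l)) (lastEmb rfl) (isCompl_firstEmb_lastEmb rfl)
  rw [glHopf_mul_lof, evalGL_lof ((e.sumCongr f).trans s), relabel_trans, glMul_val,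
    conjSum_mulEquiv, conjSum_mulEquiv, ← parCard_congr e f]
  congr 2
  funext g
  rw [glInfl_relabel, infl_relabel_sumCongr]
  simp only [evalGL_lof e, evalGL_lof f]

theorem glRes_apply {k l n : ℕ} (h : k + l = n) (φ : GLn F n → ℂ) (a : GLn F k) (b : GLn F l) :
    glRes F h φ a b = ((Fintype.card F : ℂ) ^ (k * l))⁻¹ *
      ∑ u, φ (relabel (complEquiv _ _ (isCompl_firstEmb_lastEmb h)) (blockUpper a u b)) := by
  change avg _ φ = _
  rw [avg_eq_sum _ (fun u =>
    relabel (complEquiv _ _ (isCompl_firstEmb_lastEmb h)) (blockUpper a u b)) ?_ ?_ φ,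
    card_matrix_eq, Fintype.card_fin, Fintype.card_fin]
  · intro u u' huu
    exact (blockUpper_inj ((relabel _).injective huu)).2.1
  · intro g
    obtain ⟨g', rfl⟩ := (relabel (complEquiv _ _ (isCompl_firstEmb_lastEmb h))).surjective g
    rw [hasBlocks_relabel_iff]
    simp

/-- The tensor has the intended values because parabolic restriction is a class function in both
variables: conjugation by a block diagonal matrix permutes the block above the diagonal. -/
theorem tensorEval_evalGL_glComul {k l n : ℕ} (h : k + l = n) (φ : cf (GLn F n))
    (a : GLn F k) (b : GLn F l) :
    tensorEval (LinearMap.proj a ∘ₗ (cf (GLn F k)).subtype)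
      (LinearMap.proj b ∘ₗ (cf (GLn F l)).subtype) (glComul F k l n h φ) =
        glRes F h φ.val a b := by
  unfold glComul
  refine tensorEval_toTensor _ _ a b (ConjClasses.mk a) (ConjClasses.mk b) rfl rfl ?_ ?_ ?_
  · intro C
    simp [classIndicator, eq_comm]
  · intro C
    simp [classIndicator, eq_comm]
  · intro a' b' ha hb
    obtain ⟨x, rfl⟩ := isConj_iff.1 (ConjClasses.mk_eq_mk_iff_isConj.1 ha.symm)
    obtain ⟨y, rfl⟩ := isConj_iff.1 (ConjClasses.mk_eq_mk_iff_isConj.1 hb.symm)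
    simp only [LinearMap.comp_apply, Submodule.subtype_apply, glRes_apply]
    congr 1
    rw [← sum_blockUpper_conj x a 0 y b fun g =>
      φ.val (relabel (complEquiv _ _ (isCompl_firstEmb_lastEmb h)) g)]
    simp only [map_mul, map_inv, φ.property _ _]

theorem evalGL_comp_lof (g : GeneralLinearGroup ι F) {n : ℕ} (e : ι ≃ Fin n) :
    evalGL g ∘ₗ DirectSum.lof ℂ ℕ (fun n => cf (GLn F n)) n =
      LinearMap.proj (relabel e g) ∘ₗ (cf (GLn F n)).subtype :=
  LinearMap.ext fun φ => evalGL_lof e g φ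

theorem evalGL_comp_lof_of_ne (g : GeneralLinearGroup ι F) {n : ℕ} (h : Fintype.card ι ≠ n) :
    evalGL g ∘ₗ DirectSum.lof ℂ ℕ (fun n => cf (GLn F n)) n = 0 :=
  LinearMap.ext fun φ => evalGL_lof_of_ne h g φ

theorem tensorEval_zero_left {V W : Type*} [AddCommMonoid V] [Module ℂ V] [AddCommMonoid W]
    [Module ℂ W] (q : W →ₗ[ℂ] ℂ) : tensorEval (0 : V →ₗ[ℂ] ℂ) q = 0 := by
  ext; simp

theorem tensorEval_zero_right {V W : Type*} [AddCommMonoid V] [Module ℂ V] [AddCommMonoid W]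
    [Module ℂ W] (p : V →ₗ[ℂ] ℂ) : tensorEval p (0 : W →ₗ[ℂ] ℂ) = 0 := by
  ext; simp

/-- The functional on the tensor square given by evaluation at a pair of matrices. -/
abbrev evalGL₂ (a : GeneralLinearGroup ι F) (b : GeneralLinearGroup κ F) :
    (⨁ n, cf (GLn F n)) ⊗[ℂ] (⨁ n, cf (GLn F n)) →ₗ[ℂ] ℂ :=
  tensorEval (V := ⨁ n, cf (GLn F n)) (W := ⨁ n, cf (GLn F n)) (evalGL a) (evalGL b)

/-- Evaluation at `a` and `b` kills every component of the coproduct except that of bidegree `(card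
ι, card κ)`, whose values are those of parabolic restriction. -/
theorem evalGL_comul (a : GeneralLinearGroup ι F) (b : GeneralLinearGroup κ F) :
    evalGL₂ a b ∘ₗ (glHopf F).comul =
      ((Fintype.card F : ℂ) ^ (Fintype.card ι * Fintype.card κ))⁻¹ •
        ∑ u, evalGL (blockUpper a u b) := by
  refine DirectSum.linearMap_ext ℂ fun n => LinearMap.ext fun φ => ?_
  have h1 : (glHopf F).comul (DirectSum.lof ℂ ℕ (fun n => cf (GLn F n)) n φ) = _ :=
    gradedComul_lof (glComul F) n φ
  simp only [LinearMap.comp_apply, LinearMap.smul_apply, LinearMap.sum_apply]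
  rw [h1, map_sum]
  simp only [tensorEval_map]
  by_cases hn : Fintype.card ι + Fintype.card κ = n
  · rw [Finset.sum_eq_single ⟨(Fintype.card ι, Fintype.card κ), by simpa using hn⟩]
    · let e := Fintype.equivFin ι
      let f := Fintype.equivFin κ
      let s := complEquiv _ _ (isCompl_firstEmb_lastEmb hn)
      simp only [evalGL_comp_lof _ e, evalGL_comp_lof _ f]
      rw [tensorEval_evalGL_glComul, glRes_apply, smul_eq_mul]
      congr 1
      simp only [evalGL_lof ((e.sumCongr f).trans s), relabel_trans, relabel_sumCongr_blockUpper]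
      exact (Equiv.sum_comp (Matrix.reindex e f) fun u =>
        φ.val (relabel s (blockUpper (relabel e a) u (relabel f b)))).symm
    · rintro ⟨⟨k, l⟩, hp⟩ - hne
      by_cases hk : Fintype.card ι = k
      · have hl : Fintype.card κ ≠ l := by
          rintro rfl
          exact hne (by subst hk; rfl)
        rw [evalGL_comp_lof_of_ne b hl, tensorEval_zero_right]
        rfl
      · rw [evalGL_comp_lof_of_ne a hk, tensorEval_zero_left]
        rfl
    · intro h
      exact absurd (Finset.mem_attach _ _) h
  · rw [Finset.sum_eq_zero]
    · symm
      rw [Finset.sum_eq_zero, smul_zero]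
      intro u _
      exact evalGL_lof_of_ne (by rwa [Fintype.card_sum]) _ _
    · rintro ⟨⟨k, l⟩, hp⟩ -
      replace hp := Finset.HasAntidiagonal.mem_antidiagonal.1 hp
      by_cases hk : Fintype.card ι = k
      · rw [evalGL_comp_lof_of_ne b (by rintro rfl; exact hn (by rw [hk]; exact hp)),
          tensorEval_zero_right]
        rfl
      · rw [evalGL_comp_lof_of_ne a hk, tensorEval_zero_left]
        rfl

theorem evalGL_comul_apply (a : GeneralLinearGroup ι F) (b : GeneralLinearGroup κ F)
    (x : ⨁ n, cf (GLn F n)) :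
    evalGL₂ a b ((glHopf F).comul x) =
      ((Fintype.card F : ℂ) ^ (Fintype.card ι * Fintype.card κ))⁻¹ *
        ∑ u, evalGL (blockUpper a u b) x := by
  have h := LinearMap.congr_fun (evalGL_comul a b) x
  simpa only [LinearMap.comp_apply, LinearMap.smul_apply, LinearMap.sum_apply, smul_eq_mul] using h

end GLStructure

/-! ## Associativity, coassociativity and (co)units of `cf(GL_•)` -/

section GLAxioms

variable {F : Type*} [Field F] [Fintype F]
variable {ι κ μ : Type} [Fintype ι] [DecidableEq ι] [Fintype κ] [DecidableEq κ]
  [Fintype μ] [DecidableEq μ]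

theorem relabel_sumAssoc_blockUpper (a : GeneralLinearGroup ι F) (b : GeneralLinearGroup κ F)
    (c : GeneralLinearGroup μ F) (u : Matrix ι κ F) (w₁ : Matrix ι μ F) (w₂ : Matrix κ μ F) :
    relabel (Equiv.sumAssoc ι κ μ) (blockUpper (blockUpper a u b) (fromRows w₁ w₂) c) =
      blockUpper a (fromCols u w₁) (blockUpper b w₂ c) := by
  apply Units.ext
  ext (i | i | i) (j | j | j) <;> rfl

/-- Both iterated inflations are supported on the block upper triangular matrices with three
diagonal blocks and depend only on these blocks. -/
theorem infl_relabel_sumAssoc (Φ : GeneralLinearGroup ι F → GeneralLinearGroup κ F →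
    GeneralLinearGroup μ F → ℂ) (g : GeneralLinearGroup ((ι ⊕ κ) ⊕ μ) F) :
    infl (fun a => infl (Φ a)) (relabel (Equiv.sumAssoc ι κ μ) g) =
      infl (fun h c => infl (fun a b => Φ a b c) h) g := by
  refine congrFun (eq_infl _
    (fun g => infl (fun a => infl (Φ a)) (relabel (Equiv.sumAssoc ι κ μ) g)) ?_ ?_) g
  · intro h w c
    by_cases hh : ∃ a u b, h = blockUpper a u b
    · obtain ⟨a, u, b, rfl⟩ := hh
      rw [← fromRows_toRows w, relabel_sumAssoc_blockUpper, infl_blockUpper, infl_blockUpper,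
        infl_blockUpper]
    · rw [infl_eq_zero _ h hh]
      refine infl_eq_zero _ _ ?_
      rintro ⟨a, v, b, hb⟩
      apply hh
      apply exists_blockUpper
      ext i j
      have h1 : (relabel (Equiv.sumAssoc ι κ μ) (blockUpper h w c)).val (Sum.inr (Sum.inl i))
          (Sum.inl j) = (blockUpper a v b).val (Sum.inr (Sum.inl i)) (Sum.inl j) := by rw [hb]
      have h2 : h.val (Sum.inr i) (Sum.inl j) = 0 := by simpa using h1
      exact h2
  · intro g hg
    by_contra hne
    obtain ⟨a, v, b', h1⟩ := by_contra fun h => hne (infl_eq_zero _ _ h)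
    rw [h1, infl_blockUpper] at hne
    obtain ⟨b, w, c, rfl⟩ := by_contra fun h => hne (infl_eq_zero _ _ h)
    rw [← fromCols_toCols v, ← relabel_sumAssoc_blockUpper] at h1
    exact hg ⟨_, _, _, (relabel _).injective h1⟩

theorem conjSum_mul_left {G : Type*} [Group G] [Fintype G] (c : ℂ) (Ψ : G → ℂ) (g : G) :
    conjSum (fun h => c * Ψ h) g = c * conjSum Ψ g := by
  simp [conjSum, Finset.mul_sum]

theorem infl_mul_left (c : ℂ) (Φ : GeneralLinearGroup ι F → GeneralLinearGroup κ F → ℂ) :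
    (infl fun a b => c * Φ a b) = fun g => c * infl Φ g := by
  funext g
  simp only [infl, Finset.mul_sum, mul_ite, mul_zero]

theorem card_GL_ne_zero : (Fintype.card (GeneralLinearGroup ι F) : ℂ) ≠ 0 := by
  exact_mod_cast Fintype.card_ne_zero

theorem parCard_ne_zero : parCard F ι κ ≠ 0 :=
  mul_ne_zero (mul_ne_zero card_GL_ne_zero card_GL_ne_zero) (pow_ne_zero _ card_ne_zero')

/-- Transitivity of induction when the second factor is already a class function: its superfluous
sum over conjugates contributes the order of its group, which cancels. -/
theorem conjSum_infl_conjSum_left (Ψ : GeneralLinearGroup ι F → ℂ)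
    (χ : GeneralLinearGroup κ F → ℂ) (hχ : ∀ x g, χ (x * g * x⁻¹) = χ g)
    (g : GeneralLinearGroup (ι ⊕ κ) F) :
    conjSum (infl fun a b => conjSum Ψ a * χ b) g =
      Fintype.card (GeneralLinearGroup ι F) * conjSum (infl fun a b => Ψ a * χ b) g := by
  have h := conjSum_infl_conjSum (fun a b => Ψ a * χ b) g
  have h1 : (fun (a : GeneralLinearGroup ι F) (b : GeneralLinearGroup κ F) =>
      ∑ x, ∑ y, Ψ (x * a * x⁻¹) * χ (y * b * y⁻¹)) =
      fun a b => (Fintype.card (GeneralLinearGroup κ F) : ℂ) * (conjSum Ψ a * χ b) := by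
    funext a b
    simp only [hχ, Finset.sum_const, Finset.card_univ, nsmul_eq_mul, conjSum, Finset.sum_mul,
      Finset.mul_sum]
  rw [h1, infl_mul_left, conjSum_mul_left] at h
  have h2 := card_GL_ne_zero (F := F) (ι := κ)
  apply mul_left_cancel₀ h2
  rw [h]
  ring

theorem conjSum_infl_conjSum_right (χ : GeneralLinearGroup ι F → ℂ)
    (Ψ : GeneralLinearGroup κ F → ℂ) (hχ : ∀ x g, χ (x * g * x⁻¹) = χ g)
    (g : GeneralLinearGroup (ι ⊕ κ) F) :
    conjSum (infl fun a b => χ a * conjSum Ψ b) g =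
      Fintype.card (GeneralLinearGroup κ F) * conjSum (infl fun a b => χ a * Ψ b) g := by
  have h := conjSum_infl_conjSum (fun a b => χ a * Ψ b) g
  have h1 : (fun (a : GeneralLinearGroup ι F) (b : GeneralLinearGroup κ F) =>
      ∑ x, ∑ y, χ (x * a * x⁻¹) * Ψ (y * b * y⁻¹)) =
      fun a b => (Fintype.card (GeneralLinearGroup ι F) : ℂ) * (χ a * conjSum Ψ b) := by
    funext a b
    simp only [hχ, Finset.sum_const, Finset.card_univ, nsmul_eq_mul, conjSum,
      Finset.mul_sum]
  rw [h1, infl_mul_left, conjSum_mul_left] at h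
  have h2 := card_GL_ne_zero (F := F) (ι := ι)
  apply mul_left_cancel₀ h2
  rw [h]
  ring

theorem infl_mul_right (c : ℂ) (Φ : GeneralLinearGroup ι F → GeneralLinearGroup κ F → ℂ) :
    (infl fun a b => Φ a b * c) = fun g => infl Φ g * c := by
  funext g
  simp only [infl, Finset.sum_mul, ite_mul, zero_mul]

/-- The order of the intermediate group `GL (ι ⊕ κ)` cancels between the two inductions. What
remains is the order of the group of block upper triangular matrices with three diagonal blocks,
which is the same for the other bracketing. -/
theorem evalGL_mul_mul {k l m : ℕ} (hk : Fintype.card ι = k) (hl : Fintype.card κ = l)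
    (hm : Fintype.card μ = m) (x y z : ⨁ n, cf (GLn F n))
    (hx : x ∈ homog (fun n => cf (GLn F n)) k) (hy : y ∈ homog (fun n => cf (GLn F n)) l)
    (hz : z ∈ homog (fun n => cf (GLn F n)) m) (g : GeneralLinearGroup ((ι ⊕ κ) ⊕ μ) F) :
    evalGL g ((glHopf F).mul ((glHopf F).mul x y) z) =
      (Fintype.card (GeneralLinearGroup ι F) * Fintype.card (GeneralLinearGroup κ F) *
        Fintype.card (GeneralLinearGroup μ F) * (Fintype.card F : ℂ) ^ (Fintype.card ι *
        Fintype.card κ + Fintype.card ι * Fintype.card μ + Fintype.card κ * Fintype.card μ))⁻¹ *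
        conjSum (infl fun h c => infl (fun a b => evalGL a x * (evalGL b y * evalGL c z)) h) g := by
  rw [evalGL_mul (by rw [Fintype.card_sum, hk, hl]) hm _ _ (glHopf_mul_mem k l x hx y hy) hz]
  simp only [evalGL_mul hk hl _ _ hx hy, ← mul_assoc, infl_mul_right]
  simp only [mul_assoc, infl_mul_left, conjSum_mul_left]
  rw [conjSum_infl_conjSum_left _ _ fun x g => by rw [evalGL_conj]]
  rw [parCard, parCard, Fintype.card_sum, ← mul_assoc, ← mul_assoc]
  congr 1
  have := card_GL_ne_zero (F := F) (ι := ι)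
  have := card_GL_ne_zero (F := F) (ι := κ)
  have := card_GL_ne_zero (F := F) (ι := μ)
  have := card_GL_ne_zero (F := F) (ι := ι ⊕ κ)
  have := card_ne_zero' (F := F)
  rw [add_mul, pow_add, pow_add, pow_add]
  field_simp

theorem evalGL_mul_mul' {k l m : ℕ} (hk : Fintype.card ι = k) (hl : Fintype.card κ = l)
    (hm : Fintype.card μ = m) (x y z : ⨁ n, cf (GLn F n))
    (hx : x ∈ homog (fun n => cf (GLn F n)) k) (hy : y ∈ homog (fun n => cf (GLn F n)) l)
    (hz : z ∈ homog (fun n => cf (GLn F n)) m) (g : GeneralLinearGroup (ι ⊕ (κ ⊕ μ)) F) :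
    evalGL g ((glHopf F).mul x ((glHopf F).mul y z)) =
      (Fintype.card (GeneralLinearGroup ι F) * Fintype.card (GeneralLinearGroup κ F) *
        Fintype.card (GeneralLinearGroup μ F) * (Fintype.card F : ℂ) ^ (Fintype.card ι *
        Fintype.card κ + Fintype.card ι * Fintype.card μ + Fintype.card κ * Fintype.card μ))⁻¹ *
        conjSum (infl fun a => infl fun b c => evalGL a x * (evalGL b y * evalGL c z)) g := by
  rw [evalGL_mul hk (by rw [Fintype.card_sum, hl, hm]) _ _ hx (glHopf_mul_mem l m y hy z hz)]
  simp only [evalGL_mul hl hm _ _ hy hz, infl_mul_left, mul_left_comm, conjSum_mul_left]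
  rw [conjSum_infl_conjSum_right _ _ fun x g => by rw [evalGL_conj]]
  rw [parCard, parCard, Fintype.card_sum, ← mul_assoc, ← mul_assoc]
  congr 1
  have := card_GL_ne_zero (F := F) (ι := ι)
  have := card_GL_ne_zero (F := F) (ι := κ)
  have := card_GL_ne_zero (F := F) (ι := μ)
  have := card_GL_ne_zero (F := F) (ι := κ ⊕ μ)
  have := card_ne_zero' (F := F)
  rw [mul_add, pow_add, pow_add, pow_add]
  field_simp

theorem glHopf_mul_assoc (x y z : ⨁ n, cf (GLn F n)) :
    (glHopf F).mul ((glHopf F).mul x y) z = (glHopf F).mul x ((glHopf F).mul y z) := by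
  induction x using homog_induction with
  | h0 => simp
  | hadd x x' hx hx' => simp only [map_add, LinearMap.add_apply, hx, hx']
  | h k x hx =>
    induction y using homog_induction with
    | h0 => simp
    | hadd y y' hy hy' => simp only [map_add, LinearMap.add_apply, hy, hy']
    | h l y hy =>
      induction z using homog_induction with
      | h0 => simp
      | hadd z z' hz hz' => simp only [map_add, hz, hz']
      | h m z hz =>
        refine ext_of_mem_homog (ι := (Fin k ⊕ Fin l) ⊕ Fin m) (n := k + l + m) (by simp) _ _
          (glHopf_mul_mem _ _ _ (glHopf_mul_mem _ _ _ hx _ hy) _ hz) ?_ fun g => ?_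
        · rw [add_assoc]
          exact glHopf_mul_mem _ _ _ hx _ (glHopf_mul_mem _ _ _ hy _ hz)
        · rw [evalGL_mul_mul (by simp) (by simp) (by simp) x y z hx hy hz,
            ← evalGL_relabel (Equiv.sumAssoc _ _ _),
            evalGL_mul_mul' (by simp) (by simp) (by simp) x y z hx hy hz, conjSum_mulEquiv]
          simp only [infl_relabel_sumAssoc]

theorem evalGL_one (g : GeneralLinearGroup ι F) :
    evalGL g (glHopf F).one = if Fintype.card ι = 0 then 1 else 0 := by
  split_ifs with h
  · exact evalGL_lof (Fintype.equivFinOfCardEq h) g _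
  · exact evalGL_lof_of_ne h g _

theorem glHopf_one_mem : (glHopf F).one ∈ homog (fun n => cf (GLn F n)) 0 := ⟨_, rfl⟩

/-- With an empty first block every matrix is block upper triangular and coincides, up to
relabelling, with its second block. -/
theorem infl_isEmpty_left [IsEmpty ι] (x : ⨁ n, cf (GLn F n)) :
    (infl fun (_ : GeneralLinearGroup ι F) (b : GeneralLinearGroup κ F) => evalGL b x) =
      fun g => evalGL g x := by
  symm
  apply eq_infl
  · intro a u b
    rw [← evalGL_relabel (Equiv.emptySum ι κ)]
    rfl
  · intro g hg
    exact absurd (exists_blockUpper g (by ext i j; exact isEmptyElim j)) hg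

theorem infl_isEmpty_right [IsEmpty κ] (x : ⨁ n, cf (GLn F n)) :
    (infl fun (a : GeneralLinearGroup ι F) (_ : GeneralLinearGroup κ F) => evalGL a x) =
      fun g => evalGL g x := by
  symm
  apply eq_infl
  · intro a u b
    rw [← evalGL_relabel (Equiv.sumEmpty ι κ)]
    rfl
  · intro g hg
    exact absurd (exists_blockUpper g (by ext i j; exact isEmptyElim i)) hg

theorem card_GL_isEmpty [IsEmpty ι] : Fintype.card (GeneralLinearGroup ι F) = 1 :=
  Fintype.card_eq_one_iff.2 ⟨1, fun _ => Units.ext (Subsingleton.elim _ _)⟩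

theorem glHopf_one_mul (x : ⨁ n, cf (GLn F n)) : (glHopf F).mul (glHopf F).one x = x := by
  induction x using homog_induction with
  | h0 => simp
  | hadd x x' hx hx' => simp only [map_add, hx, hx']
  | h n x hx =>
    refine ext_of_mem_homog (ι := Fin 0 ⊕ Fin n) (n := n) (by simp) _ _ ?_ hx fun g => ?_
    · have h := glHopf_mul_mem _ _ _ (glHopf_one_mem (F := F)) _ hx
      rwa [zero_add] at h
    · rw [evalGL_mul (by simp) (by simp) _ _ glHopf_one_mem hx]
      simp only [evalGL_one, Fintype.card_fin, if_true, one_mul, infl_isEmpty_left]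
      rw [conjSum_of_conj _ (fun x g => by rw [evalGL_conj]), parCard, card_GL_isEmpty,
        card_GL_congr F (Equiv.emptySum (Fin 0) (Fin n))]
      simp

theorem glHopf_mul_one (x : ⨁ n, cf (GLn F n)) : (glHopf F).mul x (glHopf F).one = x := by
  induction x using homog_induction with
  | h0 => simp
  | hadd x x' hx hx' => simp only [map_add, LinearMap.add_apply, hx, hx']
  | h n x hx =>
    refine ext_of_mem_homog (ι := Fin n ⊕ Fin 0) (n := n) (by simp) _ _ ?_ hx fun g => ?_
    · exact glHopf_mul_mem _ _ _ hx _ (glHopf_one_mem (F := F))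
    · rw [evalGL_mul (by simp) (by simp) _ _ hx glHopf_one_mem]
      simp only [evalGL_one, Fintype.card_fin, if_true, mul_one, infl_isEmpty_right]
      rw [conjSum_of_conj _ (fun x g => by rw [evalGL_conj]), parCard,
        card_GL_isEmpty (ι := Fin 0), card_GL_congr F (Equiv.sumEmpty (Fin n) (Fin 0))]
      simp

theorem glHopf_counit : (glHopf F).counit = evalGL (1 : GeneralLinearGroup (Fin 0) F) := by
  refine DirectSum.linearMap_ext ℂ fun n => LinearMap.ext fun φ => ?_
  simp only [LinearMap.comp_apply]
  simp only [glHopf, DirectSum.toModule_lof]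
  split_ifs with hn
  · subst hn
    rw [evalGL_lof (Equiv.refl _)]
    rfl
  · rw [evalGL_lof_of_ne (by simpa using Ne.symm hn)]
    rfl

theorem glHopf_coassoc (x : ⨁ n, cf (GLn F n)) :
    TensorProduct.assoc ℂ _ _ _ ((glHopf F).comul.rTensor _ ((glHopf F).comul x)) =
      (glHopf F).comul.lTensor _ ((glHopf F).comul x) := by
  refine ((separates_evalGL F).tensor ((separates_evalGL F).tensor (separates_evalGL F))).ext ?_
  rintro ⟨⟨k, a⟩, ⟨l, b⟩, ⟨m, c⟩⟩
  dsimp only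
  rw [tensorEval_assoc, tensorEval_rTensor, tensorEval_lTensor, evalGL_comul, evalGL_comul,
    tensorEval_smul_sum_left, tensorEval_smul_sum_right]
  simp only [evalGL_comul_apply, ← Finset.mul_sum]
  rw [← mul_assoc, ← mul_assoc]
  congr 1
  · simp only [Fintype.card_sum, Fintype.card_fin]
    rw [← mul_inv, ← mul_inv, ← pow_add, ← pow_add]
    congr 2
    ring
  · rw [← Fintype.sum_prod_type', ← Fintype.sum_prod_type']
    -- Both sides sum over the three blocks above the diagonal of a matrix with three diagonal
    -- blocks; `E` regroups them from `(u₁₂, (u₁₃, u₂₃))` to `(u₂₃, (u₁₂, u₁₃))`.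
    let E : Matrix (Fin k) (Fin l) F × Matrix (Fin k ⊕ Fin l) (Fin m) F ≃
        Matrix (Fin l) (Fin m) F × Matrix (Fin k) (Fin l ⊕ Fin m) F :=
      { toFun := fun p => (p.2.toRows₂, fromCols p.1 p.2.toRows₁)
        invFun := fun p => (p.2.toCols₁, fromRows p.2.toCols₂ p.1)
        left_inv := fun p => by simp
        right_inv := fun p => by simp }
    refine Fintype.sum_equiv E _ _ fun p => ?_
    rw [← evalGL_relabel (Equiv.sumAssoc _ _ _)]
    conv_lhs => rw [← fromRows_toRows p.2, relabel_sumAssoc_blockUpper]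
    rfl

theorem glHopf_counit_left (x : ⨁ n, cf (GLn F n)) :
    TensorProduct.lid ℂ _ ((glHopf F).counit.rTensor _ ((glHopf F).comul x)) = x := by
  refine (separates_evalGL F).ext ?_
  rintro ⟨n, b⟩
  dsimp only
  rw [eval_lid_rTensor, glHopf_counit, evalGL_comul_apply]
  have h : ∀ u : Matrix (Fin 0) (Fin n) F, evalGL (blockUpper 1 u b) x = evalGL b x := by
    intro u
    rw [← congrFun (infl_isEmpty_left x) (blockUpper 1 u b), infl_blockUpper]
  simp only [h, Finset.sum_const, Finset.card_univ, nsmul_eq_mul, card_matrix_eq]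
  simp

theorem glHopf_counit_right (x : ⨁ n, cf (GLn F n)) :
    TensorProduct.rid ℂ _ ((glHopf F).counit.lTensor _ ((glHopf F).comul x)) = x := by
  refine (separates_evalGL F).ext ?_
  rintro ⟨n, b⟩
  dsimp only
  rw [eval_rid_lTensor, glHopf_counit, evalGL_comul_apply]
  have h : ∀ u : Matrix (Fin n) (Fin 0) F, evalGL (blockUpper b u 1) x = evalGL b x := by
    intro u
    rw [← congrFun (infl_isEmpty_right x) (blockUpper b u 1), infl_blockUpper]
  simp only [h, Finset.sum_const, Finset.card_univ, nsmul_eq_mul, card_matrix_eq]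
  simp

theorem glHopf_comul_one : (glHopf F).comul (glHopf F).one =
    (glHopf F).one ⊗ₜ[ℂ] (glHopf F).one := by
  refine ((separates_evalGL F).tensor (separates_evalGL F)).ext ?_
  rintro ⟨⟨k, a⟩, ⟨l, b⟩⟩
  dsimp only
  rw [evalGL_comul_apply, tensorEval_tmul]
  simp only [evalGL_one, Finset.sum_const, Finset.card_univ, nsmul_eq_mul, card_matrix_eq,
    Fintype.card_sum, Fintype.card_fin]
  rw [← mul_assoc, inv_mul_cancel₀ (pow_ne_zero _ card_ne_zero'), one_mul]
  by_cases hk : k = 0 <;> by_cases hl : l = 0 <;> simp [hk, hl]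

theorem glHopf_counit_one : (glHopf F).counit (glHopf F).one = 1 := by
  rw [glHopf_counit, evalGL_one]
  simp

theorem glHopf_counit_mul (x y : ⨁ n, cf (GLn F n)) :
    (glHopf F).counit ((glHopf F).mul x y) = (glHopf F).counit x * (glHopf F).counit y := by
  rw [glHopf_counit]
  induction x using homog_induction with
  | h0 => simp
  | hadd x x' hx hx' => simp only [map_add, LinearMap.add_apply, hx, hx', add_mul]
  | h k x hx =>
    induction y using homog_induction with
    | h0 => simp
    | hadd y y' hy hy' => simp only [map_add, hy, hy', mul_add]
    | h l y hy =>
      by_cases hk : k = 0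
      · by_cases hl : l = 0
        · subst hk hl
          have h1 : (1 : GeneralLinearGroup (Fin 0) F) =
              relabel (Equiv.emptySum (Fin 0) (Fin 0)) (blockUpper 1 0 1) :=
            Units.ext (Subsingleton.elim _ _)
          conv_lhs => rw [h1, evalGL_relabel,
            evalGL_mul (by simp) (by simp) x y hx hy]
          rw [conjSum, Fintype.sum_subsingleton _ 1]
          simp [parCard]
        · rw [evalGL_of_mem (by simpa using Ne.symm hl) _ y hy, mul_zero]
          refine evalGL_of_mem ?_ _ _ (glHopf_mul_mem _ _ _ hx _ hy)
          simp only [Fintype.card_fin]; omega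
      · rw [evalGL_of_mem (by simpa using Ne.symm hk) _ x hx, zero_mul]
        refine evalGL_of_mem ?_ _ _ (glHopf_mul_mem _ _ _ hx _ hy)
        simp only [Fintype.card_fin]; omega

theorem glHopf_counit_mem (n : ℕ) (hn : n ≠ 0) (x : ⨁ n, cf (GLn F n))
    (hx : x ∈ homog (fun n => cf (GLn F n)) n) : (glHopf F).counit x = 0 := by
  rw [glHopf_counit]
  exact evalGL_of_mem (by simpa using Ne.symm hn) _ _ hx

theorem glHopf_connected : Module.finrank ℂ (homog (fun n => cf (GLn F n)) 0) = 1 := by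
  refine finrank_eq_one (⟨(glHopf F).one, glHopf_one_mem⟩ : homog (fun n => cf (GLn F n)) 0) ?_ ?_
  · intro h
    have h1 : (glHopf F).one = 0 := congrArg Subtype.val h
    have h2 := glHopf_counit_one (F := F)
    rw [h1, map_zero] at h2
    exact zero_ne_one h2
  · rintro ⟨x, hx⟩
    refine ⟨evalGL (1 : GeneralLinearGroup (Fin 0) F) x, Subtype.ext ?_⟩
    refine ext_of_mem_homog (ι := Fin 0) (by simp) _ _ ?_ hx fun g => ?_
    · exact Submodule.smul_mem _ _ glHopf_one_mem
    · have hg : g = 1 := Units.ext (Subsingleton.elim _ _)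
      subst hg
      simp [evalGL_one]

end GLAxioms

/-! ## A Mackey formula for restriction to block upper triangular matrices -/

section DoubleCosets

variable {G I : Type*} [Group G] [Fintype G] [Fintype I]

/-- The sum of `f (k * w * p)` over `K × P` is computed twice. Invariance under `K` removes `k`; on
the other hand, every point of the double coset is attained equally often, once for each element of
`S`, the intersection of `P` with a conjugate of `K`. -/
theorem sum_doubleCoset (K P : Subgroup G) (w : G) (f : G → ℂ)
    (hf : ∀ k ∈ K, ∀ g, f (k * g) = f g) :
    ∑ g, (if ∃ k ∈ K, ∃ p ∈ P, g = k * w * p then f g else 0) =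
      Fintype.card K / (Finset.univ.filter fun p => p ∈ P ∧ w * p * w⁻¹ ∈ K).card *
        ∑ p, if p ∈ P then f (w * p) else 0 := by
  set S := Finset.univ.filter fun p => p ∈ P ∧ w * p * w⁻¹ ∈ K with hS
  have hS0 : (S.card : ℂ) ≠ 0 := by
    have : (1 : G) ∈ S := by simp [hS]
    exact_mod_cast (Finset.card_pos.2 ⟨1, this⟩).ne'
  have hcardK : (Fintype.card K : ℂ) = (Finset.univ.filter fun k => k ∈ K).card := by
    rw [← Fintype.card_subtype]
  let KP : Finset (G × G) := Finset.univ.filter fun x => x.1 ∈ K ∧ x.2 ∈ P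
  have h1 : ∑ x ∈ KP, f (x.1 * w * x.2) =
      Fintype.card K * ∑ p, if p ∈ P then f (w * p) else 0 := by
    have : KP = (Finset.univ.filter fun k => k ∈ K) ×ˢ (Finset.univ.filter fun p => p ∈ P) := by
      ext x
      simp [KP]
    rw [this, Finset.sum_product, hcardK, ← nsmul_eq_mul, ← Finset.sum_const]
    refine Finset.sum_congr rfl fun k hk => ?_
    rw [← Finset.sum_filter]
    refine Finset.sum_congr rfl fun p _ => ?_
    rw [mul_assoc, hf k (Finset.mem_filter.1 hk).2]
  have h2 : ∑ x ∈ KP, f (x.1 * w * x.2) =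
      S.card * ∑ g, (if ∃ k ∈ K, ∃ p ∈ P, g = k * w * p then f g else 0) := by
    rw [← Finset.sum_fiberwise KP (fun x => x.1 * w * x.2), Finset.mul_sum]
    refine Finset.sum_congr rfl fun g _ => ?_
    rw [Finset.sum_congr rfl fun x hx => by rw [(Finset.mem_filter.1 hx).2], Finset.sum_const,
      nsmul_eq_mul]
    split_ifs with h
    · obtain ⟨k, hk, p, hp, rfl⟩ := h
      congr 2
      -- If `k' w p' = k w p`, then `p p'⁻¹` is in `P`, and conjugation by `w` takes it to `k⁻¹ k'`
      -- in `K`. Conversely, `q` in `S` comes from `(k w q w⁻¹, q⁻¹ p)`.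
      refine Finset.card_bij (fun x _ => p * x.2⁻¹) ?_ ?_ ?_
      · rintro ⟨k', p'⟩ hx
        simp only [KP, hS, Finset.mem_filter, Finset.mem_univ, true_and] at hx ⊢
        refine ⟨P.mul_mem hp (P.inv_mem hx.1.2), ?_⟩
        have : w * (p * p'⁻¹) * w⁻¹ = k⁻¹ * k' := by
          have h3 := hx.2
          rw [eq_inv_mul_iff_mul_eq]
          calc k * (w * (p * p'⁻¹) * w⁻¹) = (k * w * p) * p'⁻¹ * w⁻¹ := by group
            _ = k' := by rw [← h3]; group
        rw [this]
        exact K.mul_mem (K.inv_mem hk) hx.1.1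
      · rintro ⟨k', p'⟩ hx ⟨k'', p''⟩ hy hxy
        simp only [KP, Finset.mem_filter, Finset.mem_univ, true_and] at hx hy hxy
        have h3 : p' = p'' := inv_injective (mul_left_cancel hxy)
        subst h3
        have h4 := hx.2.trans hy.2.symm
        rw [mul_left_inj, mul_left_inj] at h4
        rw [h4]
      · intro q hq
        simp only [hS, Finset.mem_filter, Finset.mem_univ, true_and] at hq
        refine ⟨(k * (w * q * w⁻¹), q⁻¹ * p), ?_, by group⟩
        simp only [KP, Finset.mem_filter, Finset.mem_univ, true_and]
        exact ⟨⟨K.mul_mem hk hq.2, P.mul_mem (P.inv_mem hq.1) hp⟩, by group⟩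
    · rw [Finset.card_eq_zero.2, Nat.cast_zero, zero_mul, mul_zero]
      refine Finset.filter_eq_empty_iff.2 ?_
      rintro ⟨k, p⟩ hx rfl
      simp only [KP, Finset.mem_filter, Finset.mem_univ, true_and] at hx
      exact h ⟨k, hx.1, p, hx.2, rfl⟩
  rw [div_mul_eq_mul_div, ← h1, h2, mul_div_cancel_left₀ _ hS0]

theorem sum_eq_sum_doubleCoset (K P : Subgroup G) (w : I → G)
    (hw : ∀ g, ∃! i, ∃ k ∈ K, ∃ p ∈ P, g = k * w i * p) (f : G → ℂ)
    (hf : ∀ k ∈ K, ∀ g, f (k * g) = f g) :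
    ∑ g, f g = ∑ i, Fintype.card K /
      (Finset.univ.filter fun p => p ∈ P ∧ w i * p * (w i)⁻¹ ∈ K).card *
        ∑ p, if p ∈ P then f (w i * p) else 0 := by
  simp only [← sum_doubleCoset K P _ f hf]
  rw [Finset.sum_comm]
  refine Finset.sum_congr rfl fun g _ => ?_
  obtain ⟨i, hi, hu⟩ := hw g
  rw [Finset.sum_eq_single i, if_pos hi]
  · intro j _ hj
    rw [if_neg fun h => hj (hu j h)]
  · simp

end DoubleCosets

section Mackey

variable {F : Type*} [Field F]
variable {ι κ μ : Type} [Fintype ι] [DecidableEq ι] [Fintype κ] [DecidableEq κ]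
  [Fintype μ] [DecidableEq μ]

variable (F) in
/-- The group of block upper triangular matrices, relabelled. -/
def parabolic (s : ι ⊕ κ ≃ μ) : Subgroup (GeneralLinearGroup μ F) where
  carrier := {g | ∃ a u b, g = relabel s (blockUpper a u b)}
  mul_mem' := by
    rintro _ _ ⟨a, u, b, rfl⟩ ⟨a', u', b', rfl⟩
    rw [← map_mul, blockUpper_mul]
    exact ⟨_, _, _, rfl⟩
  one_mem' := ⟨1, 0, 1, by
    have : blockUpper (1 : GeneralLinearGroup ι F) 0 (1 : GeneralLinearGroup κ F) = 1 := by
      apply Units.ext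
      simp
    rw [this, map_one]⟩
  inv_mem' := by
    rintro _ ⟨a, u, b, rfl⟩
    rw [← map_inv, blockUpper_inv]
    exact ⟨_, _, _, rfl⟩

theorem mem_parabolic_iff (s : ι ⊕ κ ≃ μ) (g : GeneralLinearGroup μ F) :
    g ∈ parabolic F s ↔ ∀ a b, g.val (s (Sum.inr a)) (s (Sum.inl b)) = 0 := by
  constructor
  · rintro ⟨a, u, b, rfl⟩ i j
    simp
  · intro h
    obtain ⟨a, u, b, hg⟩ := exists_blockUpper (relabel s.symm g) (by
      ext i j
      exact h i j)
    exact ⟨a, u, b, by rw [← hg, relabel_relabel_symm]⟩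

variable [Fintype F]

theorem sum_parabolic (s : ι ⊕ κ ≃ μ) (Ψ : GeneralLinearGroup μ F → ℂ) :
    (∑ p, if p ∈ parabolic F s then Ψ p else 0) =
      ∑ a, ∑ b, ∑ u, Ψ (relabel s (blockUpper a u b)) := by
  rw [← (relabel s).toEquiv.sum_comp, sum_eq_sum_blockUpper]
  · refine Finset.sum_congr rfl fun a _ => Finset.sum_congr rfl fun b _ =>
      Finset.sum_congr rfl fun u _ => ?_
    rw [if_pos ⟨a, u, b, rfl⟩]
    rfl
  · intro g hg
    rw [if_neg]
    rintro ⟨a, u, b, h⟩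
    exact hg ⟨a, u, b, (relabel s).injective h⟩

/-- Restriction to block upper triangular matrices of a function that is induced from a
subgroup `K`, where the double cosets are represented by the bijections `s i`. -/
theorem sum_conjSum_blockUpper {I : Type*} [Fintype I] (K : Subgroup (GeneralLinearGroup μ F))
    (s₀ : ι ⊕ κ ≃ μ) (s : I → (ι ⊕ κ ≃ μ))
    (hex : ∀ g : GeneralLinearGroup μ F, ∃ i, ∃ k ∈ K, ∀ a b,
      (k * g).val (s i (Sum.inr a)) (s₀ (Sum.inl b)) = 0)
    (huniq : ∀ i j, ∀ k ∈ K, (∀ a b, k.val (s i (Sum.inr a)) (s j (Sum.inl b)) = 0) → i = j)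
    (f : GeneralLinearGroup μ F → ℂ) (hf : ∀ k ∈ K, ∀ g, f (k * g * k⁻¹) = f g)
    (a : GeneralLinearGroup ι F) (b : GeneralLinearGroup κ F) :
    ∑ u, conjSum f (relabel s₀ (blockUpper a u b)) =
      (Fintype.card F : ℂ) ^ (Fintype.card ι * Fintype.card κ) * ∑ i, Fintype.card K /
        (∑ x, ∑ y, ∑ u, if relabel (s i) (blockUpper x u y) ∈ K then (1 : ℂ) else 0) *
        ∑ x, ∑ y, ∑ u, f (relabel (s i) (blockUpper (x * a * x⁻¹) u (y * b * y⁻¹))) := by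
  -- The permutation matrix `w i` carries the labelling `s₀` to `s i` and represents the double
  -- coset of index `i`.
  choose w hw hconj using fun i => exists_conj_relabel (F := F) s₀ (s i)
  have hwmul : ∀ i (M : GeneralLinearGroup μ F) c d,
      (w i * M).val (s i c) d = M.val (s₀ c) d := by
    intro i M c d
    simp [hw, Matrix.mul_apply, Matrix.one_apply, Equiv.eq_symm_apply]
  have hmulw : ∀ i (M : GeneralLinearGroup μ F) c d,
      (M * w i).val c (s₀ d) = M.val c (s i d) := by
    intro i M c d
    simp [hw, Matrix.mul_apply, Matrix.one_apply, Equiv.symm_apply_eq]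
  have hwinv : ∀ i (M : GeneralLinearGroup μ F) c d,
      ((w i)⁻¹ * M).val (s₀ c) d = M.val (s i c) d := by
    intro i M c d
    rw [← hwmul i, mul_inv_cancel_left]
  -- The vanishing of the entries in `hex` means that `(w i)⁻¹ * (k * g)` is block upper triangular.
  -- So `hex` gives existence, and `huniq`, applied to a quotient of two such expressions, gives
  -- uniqueness.
  have hcov : ∀ g, ∃! i, ∃ k ∈ K, ∃ p ∈ parabolic F s₀, g = k * w i * p := by
    intro g
    obtain ⟨i, k, hk, h⟩ := hex g
    refine ⟨i, ⟨k⁻¹, K.inv_mem hk, (w i)⁻¹ * (k * g), ?_, by group⟩, ?_⟩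
    · rw [mem_parabolic_iff]
      intro a b
      rw [hwinv, h]
    · rintro j ⟨k', hk', p, hp, rfl⟩
      symm
      apply huniq i j (k * k') (K.mul_mem hk hk')
      have hq : (w i)⁻¹ * (k * (k' * w j * p)) ∈ parabolic F s₀ := by
        rw [mem_parabolic_iff]
        intro a b
        rw [hwinv, h]
      have hr := (mem_parabolic_iff s₀ _).1 ((parabolic F s₀).mul_mem hq
        ((parabolic F s₀).inv_mem hp))
      intro a b
      rw [← hmulw, ← hwinv, ← hr a b]
      group
  -- The sum over conjugating elements is split along the double cosets; the denominator counts the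
  -- elements of `P` that `w i` conjugates into `K`.
  have hsum : ∀ g, conjSum f g = ∑ i, (Fintype.card K : ℂ) /
        (∑ x, ∑ y, ∑ u, if relabel (s i) (blockUpper x u y) ∈ K then (1 : ℂ) else 0) *
        ∑ x, ∑ y, ∑ u, f ((w i * relabel s₀ (blockUpper x u y)) * g *
          (w i * relabel s₀ (blockUpper x u y))⁻¹) := by
    intro g
    unfold conjSum
    rw [sum_eq_sum_doubleCoset K (parabolic F s₀) w hcov]
    · refine Finset.sum_congr rfl fun i _ => ?_
      congr 1
      · congr 1
        simp only [← hconj]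
        rw [← sum_parabolic s₀ fun p => if w i * p * (w i)⁻¹ ∈ K then (1 : ℂ) else 0]
        rw [Finset.card_filter]
        push_cast
        refine Finset.sum_congr rfl fun p _ => ?_
        by_cases h : p ∈ parabolic F s₀ <;> simp [h]
      · rw [← sum_parabolic s₀ fun p => f (w i * p * g * (w i * p)⁻¹)]
    · intro k hk x
      rw [← hf k hk (x * g * x⁻¹)]
      congr 1
      group
  simp only [hsum]
  rw [Finset.sum_comm, Finset.mul_sum]
  refine Finset.sum_congr rfl fun i _ => ?_
  rw [← Finset.mul_sum, mul_left_comm]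
  congr 1
  rw [Finset.mul_sum, Finset.sum_comm]
  refine Finset.sum_congr rfl fun x _ => ?_
  rw [Finset.mul_sum, Finset.sum_comm]
  refine Finset.sum_congr rfl fun y _ => ?_
  -- The block `z` of the conjugating matrix does not affect the sum over `u`; its possible values
  -- account for the power of `q`.
  rw [Finset.sum_comm, ← card_matrix_eq, ← nsmul_eq_mul, ← Finset.card_univ, ← Finset.sum_const]
  refine Finset.sum_congr rfl fun z _ => ?_
  have h := sum_blockUpper_conj x a z y b fun h => f (relabel (s i) h)
  rw [← h]
  refine Finset.sum_congr rfl fun u _ => ?_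
  rw [← hconj]
  congr 1
  simp only [map_mul, map_inv]
  group

end Mackey

/-! ## Double coset representatives -/

section Pivots

variable {F : Type*} [Field F]

/-- The columns in `J` of an invertible matrix are linearly independent, and they lie in a
coordinate space of dimension `A.card`. -/
theorem card_le_card_of_support {μ : Type} [Fintype μ] [DecidableEq μ]
    (g : GeneralLinearGroup μ F) (J A : Finset μ) (h : ∀ a ∉ A, ∀ j ∈ J, g.val a j = 0) :
    J.card ≤ A.card := by
  let N : Matrix A J F := g.val.submatrix Subtype.val Subtype.val
  have hinj : Function.Injective N.mulVecLin := by
    rw [← LinearMap.ker_eq_bot, LinearMap.ker_eq_bot']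
    intro v hv
    let w : μ → F := fun j => if hj : j ∈ J then v ⟨j, hj⟩ else 0
    have hsum : ∀ a, (g.val *ᵥ w) a = ∑ j : J, g.val a j * v j := by
      intro a
      rw [Matrix.mulVec, dotProduct, ← Finset.sum_subset (Finset.subset_univ J),
        ← Finset.sum_coe_sort J]
      · refine Finset.sum_congr rfl fun j _ => ?_
        simp [w]
      · intro j _ hj
        simp [w, hj]
    have hw : g.val *ᵥ w = 0 := by
      funext a
      rw [hsum]
      by_cases ha : a ∈ A
      · exact congrFun hv ⟨a, ha⟩
      · exact Finset.sum_eq_zero fun j _ => by rw [h a ha j j.2, zero_mul]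
    have hw0 : w = 0 := by
      have := congrArg (g⁻¹.val *ᵥ ·) hw
      simpa [Matrix.mulVec_mulVec] using this
    funext j
    have := congrFun hw0 j
    simpa [w] using this
  have := LinearMap.finrank_le_finrank_of_injective hinj
  simpa using this

variable [Fintype F]

/-- Gaussian elimination by unitriangular row operations. The columns in `J` are treated one at a
time, and `A` collects the pivot rows. -/
theorem exists_mul_support (n : ℕ) (g : GLn F n) (J : Finset (Fin n)) :
    ∃ k ∈ UT F n, ∃ A : Finset (Fin n), A.card = J.card ∧
      ∀ a ∉ A, ∀ j ∈ J, (k * g).val a j = 0 := by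
  induction J using Finset.induction_on with
  | empty => exact ⟨1, (UT F n).one_mem, ∅, rfl, by simp⟩
  | insert j J hj ih =>
    obtain ⟨k, hk, A, hA, h⟩ := ih
    -- Otherwise the columns in `insert j J` would be supported in `A`, which has only `J.card`
    -- rows.
    have hne : ((Finset.univ.filter fun a => a ∉ A ∧ (k * g).val a j ≠ 0)).Nonempty := by
      by_contra hemp
      rw [Finset.not_nonempty_iff_eq_empty, Finset.filter_eq_empty_iff] at hemp
      have := card_le_card_of_support (k * g) (insert j J) A fun a ha i hi => by
        rcases Finset.mem_insert.1 hi with rfl | hi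
        · by_contra hne
          exact hemp (Finset.mem_univ a) ⟨ha, hne⟩
        · exact h a ha i hi
      rw [Finset.card_insert_of_notMem hj] at this
      omega
    -- The pivot is the lowest of these rows, so only rows above it need clearing, which a
    -- unitriangular matrix can do.
    obtain ⟨p, hp, hmax⟩ := Finset.exists_max_image _ id hne
    simp only [Finset.mem_filter, Finset.mem_univ, true_and, id_eq] at hp hmax
    -- Multiples of row `p` are added to the rows above it outside `A`. The columns in `J` keep
    -- their support, since row `p` vanishes there.
    let N : Matrix (Fin n) (Fin n) F := Matrix.of fun i i' =>
      if i' = p ∧ i < p ∧ i ∉ A then -((k * g).val i j / (k * g).val p j) else 0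
    have hN : IsUnitri (1 + N) := by
      intro i i' hii
      rw [add_sub_cancel_left] at hii
      by_contra hlt
      refine hii (if_neg ?_)
      rintro ⟨rfl, h', -⟩
      exact hlt h'
    refine ⟨(UT.mk _ hN : UT F n).val * k, (UT F n).mul_mem (UT.mk _ hN : UT F n).2 hk,
      insert p A, by rw [Finset.card_insert_of_notMem hp.1, Finset.card_insert_of_notMem hj, hA], ?_⟩
    intro a ha i hi
    rw [Finset.mem_insert, not_or] at ha
    have hval : ((UT.mk _ hN : UT F n).val * k * g).val a i =
        (k * g).val a i + N a p * (k * g).val p i := by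
      rw [mul_assoc]
      change ((1 + N) * (k * g).val) a i = _
      rw [add_mul, one_mul, Matrix.add_apply, Matrix.mul_apply, Finset.sum_eq_single p]
      · intro b _ hb
        rw [show N a b = 0 from if_neg fun h => hb h.1, zero_mul]
      · simp
    rw [hval]
    rcases Finset.mem_insert.1 hi with rfl | hi
    · by_cases hap : a < p
      · rw [show N a p = _ from if_pos ⟨rfl, hap, ha.2⟩, neg_mul, div_mul_cancel₀ _ hp.2,
          add_neg_cancel]
      · rw [show N a p = 0 from if_neg fun h => hap h.2.1, zero_mul, add_zero]
        by_contra hne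
        exact ha.1 (le_antisymm (hmax a ⟨ha.2, hne⟩) (not_lt.1 hap))
    · rw [h a ha.2 i hi, h p hp.1 i hi, mul_zero, add_zero]

/-- Serves to move the pivot rows inside one diagonal block to the front. -/
theorem exists_perm_lt_card_iff {k : ℕ} (A : Finset (Fin k)) :
    ∃ σ : Equiv.Perm (Fin k), ∀ i, (σ i : ℕ) < A.card ↔ i ∈ A := by
  have hcard : Fintype.card {i // i ∈ A} = Fintype.card {i : Fin k // (i : ℕ) < A.card} := by
    rw [Fintype.card_coe, Fintype.card_subtype]
    have := A.card_le_univ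
    rw [Fintype.card_fin] at this
    simp [Fin.card_filter_val_lt, this]
  let e := Fintype.equivOfCardEq hcard
  refine ⟨e.extendSubtype, fun i => ⟨fun h => ?_, fun h => e.extendSubtype_mem i h⟩⟩
  by_contra hi
  exact e.extendSubtype_not_mem i hi h

end Pivots

/-! ## Compatibility of product and coproduct of `cf(GL_•)` -/

section FourBlocks

variable {F : Type*} [Field F] [Fintype F]
variable {α β γ δ : Type} [Fintype α] [DecidableEq α] [Fintype β] [DecidableEq β]
  [Fintype γ] [DecidableEq γ] [Fintype δ] [DecidableEq δ]

/-- The block with rows `β` and columns `γ` has to be zero because the exchange of the two middle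
index sets carries it below the diagonal. -/
theorem relabel_sumSumSumComm_blockUpper (a₁ : GeneralLinearGroup α F) (v : Matrix α β F)
    (a₂ : GeneralLinearGroup β F) (b₁ : GeneralLinearGroup γ F) (w : Matrix γ δ F)
    (b₂ : GeneralLinearGroup δ F) (u₁ : Matrix α γ F) (u₂ : Matrix α δ F) (u₃ : Matrix β δ F) :
    relabel (Equiv.sumSumSumComm α β γ δ)
      (blockUpper (blockUpper a₁ v a₂) (fromBlocks u₁ u₂ 0 u₃) (blockUpper b₁ w b₂)) =
      blockUpper (blockUpper a₁ u₁ b₁) (fromBlocks v u₂ 0 w) (blockUpper a₂ u₃ b₂) := by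
  apply Units.ext
  ext ((i | i) | (i | i)) ((j | j) | (j | j)) <;> rfl

/-- The twofold inflation of a function of four blocks. -/
def inflTwo (Ψ : GeneralLinearGroup α F → GeneralLinearGroup β F → GeneralLinearGroup γ F →
    GeneralLinearGroup δ F → ℂ) (a : GeneralLinearGroup (α ⊕ β) F)
    (b : GeneralLinearGroup (γ ⊕ δ) F) : ℂ :=
  infl (fun a₁ a₂ => infl (fun b₁ b₂ => Ψ a₁ a₂ b₁ b₂) b) a

/-- The relabelled matrix is block upper triangular only if `a` and `b` are and the block `β × γ` of
`u` vanishes. The block `α × δ` is then free and does not enter the diagonal blocks, whence the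
power of `q`. The blocks `α × γ` and `β × δ` become the parts above the diagonal of the two new
diagonal blocks. -/
theorem sum_infl_sumSumSumComm
    (Φ : GeneralLinearGroup (α ⊕ γ) F → GeneralLinearGroup (β ⊕ δ) F → ℂ)
    (a : GeneralLinearGroup (α ⊕ β) F) (b : GeneralLinearGroup (γ ⊕ δ) F) :
    ∑ u, infl Φ (relabel (Equiv.sumSumSumComm α β γ δ) (blockUpper a u b)) =
      (Fintype.card F : ℂ) ^ (Fintype.card α * Fintype.card δ) *
        inflTwo (fun a₁ a₂ b₁ b₂ => ∑ u₁, ∑ u₃, Φ (blockUpper a₁ u₁ b₁) (blockUpper a₂ u₃ b₂))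
          a b := by
  have hzero : ∀ u, infl Φ (relabel (Equiv.sumSumSumComm α β γ δ) (blockUpper a u b)) ≠ 0 →
      a.val.toBlocks₂₁ = 0 ∧ b.val.toBlocks₂₁ = 0 ∧ u.toBlocks₂₁ = 0 := by
    intro u hu
    obtain ⟨x, w, y, h⟩ := by_contra fun h => hu (infl_eq_zero _ _ h)
    have h0 : ∀ i j, (relabel (Equiv.sumSumSumComm α β γ δ) (blockUpper a u b)).val
        (Sum.inr i) (Sum.inl j) = 0 := by
      intro i j
      rw [h]
      rfl
    refine ⟨?_, ?_, ?_⟩ <;> ext i j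
    · exact h0 (Sum.inl i) (Sum.inl j)
    · exact h0 (Sum.inr i) (Sum.inr j)
    · exact h0 (Sum.inl i) (Sum.inr j)
  by_cases ha : ∃ a₁ v a₂, a = blockUpper a₁ v a₂
  swap
  · rw [inflTwo, infl_eq_zero _ _ ha, mul_zero]
    refine Finset.sum_eq_zero fun u _ => ?_
    by_contra hne
    exact ha (exists_blockUpper a (hzero u hne).1)
  by_cases hb : ∃ b₁ v b₂, b = blockUpper b₁ v b₂
  swap
  · obtain ⟨a₁, v, a₂, rfl⟩ := ha
    rw [inflTwo, infl_blockUpper, infl_eq_zero _ _ hb, mul_zero]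
    refine Finset.sum_eq_zero fun u _ => ?_
    by_contra hne
    exact hb (exists_blockUpper b (hzero u hne).2.1)
  obtain ⟨a₁, v, a₂, rfl⟩ := ha
  obtain ⟨b₁, w, b₂, rfl⟩ := hb
  rw [inflTwo, infl_blockUpper, infl_blockUpper]
  have h1 : ∑ u, infl Φ (relabel (Equiv.sumSumSumComm α β γ δ)
      (blockUpper (blockUpper a₁ v a₂) u (blockUpper b₁ w b₂))) =
      ∑ t : Matrix α δ F × Matrix α γ F × Matrix β δ F,
        infl Φ (relabel (Equiv.sumSumSumComm α β γ δ) (blockUpper (blockUpper a₁ v a₂)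
          (fromBlocks t.2.1 t.1 0 t.2.2) (blockUpper b₁ w b₂))) := by
    symm
    refine Finset.sum_bij_ne_zero (fun t _ _ => fromBlocks t.2.1 t.1 0 t.2.2)
      (fun _ _ _ => Finset.mem_univ _) ?_ ?_ (fun _ _ _ => rfl)
    · rintro ⟨t₁, t₂, t₃⟩ - - ⟨t₁', t₂', t₃'⟩ - - h
      obtain ⟨rfl, rfl, -, rfl⟩ := fromBlocks_inj.1 h
      rfl
    · intro u _ hu
      have hu' : fromBlocks u.toBlocks₁₁ u.toBlocks₁₂ 0 u.toBlocks₂₂ = u := by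
        rw [← (hzero u hu).2.2, fromBlocks_toBlocks]
      refine ⟨(u.toBlocks₁₂, u.toBlocks₁₁, u.toBlocks₂₂), Finset.mem_univ _, ?_, hu'⟩
      simpa only [hu'] using hu
  rw [h1]
  simp only [relabel_sumSumSumComm_blockUpper, infl_blockUpper]
  rw [Fintype.sum_prod_type]
  dsimp only
  rw [Finset.sum_const, Finset.card_univ, nsmul_eq_mul, card_matrix_eq,
    Fintype.sum_prod_type]

theorem inflTwo_mul_left (c : ℂ) (Ψ : GeneralLinearGroup α F → GeneralLinearGroup β F →
    GeneralLinearGroup γ F → GeneralLinearGroup δ F → ℂ) (a : GeneralLinearGroup (α ⊕ β) F)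
    (b : GeneralLinearGroup (γ ⊕ δ) F) :
    inflTwo (fun a₁ a₂ b₁ b₂ => c * Ψ a₁ a₂ b₁ b₂) a b = c * inflTwo Ψ a b := by
  simp only [inflTwo, infl_mul_left]

theorem inflTwo_mul (Ψ : GeneralLinearGroup α F → GeneralLinearGroup β F → ℂ)
    (Ψ' : GeneralLinearGroup γ F → GeneralLinearGroup δ F → ℂ) (a : GeneralLinearGroup (α ⊕ β) F)
    (b : GeneralLinearGroup (γ ⊕ δ) F) :
    inflTwo (fun a₁ a₂ b₁ b₂ => Ψ a₁ a₂ * Ψ' b₁ b₂) a b = infl Ψ a * infl Ψ' b := by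
  simp only [inflTwo, infl_mul_left, infl_mul_right]

theorem inflTwo_add (Ψ Ψ' : GeneralLinearGroup α F → GeneralLinearGroup β F →
    GeneralLinearGroup γ F → GeneralLinearGroup δ F → ℂ) (a : GeneralLinearGroup (α ⊕ β) F)
    (b : GeneralLinearGroup (γ ⊕ δ) F) :
    inflTwo (fun a₁ a₂ b₁ b₂ => Ψ a₁ a₂ b₁ b₂ + Ψ' a₁ a₂ b₁ b₂) a b =
      inflTwo Ψ a b + inflTwo Ψ' a b := by
  have h : ∀ {ι κ : Type} [Fintype ι] [DecidableEq ι] [Fintype κ] [DecidableEq κ]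
      (Φ Φ' : GeneralLinearGroup ι F → GeneralLinearGroup κ F → ℂ),
      (infl fun a b => Φ a b + Φ' a b) = fun g => infl Φ g + infl Φ' g := by
    intro ι κ _ _ _ _ Φ Φ'
    funext g
    simp only [infl, ← Finset.sum_add_distrib]
    refine Finset.sum_congr rfl fun a _ => Finset.sum_congr rfl fun b _ => ?_
    split_ifs <;> simp
  simp only [inflTwo, h]

theorem sum_infl_one : ∑ g : GeneralLinearGroup (α ⊕ β) F, infl (fun _ _ => (1 : ℂ)) g =
    parCard F α β := by
  rw [sum_eq_sum_blockUpper _ (infl_eq_zero _)]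
  simp [card_matrix_eq, parCard, mul_assoc]

theorem sum_sum_inflTwo_one :
    ∑ x : GeneralLinearGroup (α ⊕ β) F, ∑ y : GeneralLinearGroup (γ ⊕ δ) F,
      inflTwo (fun _ _ _ _ => (1 : ℂ)) x y = parCard F α β * parCard F γ δ := by
  have h := fun x y => inflTwo_mul (F := F) (α := α) (β := β) (γ := γ) (δ := δ)
    (fun _ _ => 1) (fun _ _ => 1) x y
  simp only [mul_one] at h
  simp only [h, ← Finset.mul_sum, ← Finset.sum_mul, sum_infl_one]

/-- The contribution of one double coset to the coproduct of a product. -/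
theorem sum_conj_infl_sumSumSumComm (x y : ⨁ n, cf (GLn F n))
    (a : GeneralLinearGroup (α ⊕ β) F) (b : GeneralLinearGroup (γ ⊕ δ) F) :
    (∑ x : GeneralLinearGroup (α ⊕ β) F, ∑ y : GeneralLinearGroup (γ ⊕ δ) F, ∑ u,
      infl (fun _ _ => (1 : ℂ)) (relabel (Equiv.sumSumSumComm α β γ δ) (blockUpper x u y)))⁻¹ *
      ∑ x', ∑ y', ∑ u, infl (fun a b => evalGL a x * evalGL b y)
        (relabel (Equiv.sumSumSumComm α β γ δ)
          (blockUpper (x' * a * x'⁻¹) u (y' * b * y'⁻¹))) =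
      (parCard F α β)⁻¹ * (parCard F γ δ)⁻¹ * ∑ x', ∑ y', inflTwo (fun a₁ a₂ b₁ b₂ =>
        evalGL₂ a₁ b₁ ((glHopf F).comul x) * evalGL₂ a₂ b₂ ((glHopf F).comul y))
        (x' * a * x'⁻¹) (y' * b * y'⁻¹) := by
  simp only [sum_infl_sumSumSumComm, evalGL_comul_apply]
  -- Up to powers of `q` these sums are values of coproducts; the same powers occur in the inverted
  -- sum (`h2`) and cancel.
  have h1 : ∀ a₁ a₂ b₁ b₂, ∑ u₁ : Matrix α γ F, ∑ u₃ : Matrix β δ F,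
      evalGL (blockUpper a₁ u₁ b₁) x * evalGL (blockUpper a₂ u₃ b₂) y =
      (Fintype.card F : ℂ) ^ (Fintype.card α * Fintype.card γ) *
      (Fintype.card F : ℂ) ^ (Fintype.card β * Fintype.card δ) *
      ((((Fintype.card F : ℂ) ^ (Fintype.card α * Fintype.card γ))⁻¹ *
        ∑ u, evalGL (blockUpper a₁ u b₁) x) *
      (((Fintype.card F : ℂ) ^ (Fintype.card β * Fintype.card δ))⁻¹ *
        ∑ u, evalGL (blockUpper a₂ u b₂) y)) := by
    intro a₁ a₂ b₁ b₂
    have := card_ne_zero' (F := F)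
    rw [← Finset.sum_mul_sum]
    field_simp
  simp only [h1, inflTwo_mul_left]
  have h2 : ∑ _u₁ : Matrix α γ F, ∑ _u₃ : Matrix β δ F, (1 : ℂ) =
      (Fintype.card F : ℂ) ^ (Fintype.card α * Fintype.card γ) *
      (Fintype.card F : ℂ) ^ (Fintype.card β * Fintype.card δ) * 1 := by
    simp [card_matrix_eq]
  simp only [h2, inflTwo_mul_left, ← Finset.mul_sum, sum_sum_inflTwo_one]
  have := card_ne_zero' (F := F)
  have := parCard_ne_zero (F := F) (ι := α) (κ := β)
  have := parCard_ne_zero (F := F) (ι := γ) (κ := δ)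
  field_simp

/-- Both sides are bilinear in the tensors. On pure tensors the product of the tensor square is a
pair of parabolic inductions, and the two sums over conjugates separate. -/
theorem evalGL₂_mulTensor {r s r' s' : ℕ} (hα : Fintype.card α = r) (hβ : Fintype.card β = r')
    (hγ : Fintype.card γ = s) (hδ : Fintype.card δ = s')
    (a : GeneralLinearGroup (α ⊕ β) F) (b : GeneralLinearGroup (γ ⊕ δ) F)
    (t t' : (⨁ n, cf (GLn F n)) ⊗[ℂ] ⨁ n, cf (GLn F n))
    (ht : t ∈ LinearMap.range (TensorProduct.map (DirectSum.lof ℂ ℕ (fun n => cf (GLn F n)) r)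
      (DirectSum.lof ℂ ℕ (fun n => cf (GLn F n)) s)))
    (ht' : t' ∈ LinearMap.range (TensorProduct.map (DirectSum.lof ℂ ℕ (fun n => cf (GLn F n)) r')
      (DirectSum.lof ℂ ℕ (fun n => cf (GLn F n)) s'))) :
    evalGL₂ a b ((glHopf F).mulTensor t t') =
      (parCard F α β)⁻¹ * (parCard F γ δ)⁻¹ * ∑ x', ∑ y', inflTwo (fun a₁ a₂ b₁ b₂ =>
        evalGL₂ a₁ b₁ t * evalGL₂ a₂ b₂ t') (x' * a * x'⁻¹) (y' * b * y'⁻¹) := by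
  obtain ⟨t, rfl⟩ := ht
  obtain ⟨t', rfl⟩ := ht'
  induction t using TensorProduct.induction_on with
  | zero =>
    simp only [map_zero, HopfData.mulTensor, TensorProduct.zero_tmul, zero_mul]
    have : ∀ x y, inflTwo (fun (_ : GeneralLinearGroup α F) (_ : GeneralLinearGroup β F)
        (_ : GeneralLinearGroup γ F) (_ : GeneralLinearGroup δ F) => (0 : ℂ)) x y = 0 := by
      intro x y
      simp [inflTwo, infl]
    simp [this]
  | add s t hs ht =>
    simp only [map_add, HopfData.mulTensor, TensorProduct.add_tmul, add_mul, inflTwo_add,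
      Finset.sum_add_distrib, mul_add] at hs ht ⊢
    rw [hs, ht]
  | tmul x₁ x₂ =>
    induction t' using TensorProduct.induction_on with
    | zero =>
      simp only [map_zero, HopfData.mulTensor, TensorProduct.tmul_zero, mul_zero]
      have : ∀ x y, inflTwo (fun (_ : GeneralLinearGroup α F) (_ : GeneralLinearGroup β F)
          (_ : GeneralLinearGroup γ F) (_ : GeneralLinearGroup δ F) => (0 : ℂ)) x y = 0 := by
        intro x y
        simp [inflTwo, infl]
      simp [this]
    | add s t hs ht =>
      simp only [map_add, HopfData.mulTensor, TensorProduct.tmul_add, mul_add, inflTwo_add,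
        Finset.sum_add_distrib] at hs ht ⊢
      rw [hs, ht]
    | tmul y₁ y₂ =>
      simp only [TensorProduct.map_tmul, HopfData.mulTensor,
        TensorProduct.tensorTensorTensorComm_tmul, TensorProduct.lift.tmul, tensorEval_tmul]
      rw [evalGL_mul hα hβ _ _ ⟨_, rfl⟩ ⟨_, rfl⟩, evalGL_mul hγ hδ _ _ ⟨_, rfl⟩ ⟨_, rfl⟩]
      have h : (fun (a₁ : GeneralLinearGroup α F) (a₂ : GeneralLinearGroup β F)
          (b₁ : GeneralLinearGroup γ F) (b₂ : GeneralLinearGroup δ F) =>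
          evalGL a₁ (DirectSum.lof ℂ ℕ (fun n => cf (GLn F n)) r x₁) *
            evalGL b₁ (DirectSum.lof ℂ ℕ (fun n => cf (GLn F n)) s x₂) *
          (evalGL a₂ (DirectSum.lof ℂ ℕ (fun n => cf (GLn F n)) r' y₁) *
            evalGL b₂ (DirectSum.lof ℂ ℕ (fun n => cf (GLn F n)) s' y₂))) =
          fun a₁ a₂ b₁ b₂ => (evalGL a₁ (DirectSum.lof ℂ ℕ (fun n => cf (GLn F n)) r x₁) *
            evalGL a₂ (DirectSum.lof ℂ ℕ (fun n => cf (GLn F n)) r' y₁)) *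
          (evalGL b₁ (DirectSum.lof ℂ ℕ (fun n => cf (GLn F n)) s x₂) *
            evalGL b₂ (DirectSum.lof ℂ ℕ (fun n => cf (GLn F n)) s' y₂)) := by
        funext a₁ a₂ b₁ b₂
        ring
      rw [h]
      simp only [inflTwo_mul, ← Finset.mul_sum, ← Finset.sum_mul, conjSum]
      ring

end FourBlocks

/-! ### Bijections that represent the double cosets of two maximal parabolic subgroups -/

section BlockShuffle

/-- The bijection `Fin k ⊕ Fin l ≃ Fin n` for `k + l = n`. -/
def finSumEquiv {k l n : ℕ} (h : k + l = n) : Fin k ⊕ Fin l ≃ Fin n :=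
  finSumFinEquiv.trans (finCongr h)

variable {r s r' s' k l m n : ℕ} (h₁ : r + s = k) (h₂ : r' + s' = l) (h₃ : r + r' = m)
  (h₄ : s + s' = n)

/-- The bijection that exchanges the two middle ones of four intervals. -/
def blockShuffle : Fin m ⊕ Fin n ≃ Fin k ⊕ Fin l :=
  ((finSumEquiv h₃).sumCongr (finSumEquiv h₄)).symm.trans
    ((Equiv.sumSumSumComm (Fin r) (Fin r') (Fin s) (Fin s')).trans
      ((finSumEquiv h₁).sumCongr (finSumEquiv h₂)))

/-- The left summand of the source goes to the first `r` indices of `Fin k` and the first `r'`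
indices of `Fin l`, the right summand to the remaining ones. The argument on double cosets uses
nothing else. -/
theorem exists_blockShuffle_inl_eq_inl (t : Fin k) (ht : (t : ℕ) < r) :
    ∃ c, blockShuffle h₁ h₂ h₃ h₄ (Sum.inl c) = Sum.inl t := by
  refine ⟨finSumEquiv h₃ (Sum.inl ⟨t, ht⟩), ?_⟩
  simp [blockShuffle]
  rfl

theorem exists_blockShuffle_inl_eq_inr (t : Fin l) (ht : (t : ℕ) < r') :
    ∃ c, blockShuffle h₁ h₂ h₃ h₄ (Sum.inl c) = Sum.inr t := by
  refine ⟨finSumEquiv h₃ (Sum.inr ⟨t, ht⟩), ?_⟩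
  simp [blockShuffle]
  rfl

theorem exists_blockShuffle_inr_eq_inl (t : Fin k) (ht : r ≤ (t : ℕ)) :
    ∃ c, blockShuffle h₁ h₂ h₃ h₄ (Sum.inr c) = Sum.inl t := by
  refine ⟨finSumEquiv h₄ (Sum.inl ⟨t - r, by omega⟩), ?_⟩
  simp only [blockShuffle, Equiv.trans_apply, Equiv.sumCongr_symm, Equiv.sumCongr_apply,
    Sum.map_inr, Equiv.symm_apply_apply]
  refine congrArg Sum.inl (Fin.ext ?_)
  change r + ((t : ℕ) - r) = t
  omega

theorem exists_blockShuffle_inr_eq_inr (t : Fin l) (ht : r' ≤ (t : ℕ)) :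
    ∃ c, blockShuffle h₁ h₂ h₃ h₄ (Sum.inr c) = Sum.inr t := by
  refine ⟨finSumEquiv h₄ (Sum.inr ⟨t - r', by omega⟩), ?_⟩
  simp only [blockShuffle, Equiv.trans_apply, Equiv.sumCongr_symm, Equiv.sumCongr_apply,
    Sum.map_inr, Equiv.symm_apply_apply]
  refine congrArg Sum.inr (Fin.ext ?_)
  change r' + ((t : ℕ) - r') = t
  omega

theorem le_of_blockShuffle_inr_eq_inl {c : Fin n} {t : Fin k}
    (h : blockShuffle h₁ h₂ h₃ h₄ (Sum.inr c) = Sum.inl t) : r ≤ (t : ℕ) := by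
  by_contra hlt
  obtain ⟨c', hc'⟩ := exists_blockShuffle_inl_eq_inl h₁ h₂ h₃ h₄ t (not_le.1 hlt)
  exact Sum.inl_ne_inr ((blockShuffle h₁ h₂ h₃ h₄).injective (hc'.trans h.symm))

theorem le_of_blockShuffle_inr_eq_inr {c : Fin n} {t : Fin l}
    (h : blockShuffle h₁ h₂ h₃ h₄ (Sum.inr c) = Sum.inr t) : r' ≤ (t : ℕ) := by
  by_contra hlt
  obtain ⟨c', hc'⟩ := exists_blockShuffle_inl_eq_inr h₁ h₂ h₃ h₄ t (not_le.1 hlt)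
  exact Sum.inl_ne_inr ((blockShuffle h₁ h₂ h₃ h₄).injective (hc'.trans h.symm))

end BlockShuffle

/-! ### Double cosets of two maximal parabolic subgroups -/

section GLCompat

variable {F : Type*} [Field F] [Fintype F]
variable {ι κ : Type} [Fintype ι] [DecidableEq ι] [Fintype κ] [DecidableEq κ]

theorem infl_conj (Φ : GeneralLinearGroup ι F → GeneralLinearGroup κ F → ℂ)
    (hΦ : ∀ x y a b, Φ (x * a * x⁻¹) (y * b * y⁻¹) = Φ a b) (p : GeneralLinearGroup (ι ⊕ κ) F)
    (hp : p ∈ parabolic F (Equiv.refl (ι ⊕ κ))) (g : GeneralLinearGroup (ι ⊕ κ) F) :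
    infl Φ (p * g * p⁻¹) = infl Φ g := by
  have hmem : ∀ g, (∃ a u b, g = blockUpper a u b) ↔ g ∈ parabolic F (Equiv.refl (ι ⊕ κ)) :=
    fun g => Iff.rfl
  by_cases hg : g ∈ parabolic F (Equiv.refl (ι ⊕ κ))
  · obtain ⟨a, u, b, rfl⟩ := (hmem g).2 hg
    obtain ⟨x, z, y, rfl⟩ := (hmem p).2 hp
    obtain ⟨v, hv⟩ := blockUpper_conj x a z u y b
    rw [hv, infl_blockUpper, infl_blockUpper, hΦ]
  · rw [infl_eq_zero Φ g (mt (hmem g).1 hg), infl_eq_zero]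
    intro h
    apply hg
    have h1 := (hmem _).1 h
    have h2 := (parabolic F (Equiv.refl (ι ⊕ κ))).mul_mem
      ((parabolic F (Equiv.refl (ι ⊕ κ))).mul_mem
        ((parabolic F (Equiv.refl (ι ⊕ κ))).inv_mem hp) h1) hp
    convert h2 using 1
    group

theorem ite_mem_parabolic_refl (g : GeneralLinearGroup (ι ⊕ κ) F) :
    (if g ∈ parabolic F (Equiv.refl (ι ⊕ κ)) then (1 : ℂ) else 0) = infl (fun _ _ => 1) g := by
  split_ifs with h
  · obtain ⟨a, u, b, rfl⟩ := h
    exact (infl_blockUpper (fun _ _ => (1 : ℂ)) a u b).symm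
  · exact (infl_eq_zero _ g h).symm

theorem card_parabolic_refl :
    (Fintype.card (parabolic F (Equiv.refl (ι ⊕ κ))) : ℂ) = parCard F ι κ := by
  rw [← sum_infl_one, ← Finset.sum_congr rfl fun g _ => ite_mem_parabolic_refl g,
    ← Finset.sum_filter, Finset.sum_const, nsmul_eq_mul, mul_one, ← Fintype.card_subtype]

variable {r s r' s' k l m n : ℕ} (h₁ : r + s = k) (h₂ : r' + s' = l) (h₃ : r + r' = m)
  (h₄ : s + s' = n)

theorem sum_relabel_blockShuffle (Ψ : GeneralLinearGroup (Fin k ⊕ Fin l) F → ℂ)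
    (a : GeneralLinearGroup (Fin r ⊕ Fin r') F) (b : GeneralLinearGroup (Fin s ⊕ Fin s') F) :
    ∑ u, Ψ (relabel (blockShuffle h₁ h₂ h₃ h₄)
      (blockUpper (relabel (finSumEquiv h₃) a) u (relabel (finSumEquiv h₄) b))) =
    ∑ u, Ψ (relabel ((finSumEquiv h₁).sumCongr (finSumEquiv h₂))
      (relabel (Equiv.sumSumSumComm (Fin r) (Fin r') (Fin s) (Fin s')) (blockUpper a u b))) := by
  rw [← Equiv.sum_comp (Matrix.reindex (finSumEquiv h₃) (finSumEquiv h₄))]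
  refine Finset.sum_congr rfl fun u _ => ?_
  have h := relabel_sumCongr_blockUpper (finSumEquiv h₃) (finSumEquiv h₄) a u b
  rw [Matrix.reindex_apply, ← h, blockShuffle, relabel_trans, relabel_trans, relabel_symm_relabel]

/-- The contribution of one double coset to the coproduct of a product. -/
theorem sum_infl_blockShuffle (x y : ⨁ n, cf (GLn F n))
    (a : GeneralLinearGroup (Fin r ⊕ Fin r') F) (b : GeneralLinearGroup (Fin s ⊕ Fin s') F) :
    (∑ x : GLn F m, ∑ y : GLn F n, ∑ u, if relabel (blockShuffle h₁ h₂ h₃ h₄)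
        (blockUpper x u y) ∈ parabolic F (Equiv.refl (Fin k ⊕ Fin l)) then (1 : ℂ) else 0)⁻¹ *
      ∑ x', ∑ y', ∑ u, infl (fun a b => evalGL a x * evalGL b y)
        (relabel (blockShuffle h₁ h₂ h₃ h₄)
          (blockUpper (x' * relabel (finSumEquiv h₃) a * x'⁻¹) u
            (y' * relabel (finSumEquiv h₄) b * y'⁻¹))) =
      (parCard F (Fin r) (Fin r'))⁻¹ * (parCard F (Fin s) (Fin s'))⁻¹ *
        ∑ x', ∑ y', inflTwo (fun a₁ a₂ b₁ b₂ =>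
          evalGL₂ a₁ b₁ ((glHopf F).comul x) * evalGL₂ a₂ b₂ ((glHopf F).comul y))
          (x' * a * x'⁻¹) (y' * b * y'⁻¹) := by
  rw [← sum_conj_infl_sumSumSumComm]
  congr 1
  · congr 1
    rw [← (relabel (finSumEquiv h₃)).toEquiv.sum_comp]
    refine Finset.sum_congr rfl fun x _ => ?_
    rw [← (relabel (finSumEquiv h₄)).toEquiv.sum_comp]
    refine Finset.sum_congr rfl fun y _ => ?_
    simp only [ite_mem_parabolic_refl]
    refine (sum_relabel_blockShuffle h₁ h₂ h₃ h₄ (infl fun _ _ => 1) x y).trans ?_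
    simp only [infl_relabel_sumCongr]
  · rw [← (relabel (finSumEquiv h₃)).toEquiv.sum_comp]
    refine Finset.sum_congr rfl fun x' _ => ?_
    rw [← (relabel (finSumEquiv h₄)).toEquiv.sum_comp]
    refine Finset.sum_congr rfl fun y' _ => ?_
    simp only [MulEquiv.toEquiv_eq_coe, MulEquiv.coe_toEquiv, ← map_mul, ← map_inv]
    refine (sum_relabel_blockShuffle h₁ h₂ h₃ h₄ (infl fun a b => evalGL a x * evalGL b y)
      (x' * a * x'⁻¹) (y' * b * y'⁻¹)).trans ?_
    simp only [infl_relabel_sumCongr, evalGL_relabel]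

/-- Unitriangular elimination moves the support of the first `m` columns into a set `A` of `m` rows.
Unitriangular matrices are block upper triangular, and so are the permutation matrices that preserve
both blocks. The latter bring the parts `A₁` and `A₂` of `A` in the two blocks to the front, so only
their sizes `r` and `r'` matter. -/
theorem exists_blockShuffle (s₀ : Fin m ⊕ Fin n ≃ Fin k ⊕ Fin l)
    (g : GeneralLinearGroup (Fin k ⊕ Fin l) F) :
    ∃ (r s r' s' : ℕ) (h₁ : r + s = k) (h₂ : r' + s' = l) (h₃ : r + r' = m) (h₄ : s + s' = n),
      ∃ p ∈ parabolic F (Equiv.refl (Fin k ⊕ Fin l)), ∀ a b,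
        (p * g).val (blockShuffle h₁ h₂ h₃ h₄ (Sum.inr a)) (s₀ (Sum.inl b)) = 0 := by
  let E := complEquiv _ _ (isCompl_firstEmb_lastEmb (rfl : k + l = k + l))
  let J : Finset (Fin (k + l)) := Finset.univ.map ⟨fun b => E (s₀ (Sum.inl b)),
    fun a b h => Sum.inl_injective (s₀.injective (E.injective h))⟩
  obtain ⟨q, hq, A, hA, h⟩ := exists_mul_support (k + l) (relabel E g) J
  let A₁ : Finset (Fin k) := Finset.univ.filter fun i => E (Sum.inl i) ∈ A
  let A₂ : Finset (Fin l) := Finset.univ.filter fun i => E (Sum.inr i) ∈ A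
  have hcard : A₁.card + A₂.card = m := by
    have h1 : A = (A₁.disjSum A₂).map E.toEmbedding := by
      ext c
      obtain ⟨c, rfl⟩ := E.surjective c
      simp only [Finset.mem_map_equiv, Equiv.symm_apply_apply]
      rcases c with i | i <;> simp [A₁, A₂]
    have h2 : A.card = A₁.card + A₂.card := by
      rw [h1, Finset.card_map, Finset.card_disjSum]
    rw [← h2, hA, Finset.card_map, Finset.card_univ, Fintype.card_fin]
  have hk : A₁.card ≤ k := by simpa using A₁.card_le_univ
  have hl : A₂.card ≤ l := by simpa using A₂.card_le_univ
  have hmn : m + n = k + l := by simpa using Fintype.card_congr s₀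
  obtain ⟨σ₁, hσ₁⟩ := exists_perm_lt_card_iff A₁
  obtain ⟨σ₂, hσ₂⟩ := exists_perm_lt_card_iff A₂
  obtain ⟨w, hw, -⟩ := exists_conj_relabel (F := F) (Equiv.refl (Fin k ⊕ Fin l))
    (σ₁.sumCongr σ₂)
  have hwmul : ∀ (M : GeneralLinearGroup (Fin k ⊕ Fin l) F) c d,
      (w * M).val (σ₁.sumCongr σ₂ c) d = M.val c d := by
    intro M c d
    simp [hw, Matrix.mul_apply, Matrix.one_apply]
  have hzero : ∀ c, E c ∉ A → ∀ b, (w * (relabel E.symm q * g)).val (σ₁.sumCongr σ₂ c)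
      (s₀ (Sum.inl b)) = 0 := by
    intro c hc b
    rw [hwmul]
    have h1 := h (E c) hc (E (s₀ (Sum.inl b))) (Finset.mem_map.2 ⟨b, Finset.mem_univ _, rfl⟩)
    have h2 : q * relabel E g = relabel E (relabel E.symm q * g) := by
      rw [map_mul, relabel_relabel_symm]
    rw [h2] at h1
    simpa only [relabel_val, Matrix.submatrix_apply, Equiv.symm_apply_apply] using h1
  refine ⟨A₁.card, k - A₁.card, A₂.card, l - A₂.card, by omega, by omega, hcard, by omega,
    w * relabel E.symm q, ?_, ?_⟩
  · refine Subgroup.mul_mem _ ?_ ?_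
    · rw [mem_parabolic_iff]
      intro a b
      simp [hw]
    · rw [mem_parabolic_iff]
      intro a b
      by_contra hne
      have h1 := hq (E (Sum.inr a)) (E (Sum.inl b)) (by
        have h2 : E (Sum.inr a) ≠ E (Sum.inl b) := fun h => Sum.inr_ne_inl (E.injective h)
        rw [Matrix.sub_apply, Matrix.one_apply_ne h2, sub_zero]
        exact hne)
      have h3 : k + (a : ℕ) < b := h1
      omega
  · intro a b
    rw [mul_assoc]
    rcases hc : blockShuffle _ _ _ _ (Sum.inr a) with t | t
    · have ht := le_of_blockShuffle_inr_eq_inl _ _ _ _ hc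
      have h1 := hzero (Sum.inl (σ₁.symm t)) (fun hmem => by
        have := (hσ₁ (σ₁.symm t)).2 (by simpa [A₁] using hmem)
        rw [Equiv.apply_symm_apply] at this
        omega) b
      simpa using h1
    · have ht := le_of_blockShuffle_inr_eq_inr _ _ _ _ hc
      have h1 := hzero (Sum.inr (σ₂.symm t)) (fun hmem => by
        have := (hσ₂ (σ₂.symm t)).2 (by simpa [A₂] using hmem)
        rw [Equiv.apply_symm_apply] at this
        omega) b
      simpa using h1

/-- In the diagonal blocks of `p`, the first `t` columns are supported in the first `r` rows, and
the first `t'` columns in the first `r'` rows. Invertibility gives `t ≤ r` and `t' ≤ r'`, and the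
sums `t + t' = m = r + r'` force equality. -/
theorem blockShuffle_unique {r s r' s' t u t' u' : ℕ} (h₁ : r + s = k) (h₂ : r' + s' = l)
    (h₃ : r + r' = m) (h₄ : s + s' = n) (i₁ : t + u = k) (i₂ : t' + u' = l)
    (i₃ : t + t' = m) (i₄ : u + u' = n) (p : GeneralLinearGroup (Fin k ⊕ Fin l) F)
    (hp : p ∈ parabolic F (Equiv.refl (Fin k ⊕ Fin l)))
    (h : ∀ a b, p.val (blockShuffle h₁ h₂ h₃ h₄ (Sum.inr a))
      (blockShuffle i₁ i₂ i₃ i₄ (Sum.inl b)) = 0) : r = t := by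
  obtain ⟨x, z, y, rfl⟩ := hp
  have hfilter : ∀ {N a : ℕ}, a ≤ N →
      (Finset.univ.filter fun i : Fin N => (i : ℕ) < a).card = a := by
    intro N a ha
    simp [Fin.card_filter_val_lt, ha]
  have h1 := card_le_card_of_support x (Finset.univ.filter fun i => (i : ℕ) < t)
    (Finset.univ.filter fun i => (i : ℕ) < r) (fun a ha j hj => by
      simp only [Finset.mem_filter, Finset.mem_univ, true_and, not_lt] at ha hj
      obtain ⟨c, hc⟩ := exists_blockShuffle_inr_eq_inl h₁ h₂ h₃ h₄ a ha
      obtain ⟨d, hd⟩ := exists_blockShuffle_inl_eq_inl i₁ i₂ i₃ i₄ j hj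
      have := h c d
      rw [hc, hd] at this
      exact this)
  have h2 := card_le_card_of_support y (Finset.univ.filter fun i => (i : ℕ) < t')
    (Finset.univ.filter fun i => (i : ℕ) < r') (fun a ha j hj => by
      simp only [Finset.mem_filter, Finset.mem_univ, true_and, not_lt] at ha hj
      obtain ⟨c, hc⟩ := exists_blockShuffle_inr_eq_inr h₁ h₂ h₃ h₄ a ha
      obtain ⟨d, hd⟩ := exists_blockShuffle_inl_eq_inr i₁ i₂ i₃ i₄ j hj
      have := h c d
      rw [hc, hd] at this
      exact this)
  rw [hfilter (by omega), hfilter (by omega)] at h1 h2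
  omega

end GLCompat

/-! ### Bihomogeneous components of the tensor square -/

section TensorDegree

variable {V : ℕ → Type*} [∀ n, AddCommGroup (V n)] [∀ n, Module ℂ (V n)]

/-- The bihomogeneous part of degree `p` of the tensor square. -/
def bihomog (V : ℕ → Type*) [∀ n, AddCommGroup (V n)] [∀ n, Module ℂ (V n)] (p : ℕ × ℕ) :
    Submodule ℂ ((⨁ n, V n) ⊗[ℂ] ⨁ n, V n) :=
  LinearMap.range (TensorProduct.map (DirectSum.lof ℂ ℕ V p.1) (DirectSum.lof ℂ ℕ V p.2))

theorem exists_sum_bihomog {n : ℕ} {t : (⨁ n, V n) ⊗[ℂ] ⨁ n, V n} (ht : t ∈ homogTensor V n) :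
    ∃ T : ℕ × ℕ → (⨁ n, V n) ⊗[ℂ] ⨁ n, V n, (∀ p, T p ∈ bihomog V p) ∧
      ∑ p ∈ Finset.HasAntidiagonal.antidiagonal n, T p = t := by
  obtain ⟨μ, hμ⟩ := (Submodule.mem_iSup_finset_iff_exists_sum 
    (s := Finset.HasAntidiagonal.antidiagonal n)
    (bihomog V) t).1 ht
  exact ⟨fun p => (μ p).val, fun p => (μ p).property, hμ⟩

theorem mulTensor_sum (D : HopfData V) {I J : Type*} (s : Finset I) (s' : Finset J)
    (T : I → (⨁ n, V n) ⊗[ℂ] ⨁ n, V n) (T' : J → (⨁ n, V n) ⊗[ℂ] ⨁ n, V n) :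
    D.mulTensor (∑ i ∈ s, T i) (∑ j ∈ s', T' j) =
      ∑ p ∈ s ×ˢ s', D.mulTensor (T p.1) (T' p.2) := by
  simp only [HopfData.mulTensor, TensorProduct.sum_tmul, TensorProduct.tmul_sum, map_sum,
    Finset.sum_product]
  exact Finset.sum_comm

theorem mulTensor_mem (D : HopfData V)
    (hD : ∀ m n, ∀ x ∈ homog V m, ∀ y ∈ homog V n, D.mul x y ∈ homog V (m + n)) {p p' : ℕ × ℕ}
    {t t' : (⨁ n, V n) ⊗[ℂ] ⨁ n, V n} (ht : t ∈ bihomog V p) (ht' : t' ∈ bihomog V p') :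
    D.mulTensor t t' ∈ bihomog V (p + p') := by
  obtain ⟨t, rfl⟩ := ht
  obtain ⟨t', rfl⟩ := ht'
  induction t using TensorProduct.induction_on with
  | zero =>
    simp only [map_zero, HopfData.mulTensor, TensorProduct.zero_tmul]
    exact Submodule.zero_mem _
  | add s t hs ht =>
    simp only [map_add, HopfData.mulTensor, TensorProduct.add_tmul] at hs ht ⊢
    exact Submodule.add_mem _ hs ht
  | tmul x₁ x₂ =>
    induction t' using TensorProduct.induction_on with
    | zero =>
      simp only [map_zero, HopfData.mulTensor, TensorProduct.tmul_zero]
      exact Submodule.zero_mem _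
    | add s t hs ht =>
      simp only [map_add, HopfData.mulTensor, TensorProduct.tmul_add] at hs ht ⊢
      exact Submodule.add_mem _ hs ht
    | tmul y₁ y₂ =>
      simp only [TensorProduct.map_tmul, HopfData.mulTensor,
        TensorProduct.tensorTensorTensorComm_tmul, TensorProduct.lift.tmul]
      obtain ⟨z, hz⟩ := hD p.1 p'.1 _ ⟨x₁, rfl⟩ _ ⟨y₁, rfl⟩
      obtain ⟨w, hw⟩ := hD p.2 p'.2 _ ⟨x₂, rfl⟩ _ ⟨y₂, rfl⟩
      exact ⟨z ⊗ₜ w, by rw [TensorProduct.map_tmul, ← hz, ← hw]; rfl⟩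

end TensorDegree

/-! ### Multiplicativity of the coproduct of `cf(GL_•)` -/

section GLComulMul

variable {F : Type*} [Field F] [Fintype F]

theorem evalGL₂_of_mem {ι κ : Type} [Fintype ι] [DecidableEq ι] [Fintype κ] [DecidableEq κ]
    {p : ℕ × ℕ} (h : ¬(Fintype.card ι = p.1 ∧ Fintype.card κ = p.2))
    (a : GeneralLinearGroup ι F) (b : GeneralLinearGroup κ F)
    (t : (⨁ n, cf (GLn F n)) ⊗[ℂ] ⨁ n, cf (GLn F n))
    (ht : t ∈ bihomog (fun n => cf (GLn F n)) p) : evalGL₂ a b t = 0 := by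
  obtain ⟨t, rfl⟩ := ht
  rw [tensorEval_map]
  by_cases h1 : Fintype.card ι = p.1
  · rw [evalGL_comp_lof_of_ne b fun h2 => h ⟨h1, h2⟩, tensorEval_zero_right]
    rfl
  · rw [evalGL_comp_lof_of_ne a h1, tensorEval_zero_left]
    rfl

variable {k l m n : ℕ}

/-- The pairs of compositions `k = r + s`, `l = r' + s'` with `m = r + r'`, `n = s + s'`. -/
def shuffleIndex (k l m n : ℕ) : Finset ((ℕ × ℕ) × (ℕ × ℕ)) :=
  (Finset.HasAntidiagonal.antidiagonal k ×ˢ Finset.HasAntidiagonal.antidiagonal l).filter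
    fun p => p.1.1 + p.2.1 = m ∧ p.1.2 + p.2.2 = n

theorem mem_shuffleIndex {p : (ℕ × ℕ) × (ℕ × ℕ)} : p ∈ shuffleIndex k l m n ↔
    (p.1.1 + p.1.2 = k ∧ p.2.1 + p.2.2 = l) ∧ p.1.1 + p.2.1 = m ∧ p.1.2 + p.2.2 = n := by
  simp [shuffleIndex]

/-- One term of the coproduct of a product. -/
def shuffleTerm (x y : ⨁ n, cf (GLn F n)) (a : GLn F m) (b : GLn F n)
    (p : shuffleIndex k l m n) : ℂ :=
  (parCard F (Fin p.1.1.1) (Fin p.1.2.1))⁻¹ * (parCard F (Fin p.1.1.2) (Fin p.1.2.2))⁻¹ *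
    ∑ x', ∑ y', inflTwo (fun a₁ a₂ b₁ b₂ =>
      evalGL₂ a₁ b₁ ((glHopf F).comul x) * evalGL₂ a₂ b₂ ((glHopf F).comul y))
      (x' * relabel (finSumEquiv (mem_shuffleIndex.1 p.2).2.1).symm a * x'⁻¹)
      (y' * relabel (finSumEquiv (mem_shuffleIndex.1 p.2).2.2).symm b * y'⁻¹)

/-- The Mackey formula for two parabolic subgroups: `shuffleIndex` indexes the double cosets, and
each of them contributes one term. -/
theorem evalGL₂_comul_mul (x y : ⨁ n, cf (GLn F n)) (hx : x ∈ homog (fun n => cf (GLn F n)) k)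
    (hy : y ∈ homog (fun n => cf (GLn F n)) l) (hmn : m + n = k + l) (a : GLn F m)
    (b : GLn F n) : evalGL₂ a b ((glHopf F).comul ((glHopf F).mul x y)) =
      ∑ p : shuffleIndex k l m n, shuffleTerm x y a b p := by
  have hq : ((Fintype.card F : ℂ) ^ (Fintype.card (Fin m) * Fintype.card (Fin n))) ≠ 0 :=
    pow_ne_zero _ card_ne_zero'
  have hP : parCard F (Fin k) (Fin l) ≠ 0 := parCard_ne_zero
  let s₀ : Fin m ⊕ Fin n ≃ Fin k ⊕ Fin l := (finSumEquiv hmn).trans (finSumEquiv rfl).symm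
  let s : shuffleIndex k l m n → (Fin m ⊕ Fin n ≃ Fin k ⊕ Fin l) := fun p =>
    blockShuffle (mem_shuffleIndex.1 p.2).1.1 (mem_shuffleIndex.1 p.2).1.2
      (mem_shuffleIndex.1 p.2).2.1 (mem_shuffleIndex.1 p.2).2.2
  have hf : ∀ w ∈ parabolic F (Equiv.refl (Fin k ⊕ Fin l)), ∀ g,
      infl (fun a b => evalGL a x * evalGL b y) (w * g * w⁻¹) =
        infl (fun a b => evalGL a x * evalGL b y) g :=
    fun w hw g => infl_conj _ (fun x y a b => by rw [evalGL_conj, evalGL_conj]) w hw g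
  rw [evalGL_comul_apply]
  -- The matrices indexed by `Fin m ⊕ Fin n` are relabelled by `Fin k ⊕ Fin l`, where the product of
  -- `x` and `y` can be evaluated.
  simp only [← evalGL_relabel s₀ (blockUpper _ _ _)]
  simp only [evalGL_mul (Fintype.card_fin k) (Fintype.card_fin l) x y hx hy, ← Finset.mul_sum]
  rw [sum_conjSum_blockUpper (parabolic F (Equiv.refl (Fin k ⊕ Fin l))) s₀ s ?_ ?_ _ hf,
    card_parabolic_refl, mul_left_comm, inv_mul_cancel_left₀ hq, Finset.mul_sum]
  · refine Finset.sum_congr rfl fun p _ => ?_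
    rw [div_eq_mul_inv, mul_assoc, inv_mul_cancel_left₀ hP, shuffleTerm,
      ← sum_infl_blockShuffle (mem_shuffleIndex.1 p.2).1.1 (mem_shuffleIndex.1 p.2).1.2,
      relabel_relabel_symm, relabel_relabel_symm]
  · intro g
    obtain ⟨r, t, r', t', h₁, h₂, h₃, h₄, w, hw, h⟩ := exists_blockShuffle s₀ g
    exact ⟨⟨((r, t), (r', t')), mem_shuffleIndex.2 ⟨⟨h₁, h₂⟩, h₃, h₄⟩⟩, w, hw, h⟩
  · rintro ⟨⟨⟨r, t⟩, r', t'⟩, hi⟩ ⟨⟨⟨c, d⟩, c', d'⟩, hj⟩ w hw h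
    have hi' := mem_shuffleIndex.1 hi
    have hj' := mem_shuffleIndex.1 hj
    have hr := blockShuffle_unique hi'.1.1 hi'.1.2 hi'.2.1 hi'.2.2 hj'.1.1 hj'.1.2 hj'.2.1
      hj'.2.2 w hw h
    simp only [Subtype.mk.injEq, Prod.mk.injEq]
    simp only at hr hi' hj'
    omega

/-- Both coproducts are split into bihomogeneous components. The product of those of bidegrees `(r,
s)` and `(r', s')` has bidegree `(r + r', s + s')`, so evaluation at `(a, b)` sees it only if the
index lies in `shuffleIndex`. -/
theorem evalGL₂_mulTensor_comul (x y : ⨁ n, cf (GLn F n))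
    (hx : x ∈ homog (fun n => cf (GLn F n)) k)
    (hy : y ∈ homog (fun n => cf (GLn F n)) l) (a : GLn F m) (b : GLn F n) :
    evalGL₂ a b ((glHopf F).mulTensor ((glHopf F).comul x) ((glHopf F).comul y)) =
      ∑ p : shuffleIndex k l m n, shuffleTerm x y a b p := by
  obtain ⟨T, hT, hTx⟩ := exists_sum_bihomog (gradedComul_mem (glComul F) k x hx)
  obtain ⟨T', hT', hTy⟩ := exists_sum_bihomog (gradedComul_mem (glComul F) l y hy)
  have heval : ∀ {N : ℕ} (z : ⨁ n, cf (GLn F n)) (T : ℕ × ℕ → (⨁ n, cf (GLn F n)) ⊗[ℂ]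
      ⨁ n, cf (GLn F n)) (_ : ∀ p, T p ∈ bihomog (fun n => cf (GLn F n)) p)
      (_ : ∑ p ∈ Finset.HasAntidiagonal.antidiagonal N, T p = (glHopf F).comul z) {r s : ℕ}
      (_ : r + s = N) (a : GLn F r) (b : GLn F s),
      evalGL₂ a b ((glHopf F).comul z) = evalGL₂ a b (T (r, s)) := by
    intro N z T hT hTz r s hrs a b
    rw [← hTz, map_sum, Finset.sum_eq_single (r, s)]
    · rintro ⟨r', s'⟩ - hne
      refine evalGL₂_of_mem (p := (r', s')) ?_ a b _ (hT _)
      rw [Fintype.card_fin, Fintype.card_fin]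
      rintro ⟨rfl, rfl⟩
      exact hne rfl
    · intro h
      exact absurd (Finset.HasAntidiagonal.mem_antidiagonal.2 hrs) h
  have h1 : (glHopf F).mulTensor ((glHopf F).comul x) ((glHopf F).comul y) = _ :=
    (congrArg₂ (glHopf F).mulTensor hTx.symm hTy.symm).trans (mulTensor_sum _ _ _ T T')
  rw [h1, map_sum]
  have h2 : ∑ p ∈ shuffleIndex k l m n, evalGL₂ a b ((glHopf F).mulTensor (T p.1) (T' p.2)) =
      ∑ p ∈ Finset.HasAntidiagonal.antidiagonal k ×ˢ Finset.HasAntidiagonal.antidiagonal l,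
        evalGL₂ a b ((glHopf F).mulTensor (T p.1) (T' p.2)) := by
    refine Finset.sum_subset (Finset.filter_subset _ _) fun p hp hp' => ?_
    refine evalGL₂_of_mem ?_ a b _ (mulTensor_mem _ glHopf_mul_mem (hT _) (hT' _))
    rw [Fintype.card_fin, Fintype.card_fin]
    rintro ⟨rfl, rfl⟩
    exact hp' (Finset.mem_filter.2 ⟨hp, rfl, rfl⟩)
  rw [← h2, ← Finset.sum_coe_sort]
  refine Finset.sum_congr rfl ?_
  rintro ⟨⟨⟨r, s⟩, r', s'⟩, hp⟩ -
  have hp' := mem_shuffleIndex.1 hp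
  unfold shuffleTerm
  simp only at hp' ⊢
  have h3 := evalGL₂_mulTensor (Fintype.card_fin r) (Fintype.card_fin r') (Fintype.card_fin s)
    (Fintype.card_fin s') (relabel (finSumEquiv hp'.2.1).symm a)
    (relabel (finSumEquiv hp'.2.2).symm b) _ _ (hT (r, s)) (hT' (r', s'))
  simp only [evalGL₂, evalGL_relabel] at h3
  refine h3.trans ?_
  simp only [heval x T hT hTx hp'.1.1, heval y T' hT' hTy hp'.1.2]

theorem glHopf_comul_mul (x y : ⨁ n, cf (GLn F n)) :
    (glHopf F).comul ((glHopf F).mul x y) =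
      (glHopf F).mulTensor ((glHopf F).comul x) ((glHopf F).comul y) := by
  induction x using homog_induction with
  | h0 => simp [HopfData.mulTensor]
  | hadd x x' hx hx' =>
    simp only [map_add, LinearMap.add_apply, hx, hx', HopfData.mulTensor, TensorProduct.add_tmul]
  | h k x hx =>
    induction y using homog_induction with
    | h0 => simp [HopfData.mulTensor]
    | hadd y y' hy hy' =>
      simp only [map_add, hy, hy', HopfData.mulTensor, TensorProduct.tmul_add]
    | h l y hy =>
      refine ((separates_evalGL F).tensor (separates_evalGL F)).ext ?_
      rintro ⟨⟨m, a⟩, n, b⟩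
      change evalGL₂ a b _ = evalGL₂ a b _
      rw [evalGL₂_mulTensor_comul x y hx hy]
      by_cases hmn : m + n = k + l
      · exact evalGL₂_comul_mul x y hx hy hmn a b
      · rw [evalGL_comul_apply, Finset.sum_eq_zero, mul_zero]
        · symm
          refine Finset.sum_eq_zero ?_
          rintro ⟨p, hp⟩ -
          have := mem_shuffleIndex.1 hp
          omega
        · intro u _
          refine evalGL_of_mem ?_ _ _ (glHopf_mul_mem k l x hx y hy)
          simpa using hmn

variable (F) in
theorem glHopf_isHopf : (glHopf F).IsHopf :=
  HopfData.IsBialgebra.isHopf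
    { mul_assoc := glHopf_mul_assoc
      one_mul := glHopf_one_mul
      mul_one := glHopf_mul_one
      coassoc := glHopf_coassoc
      counit_left := glHopf_counit_left
      counit_right := glHopf_counit_right
      comul_one := glHopf_comul_one
      comul_mul := glHopf_comul_mul
      counit_one := glHopf_counit_one
      counit_mul := glHopf_counit_mul
      one_mem := glHopf_one_mem
      mul_mem := glHopf_mul_mem
      comul_mem := gradedComul_mem _
      counit_mem := glHopf_counit_mem
      connected := glHopf_connected }

end GLComulMul

section

variable {F : Type*} [Field F] [Fintype F]

/-! ## Superclass functions -/

section Superclass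

variable {n : ℕ}

theorem exists_inSuperclass (u : UT F n) : ∃ γ : IndiffGraph n, InSuperclass γ u := by
  obtain ⟨γ, hγ⟩ := Set.Finite.exists_maximal (Set.toFinite {γ : IndiffGraph n | InPattern γ u})
    ⟨edgeless n, fun i j h => h.elim⟩
  exact ⟨γ, hγ.1, fun σ hσ h => not_le_of_gt hσ (hγ.2 h hσ.le)⟩

/-- A union of indifference graphs is an indifference graph, so among the graphs whose pattern
subgroup contains `u` there is a greatest one, which is that of the superclass. -/
theorem InSuperclass.inPattern_iff {γ σ : IndiffGraph n} {u : UT F n} (h : InSuperclass σ u) :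
    InPattern γ u ↔ γ ≤ σ := by
  constructor
  · intro hγ
    let τ : IndiffGraph n := ⟨γ.val ⊔ σ.val, by
      intro i l hil hadj j k hij hjk hkl
      rcases hadj with hadj | hadj
      · exact Or.inl (γ.property i l hil hadj j k hij hjk hkl)
      · exact Or.inr (σ.property i l hil hadj j k hij hjk hkl)⟩
    have hτ : InPattern τ u := fun i j hadj => hadj.elim (hγ i j) (h.1 i j)
    have h1 : σ ≤ τ := (le_sup_right : σ.val ≤ γ.val ⊔ σ.val)
    have h2 : γ ≤ τ := (le_sup_left : γ.val ≤ γ.val ⊔ σ.val)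
    by_contra hne
    exact h.2 τ (lt_of_le_of_ne h1 fun h3 => hne (h3 ▸ h2)) hτ
  · intro hle i j hadj
    exact h.1 i j (hle hadj)

variable (F) in
/-- The indicator function of a normal pattern subgroup. -/
def patternIndicator (γ : IndiffGraph n) : scf F n where
  val := fun u => if InPattern γ u then 1 else 0
  property := by
    intro σ u v hu hv
    simp only [hu.inPattern_iff, hv.inPattern_iff]

theorem scf_eq_sum (φ : scf F n) : ∃ c : IndiffGraph n → ℂ,
    φ = ∑ γ, c γ • superclassIndicator F γ := by
  -- The coefficient is the value at any element of the superclass. The default `0` is immaterial,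
  -- since an empty superclass has zero indicator.
  refine ⟨fun γ => if h : ∃ u, InSuperclass γ u then φ.val h.choose else 0, ?_⟩
  refine Subtype.ext (funext fun u => ?_)
  obtain ⟨γ, hγ⟩ := exists_inSuperclass u
  have hsum : ∀ c : IndiffGraph n → ℂ,
      (∑ γ, c γ • superclassIndicator F γ).val u = ∑ γ, c γ * if InSuperclass γ u then 1 else 0 := by
    intro c
    simp [superclassIndicator, Finset.sum_apply]
  rw [hsum, Finset.sum_eq_single γ]
  · have h : ∃ u : UT F n, InSuperclass γ u := ⟨u, hγ⟩
    rw [dif_pos h, if_pos hγ, mul_one]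
    exact φ.property γ _ _ hγ h.choose_spec
  · intro σ _ hσ
    rw [if_neg fun h => hσ (h.eq hγ), mul_zero]
  · simp

/-- A pattern subgroup is the disjoint union of the superclasses of all graphs that contain its
graph. This triangular relation is inverted by induction from larger to smaller graphs. -/
theorem superclassIndicator_mem_span (γ : IndiffGraph n) :
    superclassIndicator F γ ∈ Submodule.span ℂ (Set.range (patternIndicator F (n := n))) := by
  induction γ using WellFoundedGT.induction with
  | _ γ ih =>
    have h : superclassIndicator F γ = patternIndicator F γ -
        ∑ σ ∈ Finset.univ.filter fun σ => γ < σ, superclassIndicator F σ := by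
      refine Subtype.ext (funext fun u => ?_)
      obtain ⟨τ, hτ⟩ := exists_inSuperclass u
      have hiff : ∀ σ, InSuperclass σ u ↔ σ = τ := fun σ =>
        ⟨fun h => h.eq hτ, fun h => h ▸ hτ⟩
      have hsum : (∑ σ ∈ Finset.univ.filter fun σ => γ < σ, superclassIndicator F σ).val u =
          ∑ σ ∈ Finset.univ.filter fun σ => γ < σ, if σ = τ then 1 else 0 := by
        simp only [AddSubmonoidClass.coe_finsetSum, Finset.sum_apply]
        simp [superclassIndicator, hiff]
      change _ = (patternIndicator F γ).val u - _
      rw [hsum]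
      simp only [superclassIndicator, patternIndicator, hiff, hτ.inPattern_iff,
        Finset.sum_ite_eq', Finset.mem_filter, Finset.mem_univ, true_and]
      by_cases h1 : γ = τ
      · simp [h1]
      · by_cases h2 : γ ≤ τ
        · simp [h1, h2, lt_of_le_of_ne h2 h1]
        · have h3 : ¬ γ < τ := fun h => h2 h.le
          simp [h1, h2, h3]
    rw [h]
    refine Submodule.sub_mem _ (Submodule.subset_span ⟨γ, rfl⟩) (Submodule.sum_mem _ fun σ hσ => ?_)
    exact ih σ (Finset.mem_filter.1 hσ).2

theorem span_patternIndicator :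
    Submodule.span ℂ (Set.range (patternIndicator F (n := n))) = ⊤ := by
  refine eq_top_iff.2 fun φ _ => ?_
  obtain ⟨c, rfl⟩ := scf_eq_sum φ
  exact Submodule.sum_mem _ fun γ _ => Submodule.smul_mem _ _ (superclassIndicator_mem_span γ)

theorem utHopf_induction {p : (⨁ n, scf F n) → Prop} (h0 : p 0)
    (hadd : ∀ x y, p x → p y → p (x + y)) (hsmul : ∀ (c : ℂ) x, p x → p (c • x))
    (h : ∀ n (γ : IndiffGraph n), p (DirectSum.lof ℂ ℕ (fun n => scf F n) n (patternIndicator F γ)))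
    (x : ⨁ n, scf F n) : p x := by
  induction x using homog_induction with
  | h0 => exact h0
  | hadd x y hx hy => exact hadd x y hx hy
  | h n x hx =>
    obtain ⟨φ, rfl⟩ := hx
    have hφ : φ ∈ Submodule.span ℂ (Set.range (patternIndicator F (n := n))) := by
      rw [span_patternIndicator]
      trivial
    induction hφ using Submodule.span_induction with
    | mem x hx =>
      obtain ⟨γ, rfl⟩ := hx
      exact h n γ
    | zero => rw [map_zero]; exact h0
    | add x y _ _ hx hy => rw [map_add]; exact hadd _ _ hx hy
    | smul c x _ hx => rw [map_smul]; exact hsmul c _ hx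

theorem separates_scf :
    Separates fun u : UT F n => LinearMap.proj u ∘ₗ (scf F n).subtype :=
  fun _ _ h => Subtype.ext (funext h)

theorem toTensor_mul {k l : ℕ} (φ : scf F k) (ψ : scf F l) :
    toTensor (fun (γ : IndiffGraph k) a => InSuperclass γ a)
      (fun (γ : IndiffGraph l) b => InSuperclass γ b)
      (superclassIndicator F) (superclassIndicator F) (fun a b => φ.val a * ψ.val b) =
      φ ⊗ₜ[ℂ] ψ := by
  refine ((separates_scf (F := F) (n := k)).tensor (separates_scf (F := F) (n := l))).ext ?_
  rintro ⟨a, b⟩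
  obtain ⟨γ, hγ⟩ := exists_inSuperclass a
  obtain ⟨σ, hσ⟩ := exists_inSuperclass b
  refine tensorEval_toTensor _ _ a b γ σ hγ hσ ?_ ?_ ?_
  · intro τ
    simp only [LinearMap.comp_apply, Submodule.subtype_apply, LinearMap.proj_apply,
      superclassIndicator]
    by_cases h : τ = γ
    · rw [if_pos h, if_pos (h ▸ hγ)]
    · rw [if_neg h, if_neg fun h' => h (h'.eq hγ)]
  · intro τ
    simp only [LinearMap.comp_apply, Submodule.subtype_apply, LinearMap.proj_apply,
      superclassIndicator]
    by_cases h : τ = σ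
    · rw [if_pos h, if_pos (h ▸ hσ)]
    · rw [if_neg h, if_neg fun h' => h (h'.eq hσ)]
  · intro a' b' ha hb
    rw [φ.property γ _ _ ha hγ, ψ.property σ _ _ hb hσ]

end Superclass

/-! ### Averages of pattern indicators over matrices with given diagonal blocks -/

section BlockCount

variable {k l n : ℕ} (e : Fin k ↪o Fin n) (f : Fin l ↪o Fin n)
  (h : IsCompl (Set.range e) (Set.range f))

/-- The pairs of indices above the diagonal in `e × f`. -/
abbrev UpperPair : Type := {p : Fin k × Fin l // e p.1 < f p.2}

/-- The matrix with diagonal blocks `a` and `b` and given entries above the diagonal. -/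
def blockMatrix (a : Matrix (Fin k) (Fin k) F) (b : Matrix (Fin l) (Fin l) F)
    (y : UpperPair e f → F) : Matrix (Fin n) (Fin n) F :=
  (fromBlocks a (Matrix.of fun i j => if hp : e i < f j then y ⟨(i, j), hp⟩ else 0) 0 b).submatrix
    (complEquiv e f h).symm (complEquiv e f h).symm

theorem blockMatrix_apply (a : Matrix (Fin k) (Fin k) F) (b : Matrix (Fin l) (Fin l) F)
    (y : UpperPair e f → F) (c d : Fin k ⊕ Fin l) :
    blockMatrix e f h a b y (complEquiv e f h c) (complEquiv e f h d) =
      fromBlocks a (Matrix.of fun i j => if hp : e i < f j then y ⟨(i, j), hp⟩ else 0) 0 b c d := by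
  simp [blockMatrix]

theorem isUnitri_blockMatrix {a : Matrix (Fin k) (Fin k) F} {b : Matrix (Fin l) (Fin l) F}
    (ha : IsUnitri a) (hb : IsUnitri b) (y : UpperPair e f → F) :
    IsUnitri (blockMatrix e f h a b y) := by
  intro i j hij
  obtain ⟨i, rfl⟩ := (complEquiv e f h).surjective i
  obtain ⟨j, rfl⟩ := (complEquiv e f h).surjective j
  rw [Matrix.sub_apply, blockMatrix_apply] at hij
  simp only [Matrix.one_apply, (complEquiv e f h).injective.eq_iff] at hij
  rcases i with i | i <;> rcases j with j | j
  · refine e.lt_iff_lt.2 (ha i j ?_)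
    simpa [Matrix.one_apply] using hij
  · by_contra hlt
    apply hij
    have : ¬ e i < f j := hlt
    simp [this]
  · simp at hij
  · refine f.lt_iff_lt.2 (hb i j ?_)
    simpa [Matrix.one_apply] using hij

/-- Outside its diagonal blocks, a unitriangular matrix with zero block at `f × e` has free entries
only at the positions of `e × f` above the diagonal. -/
theorem hasBlocks_iff_exists {u : Matrix (Fin n) (Fin n) F} (hu : IsUnitri u)
    (a : Matrix (Fin k) (Fin k) F) (b : Matrix (Fin l) (Fin l) F) :
    HasBlocks e f u a b ↔ ∃ y, u = blockMatrix e f h a b y := by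
  constructor
  · rintro ⟨rfl, rfl, h0⟩
    refine ⟨fun p => u (e p.1.1) (f p.1.2), ?_⟩
    ext i j
    obtain ⟨i, rfl⟩ := (complEquiv e f h).surjective i
    obtain ⟨j, rfl⟩ := (complEquiv e f h).surjective j
    rw [blockMatrix_apply]
    rcases i with i | i <;> rcases j with j | j
    · rfl
    · simp only [complEquiv_inl, complEquiv_inr, fromBlocks_apply₁₂, of_apply]
      split_ifs with hp
      · rfl
      · by_contra hne
        refine hp (hu _ _ ?_)
        have : e i ≠ f j := fun hij => Set.disjoint_left.1 h.disjoint ⟨i, rfl⟩ ⟨j, hij.symm⟩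
        rwa [Matrix.sub_apply, Matrix.one_apply_ne this, sub_zero]
    · exact congrFun (congrFun h0 i) j
    · rfl
  · rintro ⟨y, rfl⟩
    refine ⟨?_, ?_, ?_⟩
    · ext i j
      exact blockMatrix_apply e f h a b y (Sum.inl i) (Sum.inl j)
    · ext i j
      exact blockMatrix_apply e f h a b y (Sum.inr i) (Sum.inr j)
    · ext i j
      exact blockMatrix_apply e f h a b y (Sum.inr i) (Sum.inl j)

theorem blockMatrix_injective (a : Matrix (Fin k) (Fin k) F) (b : Matrix (Fin l) (Fin l) F) :
    Function.Injective (blockMatrix e f h a b) := by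
  intro y y' hy
  funext ⟨⟨i, j⟩, hp⟩
  have h1 := congrFun (congrFun hy (complEquiv e f h (Sum.inl i))) (complEquiv e f h (Sum.inr j))
  rw [blockMatrix_apply, blockMatrix_apply] at h1
  simpa [hp] using h1

/-- The element of `UT_n` with given diagonal blocks and given entries above the diagonal. -/
def utBlock (a : UT F k) (b : UT F l) (y : UpperPair e f → F) : UT F n :=
  UT.mk (blockMatrix e f h a.val.val b.val.val y) (isUnitri_blockMatrix e f h a.2 b.2 y)

theorem utBlock_val (a : UT F k) (b : UT F l) (y : UpperPair e f → F) :
    (utBlock e f h a b y).val.val = blockMatrix e f h a.val.val b.val.val y := rfl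

theorem utBlock_injective (a : UT F k) (b : UT F l) :
    Function.Injective (utBlock e f h a b) := fun _ _ hy =>
  blockMatrix_injective e f h a.val.val b.val.val
    (congrArg (fun u : UT F n => u.val.val) hy)

theorem hasBlocks_iff_exists_utBlock (u : UT F n) (a : UT F k) (b : UT F l) :
    HasBlocks e f u.val.val a.val.val b.val.val ↔ ∃ y, u = utBlock e f h a b y := by
  rw [hasBlocks_iff_exists e f h u.2]
  exact exists_congr fun y => ⟨fun h => Subtype.ext (Units.ext h), fun h => by rw [h]; rfl⟩

theorem avg_hasBlocks (a : UT F k) (b : UT F l) (φ : UT F n → ℂ) :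
    avg (fun u : UT F n => HasBlocks e f u.val.val a.val.val b.val.val) φ =
      (Fintype.card (UpperPair e f → F) : ℂ)⁻¹ * ∑ y, φ (utBlock e f h a b y) :=
  avg_eq_sum _ _ (utBlock_injective e f h a b) (fun u => hasBlocks_iff_exists_utBlock e f h u a b) φ

/-- The restriction of an indifference graph along an order embedding. -/
def IndiffGraph.comap (γ : IndiffGraph n) (e : Fin k ↪o Fin n) : IndiffGraph k :=
  ⟨γ.val.comap e, fun i l hil hadj j m hij hjm hml =>
    γ.property (e i) (e l) (e.lt_iff_lt.2 hil) hadj (e j) (e m) (e.le_iff_le.2 hij)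
      (e.lt_iff_lt.2 hjm) (e.le_iff_le.2 hml)⟩

theorem inPattern_utBlock (γ : IndiffGraph n) (a : UT F k) (b : UT F l) (y : UpperPair e f → F) :
    InPattern γ (utBlock e f h a b y) ↔ InPattern (γ.comap e) a ∧ InPattern (γ.comap f) b ∧
      ∀ p, γ.val.Adj (e p.1.1) (f p.1.2) → y p = 0 := by
  unfold InPattern
  rw [utBlock_val]
  constructor
  · intro H
    refine ⟨fun i j hij => ?_, fun i j hij => ?_, fun p hp => ?_⟩
    · rw [← H _ _ hij]
      exact (blockMatrix_apply e f h a.val.val b.val.val y (Sum.inl i) (Sum.inl j)).symm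
    · rw [← H _ _ hij]
      exact (blockMatrix_apply e f h a.val.val b.val.val y (Sum.inr i) (Sum.inr j)).symm
    · rw [← H _ _ hp]
      refine Eq.trans ?_
        (blockMatrix_apply e f h a.val.val b.val.val y (Sum.inl p.1.1) (Sum.inr p.1.2)).symm
      simp [p.2]
  · rintro ⟨h1, h2, h3⟩ i j hij
    obtain ⟨i, rfl⟩ := (complEquiv e f h).surjective i
    obtain ⟨j, rfl⟩ := (complEquiv e f h).surjective j
    rw [blockMatrix_apply]
    rcases i with i | i <;> rcases j with j | j
    · exact h1 i j hij
    · simp only [fromBlocks_apply₁₂, of_apply]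
      split_ifs with hp
      · exact h3 ⟨(i, j), hp⟩ hij
      · rfl
    · rfl
    · exact h2 i j hij

/-- The sum factors over positions: one in `Q` admits a single value out of `q`, any other admits
all of them. -/
theorem sum_pi_ite {P : Type*} [Fintype P] [DecidableEq P] (Q : P → Prop) :
    (∑ y : P → F, if ∀ p, Q p → y p = 0 then (1 : ℂ) else 0) =
      Fintype.card (P → F) * ∏ p, if Q p then (Fintype.card F : ℂ)⁻¹ else 1 := by
  have h1 : ∀ y : P → F, (if ∀ p, Q p → y p = 0 then (1 : ℂ) else 0) =
      ∏ p, if Q p → y p = 0 then 1 else 0 := by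
    intro y
    rw [Finset.prod_ite_zero]
    simp
  simp only [h1]
  rw [← Fintype.prod_sum (κ := fun _ => F) (fun p c => if Q p → c = 0 then (1 : ℂ) else 0)]
  have h2 : (Fintype.card (P → F) : ℂ) = ∏ _p : P, (Fintype.card F : ℂ) := by
    simp
  rw [h2, ← Finset.prod_mul_distrib]
  refine Finset.prod_congr rfl fun p _ => ?_
  have := card_ne_zero' (F := F)
  by_cases hp : Q p
  · simp [hp, this]
  · simp [hp]

/-- Membership in the pattern subgroup splits into conditions on the two diagonal blocks and the
vanishing of the free entries at edges of `γ`, each of which holds for one value in `q`. Hence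
pattern indicators restrict to multiples of products of pattern indicators, and this is what makes
them a convenient spanning set. -/
theorem avg_patternIndicator (h : IsCompl (Set.range e) (Set.range f)) (γ : IndiffGraph n) (a : UT F k) (b : UT F l) :
    avg (fun u : UT F n => HasBlocks e f u.val.val a.val.val b.val.val)
      (patternIndicator F γ).val =
      (∏ i, ∏ j, if e i < f j ∧ γ.val.Adj (e i) (f j) then (Fintype.card F : ℂ)⁻¹ else 1) *
        ((patternIndicator F (γ.comap e)).val a * (patternIndicator F (γ.comap f)).val b) := by
  rw [avg_hasBlocks e f h]
  simp only [patternIndicator, inPattern_utBlock]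
  by_cases h1 : InPattern (γ.comap e) a
  · by_cases h2 : InPattern (γ.comap f) b
    · simp only [h1, h2, true_and, if_true, mul_one]
      rw [sum_pi_ite, inv_mul_cancel_left₀ (Nat.cast_ne_zero.2 Fintype.card_ne_zero),
        ← Fintype.prod_prod_type']
      rw [← Finset.prod_subtype (Finset.univ.filter fun p : Fin k × Fin l => e p.1 < f p.2)
        (by simp) fun p => if γ.val.Adj (e p.1) (f p.2) then (Fintype.card F : ℂ)⁻¹ else 1,
        Finset.prod_filter]
      refine Finset.prod_congr rfl fun p _ => ?_
      rw [ite_and]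
    · simp [h2]
  · simp [h1]

end BlockCount

end

section

variable {F : Type*} [Field F] [Fintype F]

/-! ## Structure constants of `scf(UT_•)` -/

section Coproduct

/-- Indifference graphs on the natural numbers. -/
abbrev NatIndiffGraph : Type :=
  {τ : SimpleGraph ℕ // ∀ i l, i < l → τ.Adj i l → ∀ j k, i ≤ j → j < k → k ≤ l → τ.Adj j k}

/-- The restriction of an indifference graph along an order embedding. -/
def NatIndiffGraph.comap (τ : NatIndiffGraph) {k : ℕ} (e : Fin k ↪o ℕ) : IndiffGraph k :=
  ⟨τ.val.comap e, fun i l hil hadj j m hij hjm hml =>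
    τ.property (e i) (e l) (e.lt_iff_lt.2 hil) hadj (e j) (e m) (e.le_iff_le.2 hij)
      (e.lt_iff_lt.2 hjm) (e.le_iff_le.2 hml)⟩

variable (F) in
/-- The homogeneous element given by the pattern subgroup of a graph. -/
def patternElem {n : ℕ} (γ : IndiffGraph n) : ⨁ n, scf F n :=
  DirectSum.lof ℂ ℕ (fun n => scf F n) n (patternIndicator F γ)

variable (F) in
/-- The homogeneous element given by the restriction of a graph to a finite set. -/
def finsetElem (τ : NatIndiffGraph) (A : Finset ℕ) : ⨁ n, scf F n :=
  patternElem F (τ.comap (A.orderEmbOfFin rfl))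

/-- With finite subsets of `ℕ` as index sets, restricting a graph in several stages is passing to
smaller subsets, and the coproduct identities need no relabelling. -/
theorem finsetElem_eq (τ : NatIndiffGraph) {A : Finset ℕ} {k : ℕ} (e : Fin k ↪o ℕ)
    (he : A = Finset.univ.map e.toEmbedding) :
    finsetElem F τ A = patternElem F (τ.comap e) := by
  have hk : A.card = k := by simp [he]
  subst hk
  have h : e = A.orderEmbOfFin rfl := Finset.orderEmbOfFin_unique' rfl fun i =>
    (Finset.ext_iff.1 he (e i)).2 (Finset.mem_map_of_mem e.toEmbedding (Finset.mem_univ i))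
  rw [h, finsetElem]

variable (F) in
/-- The structure constants of the coproduct. -/
def edgeWeight (τ : NatIndiffGraph) (A B : Finset ℕ) : ℂ :=
  ∏ i ∈ A, ∏ j ∈ B, if i < j ∧ τ.val.Adj i j then (Fintype.card F : ℂ)⁻¹ else 1

theorem utComul_patternIndicator {k l n : ℕ} (h : k + l = n) (γ : IndiffGraph n) :
    utComul F k l n h (patternIndicator F γ) = ∑ e : Fin k ↪o Fin n, ∑ f : Fin l ↪o Fin n,
      if IsCompl (Set.range e) (Set.range f) then
        (∏ i, ∏ j, if e i < f j ∧ γ.val.Adj (e i) (f j) then (Fintype.card F : ℂ)⁻¹ else 1) •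
          (patternIndicator F (γ.comap e) ⊗ₜ[ℂ] patternIndicator F (γ.comap f)) else 0 := by
  have h1 : utRes F k l n (patternIndicator F γ).val =
      ∑ e : Fin k ↪o Fin n, ∑ f : Fin l ↪o Fin n,
      if IsCompl (Set.range e) (Set.range f) then
        (∏ i, ∏ j, if e i < f j ∧ γ.val.Adj (e i) (f j) then (Fintype.card F : ℂ)⁻¹ else 1) •
          (fun a b => (patternIndicator F (γ.comap e)).val a *
            (patternIndicator F (γ.comap f)).val b) else 0 := by
    funext a b
    simp only [utRes, LinearMap.pi_apply, LinearMap.sum_apply, Finset.sum_apply]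
    refine Finset.sum_congr rfl fun e _ => Finset.sum_congr rfl fun f _ => ?_
    split_ifs with hc
    · rw [avg_patternIndicator e f hc]
      rfl
    · rfl
  change toTensor _ _ _ _ (utRes F k l n (patternIndicator F γ).val) = _
  rw [h1, map_sum]
  refine Finset.sum_congr rfl fun e _ => ?_
  rw [map_sum]
  refine Finset.sum_congr rfl fun f _ => ?_
  split_ifs with hc
  · rw [map_smul, toTensor_mul]
  · rw [map_zero]

/-- The compositions of `Fin n` into two parts. -/
abbrev TwoParts (n : ℕ) : Type :=
  Σ p : {p : ℕ × ℕ // p ∈ Finset.HasAntidiagonal.antidiagonal n},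
    (Fin p.1.1 ↪o Fin n) × (Fin p.1.2 ↪o Fin n)

theorem comul_patternElem {n : ℕ} (γ : IndiffGraph n) :
    (utHopf F).comul (patternElem F γ) =
      ∑ x ∈ (Finset.univ : Finset (TwoParts n)).filter fun x =>
          IsCompl (Set.range x.2.1) (Set.range x.2.2),
        (∏ i, ∏ j, if x.2.1 i < x.2.2 j ∧ γ.val.Adj (x.2.1 i) (x.2.2 j) then
          (Fintype.card F : ℂ)⁻¹ else 1) •
          (patternElem F (γ.comap x.2.1) ⊗ₜ[ℂ] patternElem F (γ.comap x.2.2)) := by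
  have h1 : (utHopf F).comul (patternElem F γ) = _ :=
    gradedComul_lof (V := fun n => scf F n) (utComul F) n (patternIndicator F γ)
  rw [h1, Finset.sum_filter, ← Finset.univ_sigma_univ, Finset.sum_sigma, Finset.univ_eq_attach]
  refine Finset.sum_congr rfl fun p _ => ?_
  rw [utComul_patternIndicator, Fintype.sum_prod_type, map_sum]
  refine Finset.sum_congr rfl fun e _ => ?_
  rw [map_sum]
  refine Finset.sum_congr rfl fun f _ => ?_
  split_ifs with hc
  · rw [map_smul, TensorProduct.map_tmul]
    rfl
  · rw [map_zero]

/-- An order embedding is determined by its range, so a pair of embeddings with complementary ranges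
amounts to the subset `B` that is the range of the first. -/
theorem comul_finsetElem (τ : NatIndiffGraph) (A : Finset ℕ) :
    (utHopf F).comul (finsetElem F τ A) = ∑ B ∈ A.powerset,
      edgeWeight F τ B (A \ B) • (finsetElem F τ B ⊗ₜ[ℂ] finsetElem F τ (A \ B)) := by
  rw [finsetElem, comul_patternElem]
  generalize hE : A.orderEmbOfFin rfl = E
  have hrange : ∀ c, c ∈ A ↔ ∃ i, E i = c := by
    intro c
    have := Finset.range_orderEmbOfFin A rfl
    rw [← hE, ← Finset.mem_coe, ← this, Set.mem_range]
  have hcompl : ∀ {k l : ℕ} (e : Fin k ↪o Fin A.card) (f : Fin l ↪o Fin A.card),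
      IsCompl (Set.range e) (Set.range f) →
      A \ Finset.univ.map (e.trans E).toEmbedding = Finset.univ.map (f.trans E).toEmbedding := by
    intro k l e f hc
    ext c
    simp only [Finset.mem_sdiff, hrange, Finset.mem_map, Finset.mem_univ, true_and]
    constructor
    · rintro ⟨⟨i, rfl⟩, hi⟩
      have h1 : i ∈ (⊤ : Set (Fin A.card)) := trivial
      rw [← hc.sup_eq_top] at h1
      rcases h1 with ⟨a, rfl⟩ | ⟨b, rfl⟩
      · exact absurd ⟨a, rfl⟩ hi
      · exact ⟨b, rfl⟩
    · rintro ⟨b, rfl⟩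
      refine ⟨⟨f b, rfl⟩, ?_⟩
      rintro ⟨a, ha⟩
      exact Set.disjoint_left.1 hc.disjoint ⟨a, rfl⟩ ⟨b, (E.injective ha).symm⟩
  refine Finset.sum_bij (fun x _ => Finset.univ.map (x.2.1.trans E).toEmbedding) ?_ ?_ ?_ ?_
  · rintro ⟨p, e, f⟩ -
    rw [Finset.mem_powerset]
    intro c hc
    obtain ⟨i, -, rfl⟩ := Finset.mem_map.1 hc
    exact (hrange _).2 ⟨_, rfl⟩
  · rintro ⟨⟨⟨k, l⟩, hp⟩, e, f⟩ hx ⟨⟨⟨k', l'⟩, hp'⟩, e', f'⟩ hx' heq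
    simp only [Finset.mem_filter, Finset.mem_univ, true_and] at hx hx' heq
    obtain rfl : k = k' := by simpa using congrArg Finset.card heq
    obtain rfl : l = l' := by
      have h1 := Finset.HasAntidiagonal.mem_antidiagonal.1 hp
      have h2 := Finset.HasAntidiagonal.mem_antidiagonal.1 hp'
      simp only at h1 h2
      omega
    have hinj : ∀ {k : ℕ} (e e' : Fin k ↪o Fin A.card),
        Finset.univ.map (e.trans E).toEmbedding = Finset.univ.map (e'.trans E).toEmbedding →
          e = e' := by
      intro k e e' h
      have h1 : e.trans E = e'.trans E := OrderEmbedding.range_inj.1 (by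
        have := congrArg (fun s : Finset ℕ => (s : Set ℕ)) h
        simpa using this)
      ext i
      exact congrArg Fin.val (E.injective (DFunLike.congr_fun h1 i))
    obtain rfl := hinj e e' heq
    obtain rfl := hinj f f' (by rw [← hcompl e f hx, ← hcompl e f' hx'])
    rfl
  · intro B hB
    rw [Finset.mem_powerset] at hB
    let B' : Finset (Fin A.card) := Finset.univ.filter fun i => E i ∈ B
    refine ⟨⟨⟨(B'.card, B'ᶜ.card), ?_⟩, B'.orderEmbOfFin rfl, B'ᶜ.orderEmbOfFin rfl⟩, ?_, ?_⟩
    · rw [Finset.HasAntidiagonal.mem_antidiagonal]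
      simp
    · simp only [Finset.mem_filter, Finset.mem_univ, true_and, Finset.range_orderEmbOfFin]
      rw [Finset.coe_compl]
      exact isCompl_compl
    · ext c
      simp only [Finset.mem_map, Finset.mem_univ, true_and]
      constructor
      · rintro ⟨i, rfl⟩
        have := Finset.orderEmbOfFin_mem B' rfl i
        exact (Finset.mem_filter.1 this).2
      · intro hc
        obtain ⟨i, rfl⟩ := (hrange c).1 (hB hc)
        have h1 : i ∈ Set.range (B'.orderEmbOfFin rfl) := by
          rw [Finset.range_orderEmbOfFin]
          exact Finset.mem_filter.2 ⟨Finset.mem_univ _, hc⟩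
        obtain ⟨a, rfl⟩ := h1
        exact ⟨a, rfl⟩
  · rintro ⟨⟨⟨k, l⟩, hp⟩, e, f⟩ hx
    simp only [Finset.mem_filter, Finset.mem_univ, true_and] at hx
    simp only
    rw [hcompl e f hx, finsetElem_eq τ _ rfl, finsetElem_eq τ _ rfl, edgeWeight]
    simp only [Finset.prod_map]
    congr 1
    refine Finset.prod_congr rfl fun i _ => Finset.prod_congr rfl fun j _ => if_congr ?_ rfl rfl
    exact and_congr (E.lt_iff_lt (a := e i) (b := f j)).symm Iff.rfl

end Coproduct

/-! ### Products of pattern indicators and multiplicativity of the weights -/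

section Product

variable (τ : NatIndiffGraph)

/-- Without edges between the initial and the final segment, the pattern condition constrains the
diagonal blocks only. -/
theorem inPattern_iff_block {k l : ℕ} (γ : IndiffGraph (k + l)) (u : UT F (k + l))
    (h : ∀ a b, ¬ γ.val.Adj (firstEmb (rfl : k + l = k + l) a) (lastEmb rfl b)) :
    InPattern γ u ↔ InPattern (γ.comap (firstEmb rfl)) (UT.block (firstEmb rfl) u) ∧
      InPattern (γ.comap (lastEmb rfl)) (UT.block (lastEmb rfl) u) := by
  constructor
  · exact fun H => ⟨fun i j hij => H _ _ hij, fun i j hij => H _ _ hij⟩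
  · rintro ⟨h1, h2⟩ i j hij
    obtain ⟨i, rfl⟩ := (complEquiv _ _ (isCompl_firstEmb_lastEmb (rfl : k + l = k + l))).surjective i
    obtain ⟨j, rfl⟩ := (complEquiv _ _ (isCompl_firstEmb_lastEmb (rfl : k + l = k + l))).surjective j
    rcases i with i | i <;> rcases j with j | j
    · exact h1 i j hij
    · exact absurd hij (h i j)
    · exact absurd hij.symm (h j i)
    · exact h2 i j hij

theorem mul_patternElem {k l : ℕ} (γ : IndiffGraph (k + l))
    (h : ∀ a b, ¬ γ.val.Adj (firstEmb (rfl : k + l = k + l) a) (lastEmb rfl b)) :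
    (utHopf F).mul (patternElem F (γ.comap (firstEmb rfl)))
      (patternElem F (γ.comap (lastEmb (rfl : k + l = k + l)))) = patternElem F γ := by
  have h1 : (utHopf F).mul (patternElem F (γ.comap (firstEmb rfl)))
      (patternElem F (γ.comap (lastEmb (rfl : k + l = k + l)))) = _ :=
    gradedMul_lof (V := fun n => scf F n) (utMul F) k l _ _
  rw [h1, patternElem]
  congr 1
  refine Subtype.ext (funext fun u => ?_)
  change (if _ then (1 : ℂ) else 0) * (if _ then (1 : ℂ) else 0) = if _ then (1 : ℂ) else 0
  rw [if_congr (inPattern_iff_block γ u h) rfl rfl, ite_and]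
  split_ifs <;> simp

theorem mul_finsetElem {A B : Finset ℕ} (hlt : ∀ a ∈ A, ∀ b ∈ B, a < b)
    (hadj : ∀ a ∈ A, ∀ b ∈ B, ¬ τ.val.Adj a b) :
    (utHopf F).mul (finsetElem F τ A) (finsetElem F τ B) = finsetElem F τ (A ∪ B) := by
  let eA := A.orderEmbOfFin rfl
  let eB := B.orderEmbOfFin rfl
  let E := complEquiv _ _ (isCompl_firstEmb_lastEmb (rfl : A.card + B.card = A.card + B.card))
  -- The increasing enumeration of `A ∪ B` is that of `A` followed by that of `B`.
  have hmono : StrictMono fun c => Sum.elim eA eB (E.symm c) := by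
    intro c d hcd
    obtain ⟨c, rfl⟩ := E.surjective c
    obtain ⟨d, rfl⟩ := E.surjective d
    simp only [Equiv.symm_apply_apply]
    rcases c with c | c <;> rcases d with d | d
    · exact eA.lt_iff_lt.2 ((firstEmb rfl).lt_iff_lt.1 hcd)
    · exact hlt _ (Finset.orderEmbOfFin_mem A rfl c) _ (Finset.orderEmbOfFin_mem B rfl d)
    · have h1 : A.card + (c : ℕ) < d := hcd
      have := d.isLt
      omega
    · exact eB.lt_iff_lt.2 ((lastEmb rfl).lt_iff_lt.1 hcd)
  let e : Fin (A.card + B.card) ↪o ℕ := OrderEmbedding.ofStrictMono _ hmono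
  have hE : ∀ c, e (E c) = Sum.elim eA eB c := fun c => by
    change Sum.elim eA eB (E.symm (E c)) = _
    rw [Equiv.symm_apply_apply]
  have he : A ∪ B = Finset.univ.map e.toEmbedding := by
    ext c
    have hA : c ∈ A ↔ ∃ i, eA i = c := by
      rw [← Finset.mem_coe, ← Finset.range_orderEmbOfFin A rfl, Set.mem_range]
    have hB : c ∈ B ↔ ∃ i, eB i = c := by
      rw [← Finset.mem_coe, ← Finset.range_orderEmbOfFin B rfl, Set.mem_range]
    rw [Finset.mem_union, hA, hB, Finset.mem_map]
    simp only [Finset.mem_univ, true_and, RelEmbedding.coe_toEmbedding]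
    rw [E.surjective.exists]
    simp only [hE, Sum.exists, Sum.elim_inl, Sum.elim_inr]
  have hcA : (τ.comap e).comap (firstEmb rfl) = τ.comap eA := by
    have : (firstEmb rfl).trans e = eA := by
      ext i
      exact hE (Sum.inl i)
    rw [← this]
    rfl
  have hcB : (τ.comap e).comap (lastEmb rfl) = τ.comap eB := by
    have : (lastEmb rfl).trans e = eB := by
      ext i
      exact hE (Sum.inr i)
    rw [← this]
    rfl
  rw [finsetElem_eq τ e he, ← mul_patternElem, hcA, hcB]
  · rfl
  · intro a b hab
    refine hadj _ (Finset.orderEmbOfFin_mem A rfl a) _ (Finset.orderEmbOfFin_mem B rfl b) ?_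
    have h1 : τ.val.Adj (e (E (Sum.inl a))) (e (E (Sum.inr b))) := hab
    rwa [hE, hE] at h1

theorem edgeWeight_union_left {A A' B : Finset ℕ} (h : Disjoint A A') :
    edgeWeight F τ (A ∪ A') B = edgeWeight F τ A B * edgeWeight F τ A' B :=
  Finset.prod_union h

theorem edgeWeight_union_right {A B B' : Finset ℕ} (h : Disjoint B B') :
    edgeWeight F τ A (B ∪ B') = edgeWeight F τ A B * edgeWeight F τ A B' := by
  simp only [edgeWeight, Finset.prod_union h, Finset.prod_mul_distrib]

theorem edgeWeight_eq_one {A B : Finset ℕ} (h : ∀ a ∈ A, ∀ b ∈ B, ¬ τ.val.Adj a b) :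
    edgeWeight F τ A B = 1 :=
  Finset.prod_eq_one fun a ha => Finset.prod_eq_one fun b hb =>
    if_neg fun hab => h a ha b hb hab.2

end Product

/-! ### Disjoint unions of indifference graphs -/

section Basis

/-- The embedding onto an interval. -/
def intervalEmb (s k : ℕ) : Fin k ↪o ℕ :=
  OrderEmbedding.ofStrictMono (fun i => s + i) fun i j h => by
    have : (i : ℕ) < j := h
    simpa using this

/-- The disjoint union of three indifference graphs on consecutive intervals. -/
def glue {k l m : ℕ} (γ : IndiffGraph k) (σ : IndiffGraph l) (ρ : IndiffGraph m) :
    NatIndiffGraph :=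
  ⟨γ.val.map (intervalEmb 0 k).toEmbedding ⊔ σ.val.map (intervalEmb k l).toEmbedding ⊔
      ρ.val.map (intervalEmb (k + l) m).toEmbedding, by
    have key : ∀ {n : ℕ} (s : ℕ) (γ : IndiffGraph n) (i l : ℕ), i < l →
        (γ.val.map (intervalEmb s n).toEmbedding).Adj i l → ∀ j k, i ≤ j → j < k → k ≤ l →
          (γ.val.map (intervalEmb s n).toEmbedding).Adj j k := by
      intro n s γ i l hil hadj j k hij hjk hkl
      obtain ⟨a, b, hab, rfl, rfl⟩ := (SimpleGraph.map_adj _ _ _ _).1 hadj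
      have h1 : s + (a : ℕ) ≤ j := hij
      have h2 : k ≤ s + (b : ℕ) := hkl
      have hb := b.isLt
      have hlt : s + (a : ℕ) < s + b := hil
      refine (SimpleGraph.map_adj _ _ _ _).2 ⟨⟨j - s, by omega⟩, ⟨k - s, by omega⟩,
        γ.property a b (Fin.lt_def.2 (by omega)) hab _ _ (Fin.le_def.2 (by simp; omega))
          (Fin.lt_def.2 (by simp; omega)) (Fin.le_def.2 (by simp; omega)), ?_, ?_⟩
      · change s + (j - s) = j
        omega
      · change s + (k - s) = k
        omega
    intro i l hil hadj j k hij hjk hkl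
    rcases hadj with (hadj | hadj) | hadj
    · exact Or.inl (Or.inl (key _ _ i l hil hadj j k hij hjk hkl))
    · exact Or.inl (Or.inr (key _ _ i l hil hadj j k hij hjk hkl))
    · exact Or.inr (key _ _ i l hil hadj j k hij hjk hkl)⟩

variable {k l m : ℕ} (γ : IndiffGraph k) (σ : IndiffGraph l) (ρ : IndiffGraph m)

theorem map_intervalEmb_adj {n s i j : ℕ} {γ : SimpleGraph (Fin n)}
    (h : (γ.map (intervalEmb s n).toEmbedding).Adj i j) :
    s ≤ i ∧ i < s + n ∧ s ≤ j ∧ j < s + n := by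
  obtain ⟨a, b, -, rfl, rfl⟩ := (SimpleGraph.map_adj _ _ _ _).1 h
  have ha := a.isLt
  have hb := b.isLt
  change s ≤ s + (a : ℕ) ∧ s + (a : ℕ) < s + n ∧ s ≤ s + (b : ℕ) ∧ s + (b : ℕ) < s + n
  omega

theorem glue_adj {i j : ℕ} (h : (glue γ σ ρ).val.Adj i j) :
    (i < k ∧ j < k) ∨ ((k ≤ i ∧ i < k + l) ∧ k ≤ j ∧ j < k + l) ∨ (k + l ≤ i ∧ k + l ≤ j) := by
  rcases h with (h | h) | h
  · have := map_intervalEmb_adj h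
    omega
  · have := map_intervalEmb_adj h
    omega
  · have := map_intervalEmb_adj h
    omega

theorem Ico_eq_map_intervalEmb (s n : ℕ) :
    Finset.Ico s (s + n) = Finset.univ.map (intervalEmb s n).toEmbedding := by
  ext c
  simp only [Finset.mem_Ico, Finset.mem_map, Finset.mem_univ, true_and]
  constructor
  · rintro ⟨h1, h2⟩
    refine ⟨⟨c - s, by omega⟩, ?_⟩
    change s + (c - s) = c
    omega
  · rintro ⟨a, rfl⟩
    have := a.isLt
    change s ≤ s + (a : ℕ) ∧ s + (a : ℕ) < s + n
    omega

theorem map_intervalEmb_adj_iff {n s : ℕ} {γ : SimpleGraph (Fin n)} {a b : Fin n} :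
    (γ.map (intervalEmb s n).toEmbedding).Adj (intervalEmb s n a) (intervalEmb s n b) ↔
      γ.Adj a b :=
  SimpleGraph.map_adj_apply

theorem finsetElem_glue_left :
    finsetElem F (glue γ σ ρ) (Finset.Ico 0 k) = patternElem F γ := by
  rw [finsetElem_eq _ (intervalEmb 0 k) (by simpa using Ico_eq_map_intervalEmb 0 k)]
  congr 1
  refine Subtype.ext (SimpleGraph.ext (funext fun a => funext fun b => propext ?_))
  refine Iff.trans ?_ (map_intervalEmb_adj_iff (s := 0))
  refine ⟨fun h => ?_, fun h => Or.inl (Or.inl h)⟩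
  have ha := a.isLt
  have ha' : (intervalEmb 0 k a : ℕ) = 0 + a := rfl
  rcases h with (h | h) | h
  · exact h
  · have := map_intervalEmb_adj h
    omega
  · have := map_intervalEmb_adj h
    omega

theorem finsetElem_glue_middle :
    finsetElem F (glue γ σ ρ) (Finset.Ico k (k + l)) = patternElem F σ := by
  rw [finsetElem_eq _ (intervalEmb k l) (Ico_eq_map_intervalEmb k l)]
  congr 1
  refine Subtype.ext (SimpleGraph.ext (funext fun a => funext fun b => propext ?_))
  refine Iff.trans ?_ (map_intervalEmb_adj_iff (s := k))
  refine ⟨fun h => ?_, fun h => Or.inl (Or.inr h)⟩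
  have ha := a.isLt
  have ha' : (intervalEmb k l a : ℕ) = k + a := rfl
  rcases h with (h | h) | h
  · have := map_intervalEmb_adj h
    omega
  · exact h
  · have := map_intervalEmb_adj h
    omega

theorem finsetElem_glue_right :
    finsetElem F (glue γ σ ρ) (Finset.Ico (k + l) (k + l + m)) = patternElem F ρ := by
  rw [finsetElem_eq _ (intervalEmb (k + l) m) (Ico_eq_map_intervalEmb (k + l) m)]
  congr 1
  refine Subtype.ext (SimpleGraph.ext (funext fun a => funext fun b => propext ?_))
  refine Iff.trans ?_ (map_intervalEmb_adj_iff (s := k + l))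
  refine ⟨fun h => ?_, fun h => Or.inr h⟩
  have ha := a.isLt
  have ha' : (intervalEmb (k + l) m a : ℕ) = k + l + a := rfl
  rcases h with (h | h) | h
  · have := map_intervalEmb_adj h
    omega
  · have := map_intervalEmb_adj h
    omega
  · exact h

end Basis

end

/-! ## The axioms for `scf(UT_•)` -/

section UTAxioms

variable {F : Type*} [Field F] [Fintype F]

theorem utHopf_mul_mem (k l : ℕ) :
    ∀ x ∈ homog (fun n => scf F n) k, ∀ y ∈ homog (fun n => scf F n) l,
      (utHopf F).mul x y ∈ homog (fun n => scf F n) (k + l) :=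
  gradedMul_mem _ k l

theorem utHopf_one_eq (τ : NatIndiffGraph) : (utHopf F).one = finsetElem F τ ∅ := by
  rw [finsetElem_eq τ (k := 0) (Finset.orderEmbOfFin ∅ rfl) (by simp)]
  change DirectSum.lof ℂ ℕ (fun n => scf F n) 0 _ = DirectSum.lof ℂ ℕ (fun n => scf F n) 0 _
  congr 1
  refine Subtype.ext (funext fun u => ?_)
  exact (if_pos fun i => i.elim0).symm

theorem utHopf_counit_lof_zero (φ : scf F 0) :
    (utHopf F).counit (DirectSum.lof ℂ ℕ (fun n => scf F n) 0 φ) = φ.val 1 := by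
  change DirectSum.toModule _ _ _ _ (DirectSum.lof ℂ ℕ (fun n => scf F n) 0 φ) = _
  rw [DirectSum.toModule_lof]
  rfl

theorem utHopf_counit_mem {n : ℕ} (hn : n ≠ 0) :
    ∀ x ∈ homog (fun n => scf F n) n, (utHopf F).counit x = 0 := by
  rintro _ ⟨φ, rfl⟩
  change DirectSum.toModule _ _ _ _ (DirectSum.lof ℂ ℕ (fun n => scf F n) n φ) = _
  rw [DirectSum.toModule_lof, if_neg hn]
  rfl

theorem utHopf_counit_one : (utHopf F).counit (utHopf F).one = 1 :=
  utHopf_counit_lof_zero _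

theorem counit_finsetElem (τ : NatIndiffGraph) (A : Finset ℕ) :
    (utHopf F).counit (finsetElem F τ A) = if A = ∅ then 1 else 0 := by
  split_ifs with h
  · subst h
    rw [← utHopf_one_eq, utHopf_counit_one]
  · exact utHopf_counit_mem (by simpa using h) _ ⟨_, rfl⟩

/-- Three basis elements are restrictions of one graph to consecutive sets. -/
theorem exists_finsetElem {k l m : ℕ} (γ : IndiffGraph k) (σ : IndiffGraph l)
    (ρ : IndiffGraph m) : ∃ (τ : NatIndiffGraph) (A B C : Finset ℕ),
      patternElem F γ = finsetElem F τ A ∧ patternElem F σ = finsetElem F τ B ∧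
      patternElem F ρ = finsetElem F τ C ∧
      (∀ a ∈ A, ∀ b ∈ B, a < b ∧ ¬ τ.val.Adj a b) ∧
      (∀ a ∈ A, ∀ c ∈ C, a < c ∧ ¬ τ.val.Adj a c) ∧
      (∀ b ∈ B, ∀ c ∈ C, b < c ∧ ¬ τ.val.Adj b c) := by
  refine ⟨glue γ σ ρ, Finset.Ico 0 k, Finset.Ico k (k + l), Finset.Ico (k + l) (k + l + m),
    (finsetElem_glue_left γ σ ρ).symm, (finsetElem_glue_middle γ σ ρ).symm,
    (finsetElem_glue_right γ σ ρ).symm, ?_, ?_, ?_⟩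
  all_goals
    intro a ha b hb
    rw [Finset.mem_Ico] at ha hb
    refine ⟨by omega, fun h => ?_⟩
    have := glue_adj γ σ ρ h
    omega

theorem exists_finsetElem_pair {k l : ℕ} (γ : IndiffGraph k) (σ : IndiffGraph l) :
    ∃ (τ : NatIndiffGraph) (A B : Finset ℕ),
      patternElem F γ = finsetElem F τ A ∧ patternElem F σ = finsetElem F τ B ∧
      (∀ a ∈ A, ∀ b ∈ B, a < b ∧ ¬ τ.val.Adj a b) := by
  obtain ⟨τ, A, B, -, h1, h2, -, h3, -⟩ := exists_finsetElem (F := F) γ σ (edgeless 0)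
  exact ⟨τ, A, B, h1, h2, h3⟩

theorem mul_finsetElem' {τ : NatIndiffGraph} {A B : Finset ℕ}
    (h : ∀ a ∈ A, ∀ b ∈ B, a < b ∧ ¬ τ.val.Adj a b) :
    (utHopf F).mul (finsetElem F τ A) (finsetElem F τ B) = finsetElem F τ (A ∪ B) :=
  mul_finsetElem τ (fun a ha b hb => (h a ha b hb).1) fun a ha b hb => (h a ha b hb).2

theorem finsetElem_induction {p : (⨁ n, scf F n) → Prop} (h0 : p 0)
    (hadd : ∀ x y, p x → p y → p (x + y)) (hsmul : ∀ (c : ℂ) x, p x → p (c • x))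
    (h : ∀ τ A, p (finsetElem F τ A)) (x : ⨁ n, scf F n) : p x := by
  refine utHopf_induction h0 hadd hsmul (fun n γ => ?_) x
  obtain ⟨τ, A, -, h1, -⟩ := exists_finsetElem_pair (F := F) γ (edgeless 0)
  change p (patternElem F γ)
  rw [h1]
  exact h τ A

theorem utHopf_mul_assoc (x y z : ⨁ n, scf F n) :
    (utHopf F).mul ((utHopf F).mul x y) z = (utHopf F).mul x ((utHopf F).mul y z) := by
  induction x using utHopf_induction with
  | h0 => simp
  | hadd x x' h h' => simp only [map_add, LinearMap.add_apply, h, h']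
  | hsmul c x h => simp only [map_smul, LinearMap.smul_apply, h]
  | h k γ =>
    induction y using utHopf_induction with
    | h0 => simp
    | hadd x x' h h' => simp only [map_add, LinearMap.add_apply, h, h']
    | hsmul c x h => simp only [map_smul, LinearMap.smul_apply, h]
    | h l σ =>
      induction z using utHopf_induction with
      | h0 => simp
      | hadd x x' h h' => simp only [map_add, h, h']
      | hsmul c x h => simp only [map_smul, h]
      | h m ρ =>
        obtain ⟨τ, A, B, C, hA, hB, hC, hAB, hAC, hBC⟩ := exists_finsetElem (F := F) γ σ ρ
        change (utHopf F).mul ((utHopf F).mul (patternElem F γ) (patternElem F σ))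
          (patternElem F ρ) = (utHopf F).mul (patternElem F γ) ((utHopf F).mul (patternElem F σ)
          (patternElem F ρ))
        rw [hA, hB, hC, mul_finsetElem' hAB, mul_finsetElem' hBC, mul_finsetElem',
          mul_finsetElem', Finset.union_assoc]
        · intro a ha b hb
          rcases Finset.mem_union.1 hb with hb | hb
          · exact hAB a ha b hb
          · exact hAC a ha b hb
        · intro a ha b hb
          rcases Finset.mem_union.1 ha with ha | ha
          · exact hAC a ha b hb
          · exact hBC a ha b hb

theorem utHopf_one_mul (x : ⨁ n, scf F n) : (utHopf F).mul (utHopf F).one x = x := by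
  induction x using finsetElem_induction with
  | h0 => simp
  | hadd x x' h h' => simp only [map_add, h, h']
  | hsmul c x h => simp only [map_smul, h]
  | h τ A => rw [utHopf_one_eq τ, mul_finsetElem' (by simp), Finset.empty_union]

theorem utHopf_mul_one (x : ⨁ n, scf F n) : (utHopf F).mul x (utHopf F).one = x := by
  induction x using finsetElem_induction with
  | h0 => simp
  | hadd x x' h h' => simp only [map_add, LinearMap.add_apply, h, h']
  | hsmul c x h => simp only [map_smul, LinearMap.smul_apply, h]
  | h τ A => rw [utHopf_one_eq τ, mul_finsetElem' (by simp), Finset.union_empty]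

theorem edgeWeight_empty_left (τ : NatIndiffGraph) (A : Finset ℕ) :
    edgeWeight F τ ∅ A = 1 :=
  edgeWeight_eq_one τ (by simp)

theorem edgeWeight_empty_right (τ : NatIndiffGraph) (A : Finset ℕ) :
    edgeWeight F τ A ∅ = 1 :=
  edgeWeight_eq_one τ (by simp)

theorem utHopf_comul_one :
    (utHopf F).comul (utHopf F).one = (utHopf F).one ⊗ₜ[ℂ] (utHopf F).one := by
  rw [utHopf_one_eq ⟨⊥, fun _ _ _ h => h.elim⟩, comul_finsetElem]
  simp [edgeWeight_empty_left]

theorem utHopf_counit_left (x : ⨁ n, scf F n) :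
    TensorProduct.lid ℂ _ ((utHopf F).counit.rTensor _ ((utHopf F).comul x)) = x := by
  induction x using finsetElem_induction with
  | h0 => simp
  | hadd x x' h h' => simp only [map_add, h, h']
  | hsmul c x h => simp only [map_smul, h]
  | h τ A =>
    rw [comul_finsetElem, map_sum, map_sum, Finset.sum_eq_single ∅]
    · simp [counit_finsetElem, edgeWeight_empty_left]
    · intro B _ hB
      simp [counit_finsetElem, hB]
    · simp

theorem utHopf_counit_right (x : ⨁ n, scf F n) :
    TensorProduct.rid ℂ _ ((utHopf F).counit.lTensor _ ((utHopf F).comul x)) = x := by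
  induction x using finsetElem_induction with
  | h0 => simp
  | hadd x x' h h' => simp only [map_add, h, h']
  | hsmul c x h => simp only [map_smul, h]
  | h τ A =>
    rw [comul_finsetElem, map_sum, map_sum, Finset.sum_eq_single A]
    · simp [counit_finsetElem, edgeWeight_empty_right]
    · intro B hB hne
      have : ¬ A ⊆ B := fun h => hne ((Finset.mem_powerset.1 hB).antisymm h)
      simp [counit_finsetElem, this]
    · simp

theorem utHopf_counit_mul (x y : ⨁ n, scf F n) :
    (utHopf F).counit ((utHopf F).mul x y) = (utHopf F).counit x * (utHopf F).counit y := by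
  induction x using utHopf_induction with
  | h0 => simp
  | hadd x x' h h' => simp only [map_add, LinearMap.add_apply, h, h', add_mul]
  | hsmul c x h =>
    rw [map_smul, map_smul, LinearMap.smul_apply, map_smul, h, smul_eq_mul, smul_eq_mul, mul_assoc]
  | h k γ =>
    induction y using utHopf_induction with
    | h0 => simp
    | hadd x x' h h' => simp only [map_add, h, h', mul_add]
    | hsmul c x h =>
      rw [map_smul, map_smul, h, map_smul, smul_eq_mul, smul_eq_mul, mul_left_comm]
    | h l σ =>
      obtain ⟨τ, A, B, hA, hB, hAB⟩ := exists_finsetElem_pair (F := F) γ σ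
      change (utHopf F).counit ((utHopf F).mul (patternElem F γ) (patternElem F σ)) =
        (utHopf F).counit (patternElem F γ) * (utHopf F).counit (patternElem F σ)
      rw [hA, hB, mul_finsetElem' hAB, counit_finsetElem, counit_finsetElem, counit_finsetElem]
      simp only [Finset.union_eq_empty, ite_and]
      split_ifs <;> simp

/-- Both sides run over the decompositions of `A` into three parts `C`, `B \ C`, `A \ B`. The
weights agree because `edgeWeight` is multiplicative in each argument: either way they count the
edges that ascend from an earlier part to a later one. -/
theorem utHopf_coassoc (x : ⨁ n, scf F n) :
    TensorProduct.assoc ℂ _ _ _ ((utHopf F).comul.rTensor _ ((utHopf F).comul x)) =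
      (utHopf F).comul.lTensor _ ((utHopf F).comul x) := by
  induction x using finsetElem_induction with
  | h0 => simp
  | hadd x x' h h' => simp only [map_add, h, h']
  | hsmul c x h => simp only [map_smul, h]
  | h τ A =>
    simp only [comul_finsetElem, map_sum, map_smul, LinearMap.rTensor_tmul,
      LinearMap.lTensor_tmul, TensorProduct.sum_tmul, TensorProduct.tmul_sum,
      ← TensorProduct.smul_tmul', TensorProduct.tmul_smul, TensorProduct.assoc_tmul,
      Finset.smul_sum, smul_smul]
    rw [Finset.sum_sigma', Finset.sum_sigma']
    refine Finset.sum_bij' (fun p _ => ⟨p.2, p.1 \ p.2⟩) (fun p _ => ⟨p.1 ∪ p.2, p.1⟩) ?_ ?_ ?_ ?_ ?_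
    · rintro ⟨B, C⟩ h
      simp only [Finset.mem_sigma, Finset.mem_powerset] at h ⊢
      exact ⟨h.2.trans h.1, Finset.sdiff_subset_sdiff h.1 subset_rfl⟩
    · rintro ⟨C, D⟩ h
      simp only [Finset.mem_sigma, Finset.mem_powerset] at h ⊢
      exact ⟨Finset.union_subset h.1 (h.2.trans Finset.sdiff_subset), Finset.subset_union_left⟩
    · rintro ⟨B, C⟩ h
      simp only [Finset.mem_sigma, Finset.mem_powerset] at h
      simp only [Finset.union_sdiff_of_subset h.2]
    · rintro ⟨C, D⟩ h
      simp only [Finset.mem_sigma, Finset.mem_powerset] at h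
      have : Disjoint C D := Finset.disjoint_of_subset_right h.2 Finset.disjoint_sdiff
      simp only [Finset.union_sdiff_cancel_left this]
    · rintro ⟨B, C⟩ h
      simp only [Finset.mem_sigma, Finset.mem_powerset] at h
      have h1 : (A \ C) \ (B \ C) = A \ B := by
        ext a
        simp only [Finset.mem_sdiff]
        have := @h.2 a
        tauto
      have h2 : A \ C = (B \ C) ∪ (A \ B) := by
        ext a
        simp only [Finset.mem_sdiff, Finset.mem_union]
        have := @h.2 a
        have := @h.1 a
        tauto
      have h3 : Disjoint (B \ C) (A \ B) :=
        Finset.disjoint_of_subset_left Finset.sdiff_subset Finset.disjoint_sdiff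
      have h4 : edgeWeight F τ B (A \ B) =
          edgeWeight F τ C (A \ B) * edgeWeight F τ (B \ C) (A \ B) := by
        rw [← edgeWeight_union_left τ Finset.disjoint_sdiff, Finset.union_sdiff_of_subset h.2]
      simp only [h1]
      rw [h4, h2, edgeWeight_union_right τ h3]
      congr 1
      ring

/-- A subset of `A ∪ B` is a pair of subsets of `A` and of `B`. There are no edges between `A` and
`B`, so the mixed weights are `1`, and the parts multiply to their unions. -/
theorem utHopf_comul_mul (x y : ⨁ n, scf F n) :
    (utHopf F).comul ((utHopf F).mul x y) =
      (utHopf F).mulTensor ((utHopf F).comul x) ((utHopf F).comul y) := by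
  induction x using utHopf_induction with
  | h0 => simp [HopfData.mulTensor]
  | hadd x x' h h' =>
    simp only [map_add, LinearMap.add_apply, h, h', HopfData.mulTensor, TensorProduct.add_tmul]
  | hsmul c x h =>
    simp only [map_smul, LinearMap.smul_apply, h, HopfData.mulTensor, ← TensorProduct.smul_tmul']
  | h k γ =>
    induction y using utHopf_induction with
    | h0 => simp [HopfData.mulTensor]
    | hadd x x' h h' =>
      simp only [map_add, h, h', HopfData.mulTensor, TensorProduct.tmul_add]
    | hsmul c x h =>
      simp only [map_smul, h, HopfData.mulTensor, TensorProduct.tmul_smul]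
    | h l σ =>
      obtain ⟨τ, A, B, hA, hB, hAB⟩ := exists_finsetElem_pair (F := F) γ σ
      change (utHopf F).comul ((utHopf F).mul (patternElem F γ) (patternElem F σ)) =
        (utHopf F).mulTensor ((utHopf F).comul (patternElem F γ))
          ((utHopf F).comul (patternElem F σ))
      have hdis : Disjoint A B := by
        rw [Finset.disjoint_left]
        exact fun a ha hb => lt_irrefl a (hAB a ha a hb).1
      rw [hA, hB, mul_finsetElem' hAB, comul_finsetElem, comul_finsetElem, comul_finsetElem,
        mulTensor_sum]
      symm
      refine Finset.sum_bij' (fun p _ => p.1 ∪ p.2) (fun C _ => (C ∩ A, C ∩ B)) ?_ ?_ ?_ ?_ ?_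
      · rintro ⟨C, D⟩ h
        simp only [Finset.mem_product, Finset.mem_powerset] at h ⊢
        exact Finset.union_subset_union h.1 h.2
      · intro C _
        simp only [Finset.mem_product, Finset.mem_powerset]
        exact ⟨Finset.inter_subset_right, Finset.inter_subset_right⟩
      · rintro ⟨C, D⟩ h
        simp only [Finset.mem_product, Finset.mem_powerset] at h
        rw [Finset.disjoint_left] at hdis
        refine Prod.ext (Finset.ext fun a => ?_) (Finset.ext fun a => ?_) <;>
        · simp only [Finset.mem_inter, Finset.mem_union]
          have := @h.1 a
          have := @h.2 a
          have := @hdis a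
          tauto
      · intro C h
        rw [Finset.mem_powerset] at h
        rw [← Finset.inter_union_distrib_left, Finset.inter_eq_left.2 h]
      · rintro ⟨C, D⟩ h
        simp only [Finset.mem_product, Finset.mem_powerset] at h
        have h1 : (A ∪ B) \ (C ∪ D) = (A \ C) ∪ (B \ D) := by
          rw [Finset.disjoint_left] at hdis
          ext a
          simp only [Finset.mem_sdiff, Finset.mem_union]
          have := @h.1 a
          have := @h.2 a
          have := @hdis a
          tauto
        have h2 : ∀ {C' D'}, C' ⊆ A → D' ⊆ B → Disjoint C' D' := fun h h' =>
          Finset.disjoint_of_subset_left h (Finset.disjoint_of_subset_right h' hdis)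
        have h3 : ∀ {C' D'}, C' ⊆ A → D' ⊆ B → ∀ a ∈ C', ∀ b ∈ D', a < b ∧ ¬ τ.val.Adj a b :=
          fun h h' a ha b hb => hAB a (h ha) b (h' hb)
        have hC : A \ C ⊆ A := Finset.sdiff_subset
        have hD : B \ D ⊆ B := Finset.sdiff_subset
        simp only [h1]
        rw [edgeWeight_union_left τ (h2 h.1 h.2), edgeWeight_union_right τ (h2 hC hD),
          edgeWeight_union_right τ (h2 hC hD),
          edgeWeight_eq_one τ (A := C) (B := B \ D) fun a ha b hb => (h3 h.1 hD a ha b hb).2,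
          edgeWeight_eq_one τ (A := D) (B := A \ C) fun a ha b hb hab =>
            (h3 hC h.2 b hb a ha).2 hab.symm, mul_one, one_mul,
          ← mul_finsetElem' (h3 h.1 h.2), ← mul_finsetElem' (h3 hC hD)]
        simp only [HopfData.mulTensor, TensorProduct.tmul_smul, ← TensorProduct.smul_tmul',
          map_smul, smul_smul, TensorProduct.tensorTensorTensorComm_tmul, TensorProduct.map_tmul,
          TensorProduct.lift.tmul]
        rw [mul_comm]

theorem utHopf_one_mem : (utHopf F).one ∈ homog (fun n => scf F n) 0 := ⟨_, rfl⟩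

theorem utHopf_connected : Module.finrank ℂ (homog (fun n => scf F n) 0) = 1 := by
  refine finrank_eq_one (⟨(utHopf F).one, utHopf_one_mem⟩ : homog (fun n => scf F n) 0) ?_ ?_
  · intro h
    have h1 : (utHopf F).one = 0 := congrArg Subtype.val h
    have h2 := utHopf_counit_one (F := F)
    rw [h1, map_zero] at h2
    exact zero_ne_one h2
  · rintro ⟨_, φ, rfl⟩
    refine ⟨φ.val 1, Subtype.ext ?_⟩
    change φ.val 1 • DirectSum.lof ℂ ℕ (fun n => scf F n) 0 _ =
      DirectSum.lof ℂ ℕ (fun n => scf F n) 0 φ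
    rw [← map_smul]
    congr 1
    refine Subtype.ext (funext fun u => ?_)
    have hu : u = 1 := Subtype.ext (Units.ext (Subsingleton.elim _ _))
    subst hu
    exact mul_one (φ.val 1)

variable (F) in
theorem utHopf_isHopf : (utHopf F).IsHopf :=
  HopfData.IsBialgebra.isHopf
    { mul_assoc := utHopf_mul_assoc
      one_mul := utHopf_one_mul
      mul_one := utHopf_mul_one
      coassoc := utHopf_coassoc
      counit_left := utHopf_counit_left
      counit_right := utHopf_counit_right
      comul_one := utHopf_comul_one
      comul_mul := utHopf_comul_mul
      counit_one := utHopf_counit_one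
      counit_mul := utHopf_counit_mul
      one_mem := utHopf_one_mem
      mul_mem := utHopf_mul_mem
      comul_mem := gradedComul_mem _
      counit_mem := fun _ hn => utHopf_counit_mem hn
      connected := utHopf_connected }

end UTAxioms

/-! ## Induction is a Hopf algebra homomorphism -/

section Induction

variable {F : Type*} [Field F] [Fintype F]
variable {k l n : ℕ}

theorem UT.apply_self (u : UT F n) (i : Fin n) : u.val.val i i = 1 := by
  by_contra hne
  refine lt_irrefl i (u.2 i i ?_)
  rwa [Matrix.sub_apply, Matrix.one_apply_eq, sub_ne_zero]

theorem UT.apply_of_lt (u : UT F n) {i j : Fin n} (h : j < i) : u.val.val i j = 0 := by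
  by_contra hne
  refine lt_asymm h (u.2 i j ?_)
  rwa [Matrix.sub_apply, Matrix.one_apply_ne h.ne', sub_zero]

/-- The entry `(i, j)` of `x (u - 1) x⁻¹` only involves entries of `u` at `(a, b)` with `i ≤ a < b ≤
j`. If `i` and `j` are adjacent, then so are `a` and `b` by the indifference property. -/
theorem inPattern_conj {γ : IndiffGraph n} {u : UT F n} (h : InPattern γ u) (x : UT F n) :
    InPattern γ (x * u * x⁻¹) := by
  intro i j hij
  rcases lt_trichotomy i j with hlt | rfl | hlt
  · have h1 : (x * u * x⁻¹).val.val = x.val.val * (u.val.val - 1) * (x⁻¹).val.val + 1 := by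
      have h2 : x.val.val * (x⁻¹).val.val = 1 := congrArg (fun g : UT F n => g.val.val)
        (mul_inv_cancel x)
      rw [mul_sub, sub_mul, mul_one, h2, sub_add_cancel]
      rfl
    rw [h1, Matrix.add_apply, Matrix.one_apply_ne hlt.ne, add_zero, Matrix.mul_apply]
    refine Finset.sum_eq_zero fun b _ => ?_
    rcases lt_or_ge j b with hb | hb
    · rw [UT.apply_of_lt _ hb, mul_zero]
    rw [Matrix.mul_apply, Finset.sum_eq_zero, zero_mul]
    intro a _
    rcases lt_or_ge a i with ha | ha
    · rw [UT.apply_of_lt _ ha, zero_mul]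
    by_cases hab : a < b
    · rw [Matrix.sub_apply, h a b (γ.property i j hlt hij a b ha hab hb),
        Matrix.one_apply_ne hab.ne, sub_zero, mul_zero]
    · by_contra hne
      exact hab (u.2 a b (right_ne_zero_of_mul hne))
  · exact (hij.ne rfl).elim
  · exact UT.apply_of_lt _ hlt

theorem inSuperclass_conj {γ : IndiffGraph n} {u : UT F n} (h : InSuperclass γ u) (x : UT F n) :
    InSuperclass γ (x * u * x⁻¹) := by
  refine ⟨inPattern_conj h.1 x, fun σ hσ hin => h.2 σ hσ ?_⟩
  have h1 := inPattern_conj hin x⁻¹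
  have h2 : x⁻¹ * (x * u * x⁻¹) * x⁻¹⁻¹ = u := by group
  rwa [h2] at h1

theorem scf_conj (φ : scf F n) (x u : UT F n) : φ.val (x * u * x⁻¹) = φ.val u := by
  obtain ⟨γ, hγ⟩ := exists_inSuperclass u
  exact φ.property γ _ _ (inSuperclass_conj hγ x) hγ

theorem extendByZero_conj (φ : scf F n) (x : GLn F n) (hx : x ∈ UT F n) (g : GLn F n) :
    extendByZero (UT F n) φ.val (x * g * x⁻¹) = extendByZero (UT F n) φ.val g := by
  unfold extendByZero
  by_cases hg : g ∈ UT F n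
  · have h : x * g * x⁻¹ ∈ UT F n :=
      (UT F n).mul_mem ((UT F n).mul_mem hx hg) ((UT F n).inv_mem hx)
    rw [dif_pos hg, dif_pos h]
    exact scf_conj φ ⟨x, hx⟩ ⟨g, hg⟩
  · have h : x * g * x⁻¹ ∉ UT F n := by
      intro h
      apply hg
      have h1 := (UT F n).mul_mem ((UT F n).mul_mem ((UT F n).inv_mem hx) h) hx
      have h2 : x⁻¹ * (x * g * x⁻¹) * x = g := by group
      rwa [h2] at h1
    rw [dif_neg hg, dif_neg h]

theorem extendByZero_val {G : Type*} [Group G] {K : Subgroup G} (φ : K → ℂ) (g : K) :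
    extendByZero K φ g.val = φ g := dif_pos g.2

theorem extendByZero_of_notMem {G : Type*} [Group G] {K : Subgroup G} (φ : K → ℂ) {g : G}
    (hg : g ∉ K) : extendByZero K φ g = 0 := dif_neg hg

theorem sum_extendByZero {G : Type*} [Group G] [Fintype G] (K : Subgroup G) (φ : K → ℂ) :
    ∑ g, extendByZero K φ g = ∑ g, φ g := by
  have h : ∑ g : K, φ g = ∑ g : K, extendByZero K φ g.val :=
    Finset.sum_congr rfl fun g _ => (extendByZero_val φ g).symm
  rw [h, ← Finset.sum_subtype (Finset.univ.filter (· ∈ K)) (by simp), Finset.sum_filter]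
  refine Finset.sum_congr rfl fun g _ => ?_
  split_ifs with hg
  · rfl
  · exact extendByZero_of_notMem φ hg

theorem relabel_blockUpper_mem_UT_iff (e : Fin k ↪o Fin n) (f : Fin l ↪o Fin n)
    (h : IsCompl (Set.range e) (Set.range f)) (a : GLn F k) (w : Matrix (Fin k) (Fin l) F)
    (b : GLn F l) : relabel (complEquiv e f h) (blockUpper a w b) ∈ UT F n ↔
      (a ∈ UT F k ∧ b ∈ UT F l) ∧ ∀ i j, ¬ e i < f j → w i j = 0 := by
  have happ : ∀ c d, (relabel (complEquiv e f h) (blockUpper a w b)).val (complEquiv e f h c)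
      (complEquiv e f h d) = fromBlocks a.val w 0 b.val c d := by
    intro c d
    simp
  constructor
  · intro hmem
    refine ⟨⟨fun i j hij => ?_, fun i j hij => ?_⟩, fun i j hij => ?_⟩
    · refine e.lt_iff_lt.1 (hmem (e i) (e j) ?_)
      have := happ (Sum.inl i) (Sum.inl j)
      simp only [complEquiv_inl, fromBlocks_apply₁₁] at this
      rw [Matrix.sub_apply, this]
      simpa [Matrix.one_apply] using hij
    · refine f.lt_iff_lt.1 (hmem (f i) (f j) ?_)
      have := happ (Sum.inr i) (Sum.inr j)
      simp only [complEquiv_inr, fromBlocks_apply₂₂] at this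
      rw [Matrix.sub_apply, this]
      simpa [Matrix.one_apply] using hij
    · by_contra hne
      refine hij (hmem (e i) (f j) ?_)
      have := happ (Sum.inl i) (Sum.inr j)
      simp only [complEquiv_inl, complEquiv_inr, fromBlocks_apply₁₂] at this
      have hef : e i ≠ f j := fun hij => Set.disjoint_left.1 h.disjoint ⟨i, rfl⟩ ⟨j, hij.symm⟩
      rwa [Matrix.sub_apply, this, Matrix.one_apply_ne hef, sub_zero]
  · rintro ⟨⟨ha, hb⟩, hw⟩
    have h1 : (relabel (complEquiv e f h) (blockUpper a w b)).val =
        blockMatrix e f h a.val b.val fun p => w p.1.1 p.1.2 := by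
      ext i j
      obtain ⟨i, rfl⟩ := (complEquiv e f h).surjective i
      obtain ⟨j, rfl⟩ := (complEquiv e f h).surjective j
      rw [happ, blockMatrix_apply]
      rcases i with i | i <;> rcases j with j | j
      · rfl
      · simp only [fromBlocks_apply₁₂, of_apply]
        split_ifs with hp
        · rfl
        · exact hw i j hp
      · rfl
      · rfl
    change IsUnitri _
    rw [h1]
    exact isUnitri_blockMatrix e f h ha hb _

/-- Restriction of a function on `UT_n` to the matrices with given diagonal blocks, extended by
zero to the general linear groups. -/
def extRes (e : Fin k ↪o Fin n) (f : Fin l ↪o Fin n) (φ : UT F n → ℂ) (a : GLn F k)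
    (b : GLn F l) : ℂ :=
  extendByZero (UT F k) (fun a => extendByZero (UT F l)
    (fun b => avg (fun u : UT F n => HasBlocks e f u.val.val a.val.val b.val.val) φ) b) a

/-- Only unitriangular matrices contribute. Those with diagonal blocks `a` and `b` are parametrized
by their free entries, so the sum is the number of choices times the average from the coproduct of
`scf(UT_•)`. -/
theorem sum_extendByZero_relabel (e : Fin k ↪o Fin n) (f : Fin l ↪o Fin n)
    (h : IsCompl (Set.range e) (Set.range f)) (φ : UT F n → ℂ) (a : GLn F k) (b : GLn F l) :
    ∑ w, extendByZero (UT F n) φ (relabel (complEquiv e f h) (blockUpper a w b)) =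
      Fintype.card (UpperPair e f → F) * extRes e f φ a b := by
  by_cases hab : a ∈ UT F k ∧ b ∈ UT F l
  · have hr : extRes e f φ a b = avg (fun u : UT F n => HasBlocks e f u.val.val a.val b.val) φ := by
      rw [extRes, extendByZero, dif_pos hab.1, extendByZero, dif_pos hab.2]
    rw [hr]
    have h2 := avg_hasBlocks e f h ⟨a, hab.1⟩ ⟨b, hab.2⟩ φ
    simp only at h2
    rw [h2, mul_inv_cancel_left₀ (Nat.cast_ne_zero.2 Fintype.card_ne_zero)]
    symm
    have hval : ∀ y : UpperPair e f → F, (utBlock e f h ⟨a, hab.1⟩ ⟨b, hab.2⟩ y).val =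
        relabel (complEquiv e f h) (blockUpper a
          (Matrix.of fun i j => if hp : e i < f j then y ⟨(i, j), hp⟩ else 0) b) :=
      fun y => Units.ext rfl
    refine Finset.sum_bij_ne_zero (fun y _ _ =>
      Matrix.of fun i j => if hp : e i < f j then y ⟨(i, j), hp⟩ else 0)
      (fun _ _ _ => Finset.mem_univ _) ?_ ?_ ?_
    · intro y _ _ y' _ _ hy
      refine utBlock_injective e f h ⟨a, hab.1⟩ ⟨b, hab.2⟩ (Subtype.ext ?_)
      rw [hval, hval, hy]
    · intro w _ hw
      have hmem : relabel (complEquiv e f h) (blockUpper a w b) ∈ UT F n := by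
        by_contra hne
        exact hw (extendByZero_of_notMem φ hne)
      have hw0 := ((relabel_blockUpper_mem_UT_iff e f h a w b).1 hmem).2
      have heq : (Matrix.of fun i j => if hp : e i < f j then w i j else 0) = w := by
        ext i j
        simp only [of_apply]
        split_ifs with hp
        · rfl
        · exact (hw0 i j hp).symm
      refine ⟨fun p => w p.1.1 p.1.2, Finset.mem_univ _, ?_, heq⟩
      rw [← extendByZero_val φ, hval, heq]
      exact hw
    · intro y _ _
      rw [← extendByZero_val φ, hval]
  · rw [Finset.sum_eq_zero]
    · have hr : extRes e f φ a b = 0 := by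
        rcases not_and_or.1 hab with ha | hb
        · exact extendByZero_of_notMem _ ha
        · unfold extRes extendByZero
          simp [hb]
      rw [hr, mul_zero]
    · intro w _
      refine extendByZero_of_notMem φ fun hmem => hab ?_
      exact ((relabel_blockUpper_mem_UT_iff e f h a w b).1 hmem).1

/-- Used to compute the denominator in the Mackey formula for the subgroup `UT_n`. -/
theorem sum_extRes_one (e : Fin k ↪o Fin n) (f : Fin l ↪o Fin n)
    (h : IsCompl (Set.range e) (Set.range f)) :
    ∑ a, ∑ b, extRes (F := F) e f (fun _ => 1) a b =
      Fintype.card (UT F k) * Fintype.card (UT F l) := by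
  have h1 : ∀ (a : UT F k) (b : UT F l),
      avg (fun u : UT F n => HasBlocks e f u.val.val a.val.val b.val.val) (fun _ => 1) = 1 := by
    intro a b
    rw [avg_hasBlocks e f h, Finset.sum_const, nsmul_eq_mul, mul_one, Finset.card_univ,
      inv_mul_cancel₀ (Nat.cast_ne_zero.2 Fintype.card_ne_zero)]
  have h2 : ∀ (a : GLn F k), ∑ b, extRes (F := F) e f (fun _ => 1) a b =
      extendByZero (UT F k) (fun _ => (Fintype.card (UT F l) : ℂ)) a := by
    intro a
    unfold extRes
    simp only [h1]
    by_cases ha : a ∈ UT F k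
    · have h3 : ∀ φ : UT F k → ℂ, extendByZero (UT F k) φ a = φ ⟨a, ha⟩ := fun φ => dif_pos ha
      simp only [h3]
      rw [sum_extendByZero]
      simp
    · have h3 : ∀ φ : UT F k → ℂ, extendByZero (UT F k) φ a = 0 := fun φ => dif_neg ha
      simp only [h3, Finset.sum_const_zero]
  simp only [h2]
  rw [sum_extendByZero]
  simp

theorem card_UT_ne_zero : (Fintype.card (UT F n) : ℂ) ≠ 0 :=
  Nat.cast_ne_zero.2 Fintype.card_ne_zero

theorem indUTGL_lof (φ : scf F n) : indUTGL F (DirectSum.lof ℂ ℕ (fun n => scf F n) n φ) =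
    DirectSum.lof ℂ ℕ (fun n => cf (GLn F n)) n (ind (UT F n) φ.val) :=
  DirectSum.toModule_lof ..

theorem evalGL_indUTGL {ι : Type} [Fintype ι] [DecidableEq ι] (e : ι ≃ Fin n)
    (g : GeneralLinearGroup ι F) (φ : scf F n) :
    evalGL g (indUTGL F (DirectSum.lof ℂ ℕ (fun n => scf F n) n φ)) =
      (Fintype.card (UT F n) : ℂ)⁻¹ * conjSum (extendByZero (UT F n) φ.val) (relabel e g) := by
  rw [indUTGL_lof, evalGL_lof e]
  rfl

theorem indUTGL_mem (n : ℕ) :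
    ∀ x ∈ homog (fun n => scf F n) n, indUTGL F x ∈ homog (fun n => cf (GLn F n)) n := by
  rintro _ ⟨φ, rfl⟩
  exact ⟨ind (UT F n) φ.val, (indUTGL_lof φ).symm⟩

theorem evalGL_indUTGL_zero (g : GLn F 0) (φ : scf F 0) :
    evalGL g (indUTGL F (DirectSum.lof ℂ ℕ (fun n => scf F n) 0 φ)) = φ.val 1 := by
  have h1 : ∀ g : GLn F 0, extendByZero (UT F 0) φ.val g = φ.val 1 := by
    intro g
    have : g = (1 : UT F 0).val := Units.ext (Subsingleton.elim _ _)
    rw [this, extendByZero_val]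
  have h2 : Fintype.card (UT F 0) = 1 :=
    Fintype.card_eq_one_iff.2 ⟨1, fun u => Subtype.ext (Units.ext (Subsingleton.elim _ _))⟩
  rw [evalGL_indUTGL (Equiv.refl _), conjSum]
  simp only [h1, h2, Finset.sum_const, Finset.card_univ, card_GL_isEmpty]
  simp

theorem indUTGL_one : indUTGL F (utHopf F).one = (glHopf F).one := by
  refine ext_of_mem_homog (ι := Fin 0) (by simp) _ _ (indUTGL_mem 0 _ utHopf_one_mem)
    glHopf_one_mem fun g => ?_
  have hg : g = 1 := Units.ext (Subsingleton.elim _ _)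
  subst hg
  rw [evalGL_one]
  exact evalGL_indUTGL_zero _ _

theorem counit_indUTGL (x : ⨁ n, scf F n) :
    (glHopf F).counit (indUTGL F x) = (utHopf F).counit x := by
  induction x using homog_induction with
  | h0 => simp
  | hadd x y hx hy => simp only [map_add, hx, hy]
  | h n x hx =>
    rcases Nat.eq_zero_or_pos n with rfl | hn
    · obtain ⟨φ, rfl⟩ := hx
      rw [glHopf_counit, evalGL_indUTGL_zero, utHopf_counit_lof_zero]
    · rw [utHopf_counit_mem hn.ne' x hx, glHopf_counit_mem n hn.ne' _ (indUTGL_mem n x hx)]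

/-- The group `UT_(k+l)` is the preimage of `UT_k × UT_l` in the block upper triangular group, so
inflation and extension by zero commute. -/
theorem extendByZero_utMul (φ : scf F k) (ψ : scf F l) :
    (fun g => extendByZero (UT F (k + l)) (utMul F k l φ ψ).val
      (relabel (complEquiv _ _ (isCompl_firstEmb_lastEmb rfl)) g)) =
      infl fun a b => extendByZero (UT F k) φ.val a * extendByZero (UT F l) ψ.val b := by
  refine eq_infl _ _ (fun a w b => ?_) fun g hg => ?_
  · have hlt : ∀ i j, ¬ firstEmb (rfl : k + l = k + l) i < lastEmb rfl j → w i j = 0 := by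
      intro i j hij
      refine absurd (Fin.lt_def.2 ?_) hij
      change (i : ℕ) < k + j
      omega
    have hmem := relabel_blockUpper_mem_UT_iff _ _
      (isCompl_firstEmb_lastEmb (rfl : k + l = k + l)) a w b
    by_cases hab : a ∈ UT F k ∧ b ∈ UT F l
    · have hm := hmem.2 ⟨hab, hlt⟩
      rw [extendByZero, dif_pos hm, extendByZero, dif_pos hab.1, extendByZero, dif_pos hab.2]
      change φ.val _ * ψ.val _ = _
      refine congrArg₂ (fun x y => φ.val x * ψ.val y) (Subtype.ext (Units.ext ?_))
        (Subtype.ext (Units.ext ?_))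
      · exact ((hasBlocks_relabel_iff _ _ (isCompl_firstEmb_lastEmb (rfl : k + l = k + l))
          (blockUpper a w b) a b).2 ⟨w, rfl⟩).1
      · exact ((hasBlocks_relabel_iff _ _ (isCompl_firstEmb_lastEmb (rfl : k + l = k + l))
          (blockUpper a w b) a b).2 ⟨w, rfl⟩).2.1
    · rw [extendByZero_of_notMem _ fun hm => hab (hmem.1 hm).1]
      rcases not_and_or.1 hab with ha | hb
      · rw [extendByZero_of_notMem _ ha, zero_mul]
      · rw [extendByZero_of_notMem _ hb, mul_zero]
  · refine extendByZero_of_notMem _ fun hmem => hg (exists_blockUpper g ?_)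
    ext i j
    have h1 := UT.apply_of_lt ⟨_, hmem⟩ (i := lastEmb (rfl : k + l = k + l) i)
      (j := firstEmb rfl j) (Fin.lt_def.2 (by change (j : ℕ) < k + i; omega))
    rw [← complEquiv_inl _ _ (isCompl_firstEmb_lastEmb (rfl : k + l = k + l)),
      ← complEquiv_inr _ _ (isCompl_firstEmb_lastEmb (rfl : k + l = k + l))] at h1
    simp only [relabel_val, Matrix.submatrix_apply, Equiv.symm_apply_apply] at h1
    exact h1

/-- Obtained by summing `extendByZero_utMul` for the constant functions `1` over the whole group. -/
theorem card_UT_add : (Fintype.card (UT F (k + l)) : ℂ) =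
    Fintype.card (UT F k) * Fintype.card (UT F l) * (Fintype.card F : ℂ) ^ (k * l) := by
  have h1 := sum_extendByZero_relabel (F := F) _ _
    (isCompl_firstEmb_lastEmb (rfl : k + l = k + l)) fun _ => 1
  have hlt : ∀ (i : Fin k) (j : Fin l), firstEmb (rfl : k + l = k + l) i < lastEmb rfl j :=
    fun i j => Fin.lt_def.2 (by change (i : ℕ) < k + j; omega)
  let one : ∀ n, scf F n := fun n => ⟨fun _ => 1, fun _ _ _ _ _ => rfl⟩
  have h2 := extendByZero_utMul (one k) (one l)
  have h3 : (utMul F k l (one k) (one l)).val = fun _ => 1 := funext fun _ => mul_one 1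
  rw [h3] at h2
  have h4 : ∑ g, extendByZero (UT F (k + l)) (fun _ => (1 : ℂ)) g =
      ∑ g, infl (fun a b => extendByZero (UT F k) (one k).val a *
        extendByZero (UT F l) (one l).val b) g := by
    rw [← h2, ← (relabel (complEquiv _ _
      (isCompl_firstEmb_lastEmb (rfl : k + l = k + l)))).toEquiv.sum_comp]
    rfl
  rw [sum_extendByZero, sum_eq_sum_blockUpper _ (infl_eq_zero _)] at h4
  simp only [infl_blockUpper, Finset.sum_const, Finset.card_univ, nsmul_eq_mul, mul_one,
    card_matrix_eq, ← Finset.mul_sum, ← Finset.sum_mul, sum_extendByZero, one,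
    Fintype.card_fin] at h4
  rw [h4]
  ring

/-- Transitivity of induction: inducing an inflated function from `UT_(k+l)` equals inducing each
factor first, then inflating and inducing from the parabolic subgroup. The rest is cancellation of
group orders. -/
theorem indUTGL_mul (x y : ⨁ n, scf F n) :
    indUTGL F ((utHopf F).mul x y) = (glHopf F).mul (indUTGL F x) (indUTGL F y) := by
  induction x using homog_induction with
  | h0 => simp
  | hadd x x' hx hx' => simp only [map_add, LinearMap.add_apply, hx, hx']
  | h k x hx =>
    induction y using homog_induction with
    | h0 => simp
    | hadd y y' hy hy' => simp only [map_add, hy, hy']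
    | h l y hy =>
      refine ext_of_mem_homog (ι := Fin k ⊕ Fin l) (by simp) _ _
        (indUTGL_mem _ _ (utHopf_mul_mem k l x hx y hy))
        (glHopf_mul_mem k l _ (indUTGL_mem k x hx) _ (indUTGL_mem l y hy)) fun g => ?_
      rw [evalGL_mul (Fintype.card_fin k) (Fintype.card_fin l) _ _ (indUTGL_mem k x hx)
        (indUTGL_mem l y hy)]
      obtain ⟨φ, rfl⟩ := hx
      obtain ⟨ψ, rfl⟩ := hy
      have h1 : (utHopf F).mul (DirectSum.lof ℂ ℕ (fun n => scf F n) k φ)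
          (DirectSum.lof ℂ ℕ (fun n => scf F n) l ψ) = DirectSum.lof ℂ ℕ (fun n => scf F n) (k + l)
            (utMul F k l φ ψ) := gradedMul_lof (V := fun n => scf F n) (utMul F) k l φ ψ
      rw [h1, evalGL_indUTGL (complEquiv _ _ (isCompl_firstEmb_lastEmb rfl)), conjSum_mulEquiv,
        extendByZero_utMul]
      have h2 : (infl fun a b =>
          evalGL a (indUTGL F (DirectSum.lof ℂ ℕ (fun n => scf F n) k φ)) *
            evalGL b (indUTGL F (DirectSum.lof ℂ ℕ (fun n => scf F n) l ψ))) =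
          fun g => ((Fintype.card (UT F k) : ℂ)⁻¹ * (Fintype.card (UT F l) : ℂ)⁻¹) *
            infl (fun a b => ∑ x, ∑ y, extendByZero (UT F k) φ.val (x * a * x⁻¹) *
              extendByZero (UT F l) ψ.val (y * b * y⁻¹)) g := by
        rw [← infl_mul_left]
        congr 1
        funext a b
        rw [evalGL_indUTGL (Equiv.refl _), evalGL_indUTGL (Equiv.refl _), ← Finset.sum_mul_sum]
        change _ * (∑ x, _) * (_ * ∑ x, _) = _
        exact mul_mul_mul_comm _ _ _ _
      rw [h2, conjSum_mul_left, conjSum_infl_conjSum (fun a b =>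
        extendByZero (UT F k) φ.val a * extendByZero (UT F l) ψ.val b), card_UT_add, parCard]
      have := card_UT_ne_zero (F := F) (n := k)
      have := card_UT_ne_zero (F := F) (n := l)
      have := card_GL_ne_zero (F := F) (ι := Fin k)
      have := card_GL_ne_zero (F := F) (ι := Fin l)
      have := card_ne_zero' (F := F)
      simp only [Fintype.card_fin]
      field_simp

end Induction

/-! ### Compatibility of induction with the coproducts -/

section InductionComul

variable {F : Type*} [Field F] [Fintype F]
variable {k l n : ℕ}

variable (F) in
/-- Evaluation at an element of `GL_n` of the extension by zero, on `scf(UT_n)`. -/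
def extEval (g : GLn F n) : scf F n →ₗ[ℂ] ℂ :=
  if h : g ∈ UT F n then LinearMap.proj ⟨g, h⟩ ∘ₗ (scf F n).subtype else 0

theorem extEval_apply (g : GLn F n) (φ : scf F n) :
    extEval F g φ = extendByZero (UT F n) φ.val g := by
  unfold extEval extendByZero
  split_ifs <;> rfl

/-- The tensor has the right values only if the restricted function is constant on products of
superclasses. By linearity this is needed for pattern indicators alone, whose coproduct is explicit.
-/
theorem tensorEval_utComul (h : k + l = n) (φ : scf F n) (a : UT F k) (b : UT F l) :
    tensorEval (LinearMap.proj a ∘ₗ (scf F k).subtype) (LinearMap.proj b ∘ₗ (scf F l).subtype)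
      (utComul F k l n h φ) = utRes F k l n φ.val a b := by
  have hlin : tensorEval (LinearMap.proj a ∘ₗ (scf F k).subtype)
      (LinearMap.proj b ∘ₗ (scf F l).subtype) ∘ₗ utComul F k l n h =
      (LinearMap.proj b ∘ₗ LinearMap.proj (φ := fun _ : UT F k => UT F l → ℂ) a) ∘ₗ
        utRes F k l n ∘ₗ (scf F n).subtype := by
    refine LinearMap.ext_on (span_patternIndicator (F := F) (n := n)) ?_
    rintro _ ⟨γ, rfl⟩
    simp only [LinearMap.comp_apply, utComul_patternIndicator, map_sum, utRes, LinearMap.pi_apply,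
      LinearMap.proj_apply, LinearMap.sum_apply, Submodule.subtype_apply]
    refine Finset.sum_congr rfl fun e _ => Finset.sum_congr rfl fun f _ => ?_
    split_ifs with hc
    · rw [map_smul, tensorEval_tmul, avg_patternIndicator e f hc]
      rfl
    · rw [map_zero]
      rfl
  exact LinearMap.congr_fun hlin φ

/-- The compositions of `Fin n` into parts of sizes `k` and `l`. -/
abbrev TwoPartsOfCard (k l n : ℕ) : Type :=
  {p : (Fin k ↪o Fin n) × (Fin l ↪o Fin n) // IsCompl (Set.range p.1) (Set.range p.2)}

theorem utRes_eq_sum (φ : UT F n → ℂ) (a : UT F k) (b : UT F l) :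
    utRes F k l n φ a b = ∑ p : TwoPartsOfCard k l n, extRes p.1.1 p.1.2 φ a.val b.val := by
  have h1 : ∀ p : TwoPartsOfCard k l n, extRes p.1.1 p.1.2 φ a.val b.val =
      avg (fun u : UT F n => HasBlocks p.1.1 p.1.2 u.val.val a.val.val b.val.val) φ := by
    intro p
    rw [extRes, extendByZero_val, extendByZero_val]
  simp only [h1]
  rw [← Finset.sum_subtype (Finset.univ.filter fun p : (Fin k ↪o Fin n) × (Fin l ↪o Fin n) =>
      IsCompl (Set.range p.1) (Set.range p.2)) (by simp) fun p =>
      avg (fun u : UT F n => HasBlocks p.1 p.2 u.val.val a.val.val b.val.val) φ,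
    Finset.sum_filter, Fintype.sum_prod_type]
  simp only [utRes, LinearMap.pi_apply, LinearMap.sum_apply]
  refine Finset.sum_congr rfl fun e _ => Finset.sum_congr rfl fun f _ => ?_
  split_ifs <;> rfl

theorem extRes_of_notMem_left (e : Fin k ↪o Fin n) (f : Fin l ↪o Fin n) (φ : UT F n → ℂ)
    {a : GLn F k} (ha : a ∉ UT F k) (b : GLn F l) : extRes e f φ a b = 0 :=
  extendByZero_of_notMem _ ha

theorem extRes_of_notMem_right (e : Fin k ↪o Fin n) (f : Fin l ↪o Fin n) (φ : UT F n → ℂ)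
    (a : GLn F k) {b : GLn F l} (hb : b ∉ UT F l) : extRes e f φ a b = 0 := by
  unfold extRes extendByZero
  simp [hb]

theorem tensorEval_extEval_utComul (h : k + l = n) (φ : scf F n) (a : GLn F k) (b : GLn F l) :
    tensorEval (extEval F a) (extEval F b) (utComul F k l n h φ) =
      ∑ p : TwoPartsOfCard k l n, extRes p.1.1 p.1.2 φ.val a b := by
  by_cases ha : a ∈ UT F k
  · by_cases hb : b ∈ UT F l
    · rw [extEval, extEval, dif_pos ha, dif_pos hb, tensorEval_utComul, utRes_eq_sum]
    · rw [extEval, extEval, dif_neg hb, tensorEval_zero_right]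
      exact (Finset.sum_eq_zero fun p _ => extRes_of_notMem_right _ _ _ _ hb).symm
  · rw [extEval, dif_neg ha, tensorEval_zero_left]
    exact (Finset.sum_eq_zero fun p _ => extRes_of_notMem_left _ _ _ ha _).symm

theorem evalGL_comp_indUTGL_lof (g : GLn F n) :
    evalGL g ∘ₗ indUTGL F ∘ₗ DirectSum.lof ℂ ℕ (fun n => scf F n) n =
      (Fintype.card (UT F n) : ℂ)⁻¹ • ∑ x : GLn F n, extEval F (x * g * x⁻¹) := by
  refine LinearMap.ext fun φ => ?_
  simp only [LinearMap.comp_apply, LinearMap.smul_apply, LinearMap.sum_apply, extEval_apply]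
  rw [evalGL_indUTGL (Equiv.refl _)]
  rfl

theorem evalGL_comp_indUTGL_lof_of_ne {m : ℕ} (g : GLn F m) (h : m ≠ n) :
    evalGL g ∘ₗ indUTGL F ∘ₗ DirectSum.lof ℂ ℕ (fun n => scf F n) n = 0 := by
  refine LinearMap.ext fun φ => ?_
  exact evalGL_of_mem (by simpa using h) _ _ (indUTGL_mem n _ ⟨φ, rfl⟩)

theorem evalGL₂_map_indUTGL_map_lof {r s : ℕ} (a : GLn F k) (b : GLn F l)
    (t : scf F r ⊗[ℂ] scf F s) :
    evalGL₂ a b (TensorProduct.map (indUTGL F) (indUTGL F)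
      (TensorProduct.map (DirectSum.lof ℂ ℕ (fun n => scf F n) r)
        (DirectSum.lof ℂ ℕ (fun n => scf F n) s) t)) =
      tensorEval (evalGL a ∘ₗ indUTGL F ∘ₗ DirectSum.lof ℂ ℕ (fun n => scf F n) r)
        (evalGL b ∘ₗ indUTGL F ∘ₗ DirectSum.lof ℂ ℕ (fun n => scf F n) s) t := by
  rw [tensorEval_map, tensorEval_map]
  rfl

theorem evalGL₂_map_indUTGL_utComul (h : k + l = n) (φ : scf F n) (a : GLn F k) (b : GLn F l) :
    tensorEval (evalGL a ∘ₗ indUTGL F ∘ₗ DirectSum.lof ℂ ℕ (fun n => scf F n) k)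
      (evalGL b ∘ₗ indUTGL F ∘ₗ DirectSum.lof ℂ ℕ (fun n => scf F n) l)
      (utComul F k l n h φ) =
      (Fintype.card (UT F k) : ℂ)⁻¹ * (Fintype.card (UT F l) : ℂ)⁻¹ *
        ∑ x : GLn F k, ∑ y : GLn F l, ∑ p : TwoPartsOfCard k l n,
          extRes p.1.1 p.1.2 φ.val (x * a * x⁻¹) (y * b * y⁻¹) := by
  rw [evalGL_comp_indUTGL_lof, evalGL_comp_indUTGL_lof, tensorEval_smul_sum_left, mul_assoc]
  refine congrArg _ ?_
  rw [Finset.mul_sum]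
  refine Finset.sum_congr rfl fun x _ => ?_
  rw [tensorEval_smul_sum_right]
  simp only [tensorEval_extEval_utComul]

theorem evalGL₂_map_indUTGL (h : k + l = n) (φ : scf F n) (a : GLn F k) (b : GLn F l) :
    evalGL₂ a b (TensorProduct.map (indUTGL F) (indUTGL F)
      ((utHopf F).comul (DirectSum.lof ℂ ℕ (fun n => scf F n) n φ))) =
      (Fintype.card (UT F k) : ℂ)⁻¹ * (Fintype.card (UT F l) : ℂ)⁻¹ *
        ∑ x : GLn F k, ∑ y : GLn F l, ∑ p : TwoPartsOfCard k l n,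
          extRes p.1.1 p.1.2 φ.val (x * a * x⁻¹) (y * b * y⁻¹) := by
  have h1 : (utHopf F).comul (DirectSum.lof ℂ ℕ (fun n => scf F n) n φ) = _ :=
    gradedComul_lof (V := fun n => scf F n) (utComul F) n φ
  rw [h1, map_sum, map_sum, Finset.sum_eq_single ⟨(k, l), by simpa using h⟩]
  · exact (evalGL₂_map_indUTGL_map_lof a b _).trans (evalGL₂_map_indUTGL_utComul h φ a b)
  · rintro ⟨⟨r, s⟩, hp⟩ - hne
    rw [evalGL₂_map_indUTGL_map_lof]
    by_cases hk : k = r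
    · have hl : l ≠ s := by
        rintro rfl
        subst hk
        exact hne rfl
      rw [evalGL_comp_indUTGL_lof_of_ne b hl, tensorEval_zero_right]
      rfl
    · rw [evalGL_comp_indUTGL_lof_of_ne a hk, tensorEval_zero_left]
      rfl
  · intro h
    exact absurd (Finset.mem_attach _ _) h

theorem evalGL₂_map_indUTGL_of_ne (h : k + l ≠ n) (φ : scf F n) (a : GLn F k) (b : GLn F l) :
    evalGL₂ a b (TensorProduct.map (indUTGL F) (indUTGL F)
      ((utHopf F).comul (DirectSum.lof ℂ ℕ (fun n => scf F n) n φ))) = 0 := by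
  have h1 : (utHopf F).comul (DirectSum.lof ℂ ℕ (fun n => scf F n) n φ) = _ :=
    gradedComul_lof (V := fun n => scf F n) (utComul F) n φ
  rw [h1, map_sum, map_sum]
  refine Finset.sum_eq_zero ?_
  rintro ⟨⟨r, s⟩, hp⟩ -
  replace hp : r + s = n := Finset.HasAntidiagonal.mem_antidiagonal.1 hp
  rw [evalGL₂_map_indUTGL_map_lof]
  by_cases hk : k = r
  · rw [evalGL_comp_indUTGL_lof_of_ne b (by omega : l ≠ s), tensorEval_zero_right]
    rfl
  · rw [evalGL_comp_indUTGL_lof_of_ne a hk, tensorEval_zero_left]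
    rfl

/-- Elimination by `UT_n` yields a set `A` of `k` pivot rows; the double coset is then given by `A`
and its complement. -/
theorem exists_twoParts (h : k + l = n) (s₀ : Fin k ⊕ Fin l ≃ Fin n) (g : GLn F n) :
    ∃ p : TwoPartsOfCard k l n, ∃ u ∈ UT F n, ∀ a b,
      (u * g).val (complEquiv p.1.1 p.1.2 p.2 (Sum.inr a)) (s₀ (Sum.inl b)) = 0 := by
  obtain ⟨u, hu, A, hA, hzero⟩ := exists_mul_support n g
    (Finset.univ.map ⟨fun b => s₀ (Sum.inl b), s₀.injective.comp Sum.inl_injective⟩)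
  rw [Finset.card_map, Finset.card_univ, Fintype.card_fin] at hA
  have hA' : Aᶜ.card = l := by
    rw [Finset.card_compl, hA, Fintype.card_fin]
    omega
  refine ⟨⟨(A.orderEmbOfFin hA, Aᶜ.orderEmbOfFin hA'), ?_⟩, u, hu, fun a b => ?_⟩
  · simp only [Finset.range_orderEmbOfFin]
    rw [Finset.coe_compl]
    exact isCompl_compl
  · refine hzero _ ?_ _ (Finset.mem_map.2 ⟨b, Finset.mem_univ _, rfl⟩)
    exact Finset.mem_compl.1 (Finset.orderEmbOfFin_mem Aᶜ hA' a)

/-- The diagonal entries of `u` are `1`, so the range of `e'` cannot meet that of `f`. It is thus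
contained in the range of `e`, which has the same size. -/
theorem twoParts_unique (p p' : TwoPartsOfCard k l n) (u : UT F n)
    (h : ∀ a b, u.val.val (complEquiv p.1.1 p.1.2 p.2 (Sum.inr a))
      (complEquiv p'.1.1 p'.1.2 p'.2 (Sum.inl b)) = 0) : p = p' := by
  obtain ⟨⟨e, f⟩, hp⟩ := p
  obtain ⟨⟨e', f'⟩, hp'⟩ := p'
  simp only [complEquiv_inl, complEquiv_inr] at h hp hp'
  have hsub : Set.range e' ⊆ Set.range e := by
    rintro _ ⟨b, rfl⟩
    have h1 : e' b ∈ (⊤ : Set (Fin n)) := trivial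
    rw [← hp.sup_eq_top] at h1
    rcases h1 with h1 | ⟨a, ha⟩
    · exact h1
    · have h2 := h a b
      rw [ha, UT.apply_self] at h2
      exact absurd h2 one_ne_zero
  have he : Set.range e' = Set.range e := by
    refine Set.eq_of_subset_of_ncard_le hsub ?_
    rw [← Set.image_univ, ← Set.image_univ, Set.ncard_image_of_injective _ e.injective,
      Set.ncard_image_of_injective _ e'.injective]
  have hf : Set.range f' = Set.range f := by
    rw [hp.symm.eq_compl, hp'.symm.eq_compl, he]
  obtain rfl := OrderEmbedding.range_inj.1 he
  obtain rfl := OrderEmbedding.range_inj.1 hf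
  rfl

/-- The Mackey formula for `UT_n`, with one double coset for each pair of complementary embeddings.
The number of choices for the free entries occurs in the numerator and in the denominator and
cancels. -/
theorem evalGL₂_comul_indUTGL (h : k + l = n) (φ : scf F n) (a : GLn F k) (b : GLn F l) :
    evalGL₂ a b ((glHopf F).comul (indUTGL F (DirectSum.lof ℂ ℕ (fun n => scf F n) n φ))) =
      (Fintype.card (UT F k) : ℂ)⁻¹ * (Fintype.card (UT F l) : ℂ)⁻¹ *
        ∑ x : GLn F k, ∑ y : GLn F l, ∑ p : TwoPartsOfCard k l n,
          extRes p.1.1 p.1.2 φ.val (x * a * x⁻¹) (y * b * y⁻¹) := by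
  have hq : ((Fintype.card F : ℂ) ^ (Fintype.card (Fin k) * Fintype.card (Fin l))) ≠ 0 :=
    pow_ne_zero _ card_ne_zero'
  let s₀ := complEquiv _ _ (isCompl_firstEmb_lastEmb h)
  rw [evalGL_comul_apply]
  simp only [evalGL_indUTGL s₀, ← Finset.mul_sum]
  rw [sum_conjSum_blockUpper (UT F n) s₀
    (fun p : TwoPartsOfCard k l n => complEquiv p.1.1 p.1.2 p.2) (exists_twoParts h s₀)
    (fun p p' u hu => twoParts_unique p p' ⟨u, hu⟩) _
    (fun x hx g => extendByZero_conj φ x hx g), mul_left_comm, inv_mul_cancel_left₀ hq,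
    Finset.mul_sum]
  have hone : ∀ g : GLn F n, (if g ∈ UT F n then (1 : ℂ) else 0) =
      extendByZero (UT F n) (fun _ => 1) g := by
    intro g
    unfold extendByZero
    split_ifs <;> rfl
  have hterm : ∀ p : TwoPartsOfCard k l n, (Fintype.card (UT F n) : ℂ)⁻¹ *
      (Fintype.card (UT F n) / (∑ x, ∑ y, ∑ u, if relabel (complEquiv p.1.1 p.1.2 p.2)
        (blockUpper x u y) ∈ UT F n then (1 : ℂ) else 0) *
      ∑ x, ∑ y, ∑ u, extendByZero (UT F n) φ.val (relabel (complEquiv p.1.1 p.1.2 p.2)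
        (blockUpper (x * a * x⁻¹) u (y * b * y⁻¹)))) =
      (Fintype.card (UT F k) : ℂ)⁻¹ * (Fintype.card (UT F l) : ℂ)⁻¹ *
        ∑ x : GLn F k, ∑ y : GLn F l,
          extRes p.1.1 p.1.2 φ.val (x * a * x⁻¹) (y * b * y⁻¹) := by
    intro p
    simp only [hone, sum_extendByZero_relabel, ← Finset.mul_sum]
    rw [sum_extRes_one _ _ p.2]
    have h1 := card_UT_ne_zero (F := F) (n := k)
    have h2 := card_UT_ne_zero (F := F) (n := l)
    have h3 := card_UT_ne_zero (F := F) (n := n)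
    have h4 : (Fintype.card (UpperPair p.1.1 p.1.2 → F) : ℂ) ≠ 0 :=
      Nat.cast_ne_zero.2 Fintype.card_ne_zero
    field_simp
  rw [Finset.sum_congr rfl fun p _ => hterm p, ← Finset.mul_sum, Finset.sum_comm]
  congr 1
  refine Finset.sum_congr rfl fun x _ => ?_
  rw [Finset.sum_comm]

theorem indUTGL_comul (x : ⨁ n, scf F n) :
    TensorProduct.map (indUTGL F) (indUTGL F) ((utHopf F).comul x) =
      (glHopf F).comul (indUTGL F x) := by
  induction x using homog_induction with
  | h0 => simp
  | hadd x y hx hy => simp only [map_add, hx, hy]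
  | h n x hx =>
    obtain ⟨φ, rfl⟩ := hx
    refine ((separates_evalGL F).tensor (separates_evalGL F)).ext ?_
    rintro ⟨⟨k, a⟩, l, b⟩
    change evalGL₂ a b _ = evalGL₂ a b _
    by_cases h : k + l = n
    · rw [evalGL₂_map_indUTGL h, evalGL₂_comul_indUTGL h]
    · rw [evalGL₂_map_indUTGL_of_ne h, evalGL_comul_apply, Finset.sum_eq_zero, mul_zero]
      intro u _
      exact evalGL_of_mem (by simpa using h) _ _ (indUTGL_mem n _ ⟨φ, rfl⟩)

variable (F) in
theorem isHopfHom_indUTGL : IsHopfHom (utHopf F) (glHopf F) (indUTGL F) where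
  map_homog := indUTGL_mem
  map_one := indUTGL_one
  map_mul := indUTGL_mul
  map_comul := indUTGL_comul
  map_counit := counit_indUTGL

end InductionComul

/-! ## The linear characters -/

section Functionals

/-- For an indicator `χ`, the functional `dualKet χ` is the average over its support, hence
evaluation at any point there when `φ` is constant on it. -/
theorem dualKet_indicator {G : Type*} [Group G] [Fintype G] (P : G → Prop) {χ : G → ℂ}
    (h1 : ∀ g, P g → χ g = 1) (h0 : ∀ g, ¬ P g → χ g = 0) (φ : G → ℂ) (x : G)
    (hx : P x) (h : ∀ g, P g → φ g = φ x) : dualKet χ φ = φ x := by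
  obtain rfl : χ = fun g => if P g then 1 else 0 := by
    funext g
    split_ifs with hg
    · exact h1 g hg
    · exact h0 g hg
  have h7 : (Finset.univ.filter P).card ≠ 0 :=
    (Finset.card_pos.2 ⟨x, Finset.mem_filter.2 ⟨Finset.mem_univ x, hx⟩⟩).ne'
  have h2 : ((Finset.univ.filter P).card : ℂ) ≠ 0 := Nat.cast_ne_zero.2 h7
  have h3 : (Fintype.card G : ℂ) ≠ 0 := Nat.cast_ne_zero.2 Fintype.card_ne_zero
  have h4 : ∀ ψ : G → ℂ, cfInner ψ (fun g => if P g then 1 else 0) =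
      (Fintype.card G : ℂ)⁻¹ * ∑ g ∈ Finset.univ.filter P, ψ g := by
    intro ψ
    rw [cfInner, Finset.sum_filter]
    congr 1
    refine Finset.sum_congr rfl fun g _ => ?_
    split_ifs <;> simp
  have h5 : ∑ g ∈ Finset.univ.filter P, φ g = (Finset.univ.filter P).card * φ x := by
    rw [Finset.sum_congr rfl fun g hg => h g (Finset.mem_filter.1 hg).2, Finset.sum_const,
      nsmul_eq_mul]
  have h6 : ∑ g ∈ Finset.univ.filter P, (if P g then (1 : ℂ) else 0) =
      (Finset.univ.filter P).card := by
    rw [Finset.sum_congr rfl fun g hg => if_pos (Finset.mem_filter.1 hg).2, Finset.sum_const,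
      nsmul_eq_mul, mul_one]
  change (cfInner _ _)⁻¹ * cfInner _ _ = _
  rw [h4, h4, h5, h6]
  field_simp

variable {F : Type*} [Field F] [Fintype F] {n : ℕ}

theorem glChar_lof (φ : cf (GLn F n)) :
    glChar F (DirectSum.lof ℂ ℕ (fun n => cf (GLn F n)) n φ) = φ.val (jordanBlock F n).val := by
  rw [glChar, DirectSum.toModule_lof]
  refine dualKet_indicator (fun g => ConjClasses.mk g = ConjClasses.mk (jordanBlock F n).val)
    (fun g hg => if_pos hg) (fun g hg => if_neg hg) φ.val _ rfl fun g hg => ?_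
  obtain ⟨x, hx⟩ := isConj_iff.1 (ConjClasses.mk_eq_mk_iff_isConj.1 hg)
  rw [← hx]
  exact (φ.property x g).symm

/-- An indifference graph with an edge has an edge between consecutive vertices, and the entry there
would have to vanish. -/
theorem inSuperclass_edgeless {u : UT F n}
    (h : ∀ i j : Fin n, (i : ℕ) + 1 = j → u.val.val i j ≠ 0) : InSuperclass (edgeless n) u := by
  refine ⟨fun i j hij => hij.elim, fun σ hσ hin => ?_⟩
  have hne : ¬ σ ≤ edgeless n := not_le_of_gt hσ
  apply hne
  have key : ∀ i j, i < j → ¬ σ.val.Adj i j := by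
    intro i j hij hadj
    have h1 : (i : ℕ) + 1 < n := lt_of_le_of_lt (Nat.succ_le_of_lt hij) j.isLt
    have h2 := σ.property i j hij hadj i ⟨i + 1, h1⟩ le_rfl (Fin.lt_def.2 (by simp))
      (Fin.le_def.2 (Nat.succ_le_of_lt hij))
    exact h i ⟨i + 1, h1⟩ rfl (hin _ _ h2)
  intro i j hij
  rcases lt_trichotomy i j with hlt | rfl | hlt
  · exact (key i j hlt hij).elim
  · exact (hij.ne rfl).elim
  · exact (key j i hlt hij.symm).elim

theorem jordanBlock_apply (i j : Fin n) :
    (jordanBlock F n).val.val i j = if i = j ∨ (i : ℕ) + 1 = j then 1 else 0 := rfl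

theorem inSuperclass_jordanBlock : InSuperclass (edgeless n) (jordanBlock F n) :=
  inSuperclass_edgeless fun i j hij => by
    rw [jordanBlock_apply, if_pos (Or.inr hij)]
    exact one_ne_zero

theorem utChar_lof (φ : scf F n) :
    utChar F (DirectSum.lof ℂ ℕ (fun n => scf F n) n φ) =
      ((Fintype.card F : ℂ) - 1) ^ n * φ.val (jordanBlock F n) := by
  rw [utChar, DirectSum.toModule_lof]
  refine congrArg (((Fintype.card F : ℂ) - 1) ^ n * ·) (dualKet_indicator (InSuperclass (edgeless n)) (fun g hg => if_pos hg)
    (fun g hg => if_neg hg) φ.val _ inSuperclass_jordanBlock fun g hg => ?_)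
  exact φ.property _ _ _ hg inSuperclass_jordanBlock

theorem block_firstEmb_jordanBlock {k l : ℕ} (h : k + l = n) :
    UT.block (firstEmb h) (jordanBlock F n) = jordanBlock F k :=
  Subtype.ext (Units.ext (Matrix.ext fun i j => by
    change (jordanBlock F n).val.val (firstEmb h i) (firstEmb h j) = _
    rw [jordanBlock_apply, jordanBlock_apply]
    exact if_congr (or_congr (firstEmb h).injective.eq_iff Iff.rfl) rfl rfl))

theorem block_lastEmb_jordanBlock {k l : ℕ} (h : k + l = n) :
    UT.block (lastEmb h) (jordanBlock F n) = jordanBlock F l :=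
  Subtype.ext (Units.ext (Matrix.ext fun i j => by
    change (jordanBlock F n).val.val (lastEmb h i) (lastEmb h j) = _
    rw [jordanBlock_apply, jordanBlock_apply]
    refine if_congr (or_congr (lastEmb h).injective.eq_iff ?_) rfl rfl
    change k + (i : ℕ) + 1 = k + j ↔ _
    omega))

/-- The diagonal blocks of a Jordan block are Jordan blocks, so evaluation at them is multiplicative
for inflation; the powers of `q - 1` multiply by degree. -/
theorem utChar_isLinearCharacter : (utHopf F).IsLinearCharacter (utChar F) where
  map_one := by
    refine (utChar_lof _).trans ?_
    simp
  map_mul x y := by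
    induction x using homog_induction with
    | h0 => simp
    | hadd x x' hx hx' => simp only [map_add, LinearMap.add_apply, hx, hx', add_mul]
    | h k x hx =>
      induction y using homog_induction with
      | h0 => simp
      | hadd y y' hy hy' => simp only [map_add, hy, hy', mul_add]
      | h l y hy =>
        obtain ⟨φ, rfl⟩ := hx
        obtain ⟨ψ, rfl⟩ := hy
        have h1 : (utHopf F).mul (DirectSum.lof ℂ ℕ (fun n => scf F n) k φ)
            (DirectSum.lof ℂ ℕ (fun n => scf F n) l ψ) =
            DirectSum.lof ℂ ℕ (fun n => scf F n) (k + l) (utMul F k l φ ψ) :=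
          gradedMul_lof (V := fun n => scf F n) (utMul F) k l φ ψ
        rw [h1, utChar_lof, utChar_lof, utChar_lof]
        change _ * (φ.val _ * ψ.val _) = _
        rw [block_firstEmb_jordanBlock, block_lastEmb_jordanBlock]
        ring

end Functionals

/-! ### Conjugates of a Jordan block -/

section RegularUnipotent

variable {F : Type*} [Field F]

/-- The characteristic polynomial of a nilpotent matrix over a field is a power of the variable;
Cayley–Hamilton concludes. -/
theorem pow_card_eq_zero_of_isNilpotent {ι : Type*} [Fintype ι] [DecidableEq ι]
    {M : Matrix ι ι F} (hM : IsNilpotent M) : M ^ Fintype.card ι = 0 := by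
  have h1 := (Matrix.isNilpotent_charpoly_sub_pow_of_isNilpotent hM).eq_zero
  have h2 := M.aeval_self_charpoly
  rw [sub_eq_zero.1 h1] at h2
  simpa using h2

theorem fromBlocks_pow {ι κ : Type*} [Fintype ι] [DecidableEq ι] [Fintype κ] [DecidableEq κ]
    (a : Matrix ι ι F) (u : Matrix ι κ F) (b : Matrix κ κ F) (m : ℕ) :
    ∃ v, fromBlocks a u 0 b ^ m = fromBlocks (a ^ m) v 0 (b ^ m) := by
  induction m with
  | zero => exact ⟨0, by simp⟩
  | succ m ih =>
    obtain ⟨v, hv⟩ := ih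
    rw [pow_succ, hv, fromBlocks_multiply]
    exact ⟨_, by simp only [Matrix.mul_zero, Matrix.zero_mul, add_zero, zero_add, pow_succ]; rfl⟩

variable [Fintype F] {n : ℕ}

theorem jordanBlock_sub_one_pow (m : ℕ) (i j : Fin n) :
    (((jordanBlock F n).val.val - 1) ^ m) i j = if (i : ℕ) + m = j then 1 else 0 := by
  induction m generalizing i with
  | zero => simp [Matrix.one_apply, Fin.ext_iff]
  | succ m ih =>
    have h1 : ∀ c, ((jordanBlock F n).val.val - 1) i c = if (i : ℕ) + 1 = c then 1 else 0 := by
      intro c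
      rw [Matrix.sub_apply, jordanBlock_apply, Matrix.one_apply]
      by_cases hic : i = c
      · subst hic
        simp
      · simp [hic]
    rw [pow_succ', Matrix.mul_apply]
    simp only [h1, ih, ite_mul, one_mul, zero_mul]
    by_cases hi : (i : ℕ) + 1 < n
    · rw [Finset.sum_eq_single ⟨i + 1, hi⟩]
      · simp only [if_true]
        exact if_congr (by omega) rfl rfl
      · intro c _ hc
        exact if_neg fun h => hc (Fin.ext h.symm)
      · simp
    · rw [Finset.sum_eq_zero, if_neg]
      · have := j.isLt
        omega
      · intro c _
        have := c.isLt
        rw [if_neg (by omega)]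

theorem conj_sub_one_pow {ι : Type*} [Fintype ι] [DecidableEq ι] (x g : GeneralLinearGroup ι F)
    (m : ℕ) : ((x * g * x⁻¹).val - 1) ^ m * x.val = x.val * (g.val - 1) ^ m := by
  have h : SemiconjBy x.val (g.val - 1) ((x * g * x⁻¹).val - 1) := by
    have h1 : (x * g * x⁻¹).val * x.val = x.val * g.val := by
      rw [← Units.val_mul, ← Units.val_mul]
      congr 1
      group
    rw [SemiconjBy, sub_mul, h1, mul_sub, one_mul, mul_one]
  exact (h.pow_right m).symm

/-- A unitriangular conjugate of a Jordan block has no zero entry next to the diagonal. -/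
theorem inSuperclass_of_conj_jordanBlock (x : GLn F n) (u : UT F n)
    (h : u.val = x * (jordanBlock F n).val * x⁻¹) : InSuperclass (edgeless n) u := by
  refine inSuperclass_edgeless fun p p' hp h0 => ?_
  have hn := p'.isLt
  -- A nonzero entry of the power comes from an increasing path of `m` steps from `i` to `j`. A path
  -- that crosses the gap after `p` cannot use the step from `p` to `p + 1`, where the entry is
  -- zero, so one of its steps has length at least two.
  have hpow : ∀ (m : ℕ) (i j : Fin n), ((u.val.val - 1) ^ m) i j ≠ 0 →
      (i : ℕ) + m ≤ j ∧ ((i : ℕ) ≤ p → (p : ℕ) < j → (i : ℕ) + m + 1 ≤ j) := by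
    intro m
    induction m with
    | zero =>
      intro i j hij
      have : i = j := by
        by_contra hne
        exact hij (by rw [pow_zero, Matrix.one_apply_ne hne])
      subst this
      omega
    | succ m ih =>
      intro i j hij
      rw [pow_succ, Matrix.mul_apply] at hij
      obtain ⟨c, -, hc⟩ := Finset.exists_ne_zero_of_sum_ne_zero hij
      obtain ⟨h1, h2⟩ := ih i c (left_ne_zero_of_mul hc)
      have h3 : (c : ℕ) < j := u.2 c j (right_ne_zero_of_mul hc)
      have h4 : ¬ ((c : ℕ) = p ∧ (j : ℕ) = p + 1) := by
        rintro ⟨h4, h5⟩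
        obtain rfl : c = p := Fin.ext h4
        obtain rfl : j = p' := Fin.ext (by omega)
        refine right_ne_zero_of_mul hc ?_
        rw [Matrix.sub_apply, h0, Matrix.one_apply_ne (ne_of_lt h3 <| congrArg Fin.val ·),
          sub_zero]
      omega
  -- Only the entry `(0, n - 1)` has room for `n - 1` steps, and a path between these indices
  -- crosses the gap. For the Jordan block this corner entry of the power is `1`.
  have hzero : (u.val.val - 1) ^ (n - 1) = 0 := by
    ext i j
    by_contra hne
    have := hpow _ i j hne
    have := i.isLt
    have := j.isLt
    omega
  have h1 := conj_sub_one_pow x (jordanBlock F n).val (n - 1)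
  rw [← h, hzero, zero_mul] at h1
  have h2 : ((jordanBlock F n).val.val - 1) ^ (n - 1) = 0 := by
    have := congrArg (x⁻¹.val * ·) h1.symm
    simpa [← Matrix.mul_assoc] using this
  have h3 := jordanBlock_sub_one_pow (F := F) (n := n) (n - 1) ⟨0, by omega⟩ ⟨n - 1, by omega⟩
  rw [h2, if_pos (by simp)] at h3
  exact zero_ne_one h3

/-- The only invariant subspaces of a Jordan block are those of the standard flag. -/
theorem exists_blockUpper_of_conj_jordanBlock {k l : ℕ}
    (x : GeneralLinearGroup (Fin k ⊕ Fin l) F)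
    (h : ∃ a u b, x * relabel (complEquiv _ _ (isCompl_firstEmb_lastEmb (rfl : k + l = k + l))).symm
      (jordanBlock F (k + l)).val * x⁻¹ = blockUpper a u b) :
    ∃ a u b, x = blockUpper a u b := by
  obtain ⟨a, u, b, hM⟩ := h
  let s := complEquiv _ _ (isCompl_firstEmb_lastEmb (rfl : k + l = k + l))
  let J := relabel s.symm (jordanBlock F (k + l)).val
  have hJpow : ∀ m c d, ((J.val - 1) ^ m) c d = if (s c : ℕ) + m = s d then 1 else 0 := by
    intro m c d
    have h1 : J.val - 1 = Matrix.reindexAlgEquiv F F s.symm ((jordanBlock F (k + l)).val.val - 1) := by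
      rw [map_sub, map_one]
      rfl
    rw [h1, ← map_pow]
    exact jordanBlock_sub_one_pow m (s c) (s d)
  have hMpow : ∀ m, ((blockUpper a u b).val - 1) ^ m * x.val = x.val * (J.val - 1) ^ m := by
    intro m
    rw [← hM]
    exact conj_sub_one_pow x J m
  have hblocks : (blockUpper a u b).val - 1 = fromBlocks (a.val - 1) u 0 (b.val - 1) := by
    rw [blockUpper_val]
    ext (i | i) (j | j) <;> simp [Matrix.sub_apply, Matrix.one_apply]
  have hxx : x.val * x⁻¹.val = 1 := x.mul_inv
  have hxx' : x⁻¹.val * x.val = 1 := x.inv_mul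
  have hnil : IsNilpotent (a.val - 1) := by
    refine ⟨k + l, ?_⟩
    obtain ⟨v, hv⟩ := fromBlocks_pow (a.val - 1) u (b.val - 1) (k + l)
    have hJ0 : (J.val - 1) ^ (k + l) = 0 := by
      ext c d
      rw [hJpow, if_neg]
      · rfl
      · have := (s d).isLt
        omega
    have h1 := hMpow (k + l)
    rw [hJ0, Matrix.mul_zero, hblocks, hv] at h1
    have h2 : fromBlocks ((a.val - 1) ^ (k + l)) v 0 ((b.val - 1) ^ (k + l)) = 0 := by
      have := congrArg (· * x⁻¹.val) h1
      simpa only [Matrix.mul_assoc, hxx, Matrix.mul_one, Matrix.zero_mul] using this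
    rw [← fromBlocks_zero, fromBlocks_inj] at h2
    exact h2.1
  -- The exponent is the size of `a`, so the first `k` columns of the `k`-th power of `blockUpper a
  -- u b - 1` vanish.
  have hk : (a.val - 1) ^ k = 0 := by
    simpa using pow_card_eq_zero_of_isNilpotent hnil
  obtain ⟨v, hv⟩ := fromBlocks_pow (a.val - 1) u (b.val - 1) k
  have hcomm : x⁻¹.val * fromBlocks 0 v 0 ((b.val - 1) ^ k) = (J.val - 1) ^ k * x⁻¹.val := by
    have h1 := hMpow k
    rw [hblocks, hv, hk] at h1
    calc _ = x⁻¹.val * (fromBlocks 0 v 0 ((b.val - 1) ^ k) * x.val) * x⁻¹.val := by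
          rw [Matrix.mul_assoc, Matrix.mul_assoc, hxx, Matrix.mul_one]
      _ = x⁻¹.val * (x.val * (J.val - 1) ^ k) * x⁻¹.val := by rw [h1]
      _ = _ := by rw [← Matrix.mul_assoc x⁻¹.val, hxx', Matrix.one_mul]
  -- Row `i` of `(J - 1) ^ k` is the basis vector at position `i + k`. Reading `hcomm` in that row
  -- and in the first `k` columns shows that the lower left block of `x⁻¹` vanishes.
  have hinv : ∃ a u b, x⁻¹ = blockUpper a u b := by
    refine exists_blockUpper _ ?_
    ext i j
    let c : Fin k ⊕ Fin l := s.symm ⟨i, by omega⟩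
    have h1 := congrFun (congrFun hcomm c) (Sum.inl j)
    have hL : (x⁻¹.val * fromBlocks (0 : Matrix (Fin k) (Fin k) F) v 0 ((b.val - 1) ^ k) :
        Matrix (Fin k ⊕ Fin l) (Fin k ⊕ Fin l) F) c (Sum.inl j) = 0 := by
      rw [Matrix.mul_apply]
      refine Finset.sum_eq_zero ?_
      rintro (d | d) - <;> simp
    have hR : ((J.val - 1) ^ k * x⁻¹.val) c (Sum.inl j) = x⁻¹.val (Sum.inr i) (Sum.inl j) := by
      rw [Matrix.mul_apply, Finset.sum_eq_single (Sum.inr i)]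
      · rw [hJpow, if_pos, one_mul]
        simp only [c, Equiv.apply_symm_apply]
        change (i : ℕ) + k = k + i
        omega
      · intro d _ hd
        rw [hJpow, if_neg, zero_mul]
        simp only [c, Equiv.apply_symm_apply]
        intro hcd
        apply hd
        apply s.injective
        apply Fin.ext
        change _ = k + (i : ℕ)
        omega
      · simp
    rw [hL, hR] at h1
    exact h1.symm
  obtain ⟨a', u', b', h'⟩ := hinv
  exact ⟨_, _, _, by rw [← inv_inv x, h', blockUpper_inv]⟩

end RegularUnipotent

/-! ### Multiplicativity at Jordan blocks and comparison of the two characters -/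

section Characters

variable {F : Type*} [Field F] [Fintype F]

/-- Only block upper triangular `x` conjugate the Jordan block to a block upper triangular matrix.
For such `x` the diagonal blocks of the conjugate are conjugate to the smaller Jordan blocks, so all
terms are equal, and their number is the normalizing factor. -/
theorem glMul_jordanBlock {k l : ℕ} (φ : cf (GLn F k)) (ψ : cf (GLn F l)) :
    (glMul F k l φ ψ).val (jordanBlock F (k + l)).val =
      φ.val (jordanBlock F k).val * ψ.val (jordanBlock F l).val := by
  let s := complEquiv _ _ (isCompl_firstEmb_lastEmb (rfl : k + l = k + l))
  obtain ⟨v, hv⟩ : ∃ v, relabel s.symm (jordanBlock F (k + l)).val =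
      blockUpper (jordanBlock F k).val v (jordanBlock F l).val := by
    rw [← hasBlocks_relabel_iff _ _ (isCompl_firstEmb_lastEmb (rfl : k + l = k + l)),
      relabel_relabel_symm]
    refine ⟨congrArg (fun u : UT F k => u.val.val) (block_firstEmb_jordanBlock rfl),
      congrArg (fun u : UT F l => u.val.val) (block_lastEmb_jordanBlock rfl), ?_⟩
    ext i j
    refine UT.apply_of_lt (jordanBlock F (k + l)) (Fin.lt_def.2 ?_)
    change (j : ℕ) < k + i
    omega
  have h1 : conjSum (glInfl F φ.val ψ.val) (jordanBlock F (k + l)).val =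
      conjSum (infl fun a b => φ.val a * ψ.val b)
        (relabel s.symm (jordanBlock F (k + l)).val) := by
    conv_lhs => rw [← relabel_relabel_symm s (jordanBlock F (k + l)).val]
    rw [conjSum_mulEquiv]
    congr 1
    funext g
    exact glInfl_relabel _ _ g
  rw [glMul_val, h1, conjSum, sum_eq_sum_blockUpper]
  · have h2 : ∀ a u b, infl (fun a b => φ.val a * ψ.val b) (blockUpper a u b *
        relabel s.symm (jordanBlock F (k + l)).val * (blockUpper a u b)⁻¹) =
        φ.val (jordanBlock F k).val * ψ.val (jordanBlock F l).val := by
      intro a u b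
      obtain ⟨w, hw⟩ := blockUpper_conj a (jordanBlock F k).val u v b (jordanBlock F l).val
      rw [hv, hw, infl_blockUpper, φ.property, ψ.property]
    simp only [h2, Finset.sum_const, Finset.card_univ, nsmul_eq_mul, card_matrix_eq]
    have h3 := parCard_ne_zero (F := F) (ι := Fin k) (κ := Fin l)
    rw [inv_mul_eq_iff_eq_mul₀ h3, parCard]
    ring
  · intro x hx
    refine infl_eq_zero _ _ fun h => hx ?_
    exact exists_blockUpper_of_conj_jordanBlock x h

theorem glChar_isLinearCharacter : (glHopf F).IsLinearCharacter (glChar F) where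
  map_one := glChar_lof _
  map_mul x y := by
    induction x using homog_induction with
    | h0 => simp
    | hadd x x' hx hx' => simp only [map_add, LinearMap.add_apply, hx, hx', add_mul]
    | h k x hx =>
      induction y using homog_induction with
      | h0 => simp
      | hadd y y' hy hy' => simp only [map_add, hy, hy', mul_add]
      | h l y hy =>
        obtain ⟨φ, rfl⟩ := hx
        obtain ⟨ψ, rfl⟩ := hy
        rw [glHopf_mul_lof, glChar_lof, glChar_lof, glChar_lof, glMul_jordanBlock]

variable (F) in
/-- The constant function `1` on `UT_n`. -/
def utOne (n : ℕ) : scf F n := ⟨fun _ => 1, fun _ _ _ _ _ => rfl⟩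

/-- All unitriangular conjugates of the Jordan block lie in one superclass, where `φ` is constant;
this constant factors out of the sum that defines induction. -/
theorem glChar_indUTGL_lof {n : ℕ} (φ : scf F n) :
    glChar F (indUTGL F (DirectSum.lof ℂ ℕ (fun n => scf F n) n φ)) =
      glChar F (indUTGL F (DirectSum.lof ℂ ℕ (fun n => scf F n) n (utOne F n))) *
        φ.val (jordanBlock F n) := by
  rw [indUTGL_lof, indUTGL_lof, glChar_lof, glChar_lof]
  change indFun _ _ _ = indFun _ _ _ * _
  rw [indFun, indFun, mul_assoc, Finset.sum_mul]
  congr 1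
  refine Finset.sum_congr rfl fun x _ => ?_
  by_cases h : x * (jordanBlock F n).val * x⁻¹ ∈ UT F n
  · rw [extendByZero, extendByZero, dif_pos h, dif_pos h]
    refine Eq.trans ?_ (one_mul _).symm
    exact φ.property _ _ _ (inSuperclass_of_conj_jordanBlock x ⟨_, h⟩ rfl) inSuperclass_jordanBlock
  · rw [extendByZero_of_notMem _ h, extendByZero_of_notMem _ h, zero_mul]

/-- The constant function in degree `n + 1` is the product of those in degrees `n` and `1`. Since
`indUTGL` and `glChar` are multiplicative, only degree one remains, where `UT_1` is trivial and the
induced value is the order `q - 1` of `GL_1`. -/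
theorem glChar_indUTGL_utOne (n : ℕ) :
    glChar F (indUTGL F (DirectSum.lof ℂ ℕ (fun n => scf F n) n (utOne F n))) =
      ((Fintype.card F : ℂ) - 1) ^ n := by
  induction n with
  | zero =>
    have h : glChar F (indUTGL F (utHopf F).one) = 1 := by
      rw [indUTGL_one, glChar_isLinearCharacter.map_one]
    rw [pow_zero, ← h]
    rfl
  | succ n ih =>
    have h1 : (utHopf F).mul (DirectSum.lof ℂ ℕ (fun n => scf F n) n (utOne F n))
        (DirectSum.lof ℂ ℕ (fun n => scf F n) 1 (utOne F 1)) =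
        DirectSum.lof ℂ ℕ (fun n => scf F n) (n + 1) (utOne F (n + 1)) := by
      refine (gradedMul_lof (V := fun n => scf F n) (utMul F) n 1 _ _).trans ?_
      congr 1
      exact Subtype.ext (funext fun _ => mul_one 1)
    have h2 : glChar F (indUTGL F (DirectSum.lof ℂ ℕ (fun n => scf F n) 1 (utOne F 1))) =
        (Fintype.card F : ℂ) - 1 := by
      have hsub : ∀ u : UT F 1, u = 1 := fun u => Subtype.ext (Units.ext (Matrix.ext fun i j => by
        obtain rfl := Subsingleton.elim i j
        rw [UT.apply_self]
        exact (Matrix.one_apply_eq i).symm))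
      have hcard : Fintype.card (UT F 1) = 1 := Fintype.card_eq_one_iff.2 ⟨1, hsub⟩
      have hGL : (Fintype.card (GLn F 1) : ℂ) = Fintype.card F - 1 := by
        have := Matrix.card_GL_field (𝔽 := F) 1
        rw [Nat.card_eq_fintype_card] at this
        rw [this]
        simp only [Finset.univ_unique, Finset.prod_singleton, pow_one, Fin.default_eq_zero, Fin.val_zero,
          pow_zero]
        rw [Nat.cast_sub (Nat.one_le_iff_ne_zero.2 Fintype.card_ne_zero), Nat.cast_one]
      rw [indUTGL_lof, glChar_lof]
      change indFun _ _ _ = _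
      rw [indFun, hcard, hsub (jordanBlock F 1)]
      have h3 : ∀ x : GLn F 1, extendByZero (UT F 1) (utOne F 1).val
          (x * (1 : UT F 1).val * x⁻¹) = 1 := by
        intro x
        have : x * (1 : UT F 1).val * x⁻¹ = (1 : UT F 1).val := by simp
        rw [this, extendByZero_val]
        rfl
      simp only [h3, Finset.sum_const, Finset.card_univ, nsmul_eq_mul, hGL]
      simp
    rw [← h1, indUTGL_mul, glChar_isLinearCharacter.map_mul, ih, h2, pow_succ]

variable (F) in
theorem utChar_eq : utChar F = glChar F ∘ₗ indUTGL F := by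
  refine DirectSum.linearMap_ext ℂ fun n => LinearMap.ext fun φ => ?_
  change utChar F (DirectSum.lof ℂ ℕ (fun n => scf F n) n φ) =
    glChar F (indUTGL F (DirectSum.lof ℂ ℕ (fun n => scf F n) n φ))
  rw [utChar_lof, glChar_indUTGL_lof, glChar_indUTGL_utOne]

end Characters

end ClassFunctionHopf

end

theorem theorem3p3 (F : Type*) [Field F] [Fintype F] :
    (ClassFunctionHopf.utHopf F).IsLinearCharacter (ClassFunctionHopf.utChar F) ∧
    ClassFunctionHopf.utChar F = ClassFunctionHopf.glChar F ∘ₗ ClassFunctionHopf.indUTGL F ∧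
    ClassFunctionHopf.IsCHAMorphism
      (ClassFunctionHopf.utHopf F) (ClassFunctionHopf.utChar F)
      (ClassFunctionHopf.glHopf F) (ClassFunctionHopf.glChar F)
      (ClassFunctionHopf.indUTGL F) := by
  exact ⟨ClassFunctionHopf.utChar_isLinearCharacter, ClassFunctionHopf.utChar_eq F,
    ⟨ClassFunctionHopf.utHopf_isHopf F, ClassFunctionHopf.utChar_isLinearCharacter⟩,
    ⟨ClassFunctionHopf.glHopf_isHopf F, ClassFunctionHopf.glChar_isLinearCharacter⟩,
    ClassFunctionHopf.isHopfHom_indUTGL F, ClassFunctionHopf.utChar_eq F⟩
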